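/- Let $n\ge 2$, let $q$ be an indeterminate and let $\mathcal F=\bigoplus_{\lambda}\mathbf Q(q)\,s_\lambda$ be the vector space with basis the partitions $\lambda$, where $s_\lambda=|\lambda\rangle$; we identify $\mathcal F$ with the space of symmetric functions over $\mathbf Q(q)$, $s_\lambda$ being a Schur function, with the scalar product for which $(s_\lambda)$ is orthonormal. Young diagrams are drawn with the largest part at the bottom. Ribbon tableaux. An $n$-ribbon is a connected skew diagram with $n$ cells that contains no $2\times 2$ square; its initial cell is its rightmost and bottommost cell, its height $h(R)$ is the number of rows it meets, and its spin is $s(R)=(h(R)-1)/2$. A skew diagram $\beta/\alpha$ is a horizontal $n$-ribbon strip of weight $m$ if it can be tiled by $m$ $n$-ribbons whose initial cells are each the bottom cell of their column in $\beta/\alpha$ (such a tiling is unique). An $n$-ribbon tableau of shape $\lambda/\nu$ and weight $\mu=(\mu_1,\dots,\mu_r)$ is a chain of partitions $\nu=\alpha^0\subset\alpha^1\subset\dots\subset\alpha^r=\lambda$ such that $\alpha^i/\alpha^{i-1}$ is a horizontal $n$-ribbon strip of weight $\mu_i$; its spin $s(T)$ is the sum of the spins of its ribbons. Let $\mathrm{Tab}_n(\lambda/\nu,\mu)$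 be the set of these tableaux, and put $$\psi^n_q(h_\mu)=\sum_{\lambda}\ \sum_{T\in\mathrm{Tab}_n(\lambda,\mu)}(-q)^{-2s(T)}\,s_\lambda .$$ The Hayashi action. $U_q(\widehat{\mathfrak{sl}}_n)$ is the $\mathbf Q(q)$-algebra generated by $e_i,f_i$ $(i\in\mathbf Z/n)$ and $q^h$ $(h\in P^\vee=\bigoplus_i\mathbf Z h_i\oplus\mathbf Z D)$, subject to the relations $$q^hq^{h'}=q^{h+h'},\quad q^0=1,\quad q^he_jq^{-h}=q^{\langle\alpha_j,h\rangle}e_j,\quad q^hf_jq^{-h}=q^{-\langle\alpha_j,h\rangle}f_j,\quad [e_i,f_j]=\delta_{ij}\frac{q^{h_i}-q^{-h_i}}{q-q^{-1}}$$ and the $q$-Serre relations $\sum_{k=0}^{m}(-1)^k\left[{m\atop k}\right]x_i^{m-k}x_jx_i^k=0$ for $i\ne j$, $m=1-\langle\alpha_i,h_j\rangle$, $x=e$ and $x=f$ (symmetric $q$-binomial coefficients), where $\langle\alpha_j,h_i\rangle=2\delta_{ij}-\delta_{i,j-1}-\delta_{i,j+1}$ (indices modulo $n$) and $\langle\alpha_j,D\rangle=\delta_{j0}$;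 $U_q'(\widehat{\mathfrak{sl}}_n)$ is its subalgebra generated by the $e_i$, $f_i$, $q^{\pm h_i}$. The residue of the cell in row $b$ and column $a$ is $a-b$ modulo $n$; an indent (resp. removable) $i$-node of $\lambda$ is a cell of residue $i$ that can be added to (resp. removed from) $\lambda$. Let $N_i(\lambda)$ be the number of indent $i$-nodes minus the number of removable $i$-nodes of $\lambda$; if $\nu/\lambda$ is a single cell $\gamma$ of residue $i$, let $N_i^l(\lambda,\nu)$ and $N_i^r(\lambda,\nu)$ be the same difference for the nodes of $\lambda$ strictly to the left, resp. strictly to the right, of $\gamma$; let $N^0(\lambda)$ be the number of cells of $\lambda$ of residue $0$. Then $U_q(\widehat{\mathfrak{sl}}_n)$ acts on $\mathcal F$ by $$q^{h_i}s_\lambda=q^{N_i(\lambda)}s_\lambda,\quad q^Ds_\lambda=q^{-N^0(\lambda)}s_\lambda,\quad f_is_\lambda=\sum_\nu q^{N_i^r(\lambda,\nu)}s_\nu,\quad e_is_\nu=\sum_\lambda q^{-N_i^l(\lambda,\nu)}s_\lambda ,$$ the last two sums being over the $\nu$ (resp. $\lambda$) such that $\nu/\lambda$ is a single cell of residue $i$.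 A highest weight vector is a vector annihilated by all $e_i$. Theorem. For $k\ge1$ define linear operators on $\mathcal F$ by $$V_ks_\lambda=\sum_\mu\Big(\sum_{T\in\mathrm{Tab}_n(\mu/\lambda,(k))}(-q)^{-2s(T)}\Big)s_\mu,\qquad U_ks_\lambda=\sum_\nu\Big(\sum_{T\in\mathrm{Tab}_n(\lambda/\nu,(k))}(-q)^{-2s(T)}\Big)s_\nu .$$ Then $V_k$ is a $q$-analogue of $f\mapsto\psi^n(h_k)f$, that is, at $q=1$ it becomes multiplication by $\psi^n(h_k)=h_k(x_1^n,x_2^n,\dots)$; and $U_k$ is the adjoint of $V_k$. The operators $U_k$ and $V_k$ commute with the action of $U_q'(\widehat{\mathfrak{sl}}_n)$, while $q^DV_k=q^{-k}V_kq^D$ and $q^DU_k=q^kU_kq^D$. In particular, for all positive integers $\mu_1,\dots,\mu_r$, $$\psi^n_q(h_\mu)=V_{\mu_r}\cdots V_{\mu_1}|0\rangle$$ (where $|0\rangle$ is the basis vector of the empty partition) is a highest weight vector. -/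

import Mathlib

namespace RibbonFock

/-! ## Young diagrams

A partition is a `YoungDiagram`. The cell `(r, c)` lies in row `r` and column `c`; row `0` is the
largest part and is drawn at the bottom, so that increasing `r` goes up and increasing `c` goes to
the right. -/

theorem finite_le (lam : YoungDiagram) : {nu : YoungDiagram | nu ≤ lam}.Finite := by
  refine Set.Finite.of_finite_image (f := YoungDiagram.cells)
    ((lam.cells.powerset.finite_toSet).subset ?_) ?_
  · rintro _ ⟨nu, h, rfl⟩
    exact Finset.mem_coe.2 (Finset.mem_powerset.2 (YoungDiagram.cells_subset_iff.2 h))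
  · intro a _ b _ h
    exact YoungDiagram.ext h

theorem lt_card_of_mem {mu : YoungDiagram} {x : ℕ × ℕ} (hx : x ∈ mu.cells) :
    x.1 < mu.card ∧ x.2 < mu.card := by
  obtain ⟨r, c⟩ := x
  constructor
  · have h : ((Finset.range (r + 1)).image fun i => (i, c)) ⊆ mu.cells := by
      intro y hy
      obtain ⟨i, hi, rfl⟩ := Finset.mem_image.1 hy
      exact mu.up_left_mem (by simpa [Nat.lt_succ_iff] using hi) le_rfl hx
    have h2 := Finset.card_le_card h
    rw [Finset.card_image_of_injective _ (fun a b hab => (Prod.mk.inj hab).1)] at h2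
    simpa using h2
  · have h : ((Finset.range (c + 1)).image fun j => (r, j)) ⊆ mu.cells := by
      intro y hy
      obtain ⟨i, hi, rfl⟩ := Finset.mem_image.1 hy
      exact mu.up_left_mem le_rfl (by simpa [Nat.lt_succ_iff] using hi) hx
    have h2 := Finset.card_le_card h
    rw [Finset.card_image_of_injective _ (fun a b hab => (Prod.mk.inj hab).2)] at h2
    simpa using h2

theorem finite_card_eq (m : ℕ) : {mu : YoungDiagram | mu.card = m}.Finite := by
  refine Set.Finite.of_finite_image (f := YoungDiagram.cells)
    (((Finset.range m ×ˢ Finset.range m).powerset.finite_toSet).subset ?_) ?_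
  · rintro _ ⟨mu, h, rfl⟩
    refine Finset.mem_coe.2 (Finset.mem_powerset.2 fun x hx => ?_)
    have h1 := lt_card_of_mem hx
    have h2 : mu.card = m := h
    rw [h2] at h1
    exact Finset.mem_product.2 ⟨Finset.mem_range.2 h1.1, Finset.mem_range.2 h1.2⟩
  · intro a _ b _ h
    exact YoungDiagram.ext h

/-- The finite set of all partitions of `m`. -/
noncomputable def diagramsOfSize (m : ℕ) : Finset YoungDiagram := (finite_card_eq m).toFinset

/-- The finite set of all partitions contained in `lam`. -/
noncomputable def subdiagrams (lam : YoungDiagram) : Finset YoungDiagram := (finite_le lam).toFinset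

/-! ## Ribbons, horizontal ribbon strips, ribbon tableaux -/

/-- `R` is an `n`-ribbon with initial (rightmost and bottommost) cell `x`: it is swept out by a
path of `n` cells that starts at `x` and goes one step up or one step to the left each time. -/
def IsRibbon (n : ℕ) (x : ℕ × ℕ) (R : Finset (ℕ × ℕ)) : Prop :=
  ∃ p : ℕ → ℕ × ℕ, p 0 = x ∧
    (∀ t, t + 1 < n →
      ((p (t + 1)).1 = (p t).1 + 1 ∧ (p (t + 1)).2 = (p t).2) ∨
      ((p (t + 1)).1 = (p t).1 ∧ (p (t + 1)).2 + 1 = (p t).2)) ∧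
    R = (Finset.range n).image p

/-- The height of a ribbon: the number of rows that it meets. -/
def height (R : Finset (ℕ × ℕ)) : ℕ := (R.image Prod.fst).card

/-- `tiles` is a tiling of the skew shape `bet / alp` by `m` `n`-ribbons that makes it a horizontal
`n`-ribbon strip of weight `m`: the initial cell of each ribbon is the bottom cell of its column
in the skew shape (it lies in row `0`, or the cell below it belongs to `alp`). -/
structure IsStripTiling (n m : ℕ) (alp bet : YoungDiagram)
    (tiles : Finset (Finset (ℕ × ℕ))) : Prop where
  le : alp ≤ bet
  card_eq : tiles.card = m
  disjoint : ∀ R ∈ tiles, ∀ S ∈ tiles, R ≠ S → Disjoint R S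
  cover : tiles.biUnion id = bet.cells \ alp.cells
  initial : ∀ R ∈ tiles, ∃ r c : ℕ, IsRibbon n (r, c) R ∧ (r = 0 ∨ (r - 1, c) ∈ alp)

/-- `n`-ribbon tableaux of shape `lam / nu` and weight `mu = (mu_1, …, mu_r)`: chains of partitions
from `nu` to `lam` such that the `i`-th step is a horizontal `n`-ribbon strip of weight `mu_i`,
together with the (unique) tilings of the steps by `n`-ribbons. -/
@[ext]
structure RibbonTableau (n : ℕ) (lam nu : YoungDiagram) (mu : List ℕ) where
  shape : Fin (mu.length + 1) → YoungDiagram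
  tiles : Fin mu.length → Finset (Finset (ℕ × ℕ))
  shape_zero : shape 0 = nu
  shape_last : shape (Fin.last mu.length) = lam
  isStrip : ∀ i : Fin mu.length,
    IsStripTiling n (mu.get i) (shape i.castSucc) (shape i.succ) (tiles i)

instance (n : ℕ) (lam nu : YoungDiagram) (mu : List ℕ) : Finite (RibbonTableau n lam nu mu) := by
  have hle : ∀ (T : RibbonTableau n lam nu mu) i, T.shape i ≤ lam := by
    intro T i
    have hmono : Monotone T.shape := Fin.monotone_iff_le_succ.2 fun j => (T.isStrip j).le
    exact (hmono (Fin.le_last i)).trans_eq T.shape_last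
  have htile : ∀ (T : RibbonTableau n lam nu mu) i,
      T.tiles i ∈ lam.cells.powerset.powerset := by
    intro T i
    refine Finset.mem_powerset.2 fun R hR => Finset.mem_powerset.2 fun x hx => ?_
    have h1 : x ∈ (T.tiles i).biUnion id := Finset.mem_biUnion.2 ⟨R, hR, hx⟩
    rw [(T.isStrip i).cover] at h1
    exact YoungDiagram.cells_subset_iff.2 (hle T i.succ) (Finset.mem_sdiff.1 h1).1
  have : Finite {kap : YoungDiagram | kap ≤ lam} := finite_le lam
  let g : RibbonTableau n lam nu mu →
      (Fin (mu.length + 1) → {kap : YoungDiagram | kap ≤ lam}) ×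
      (Fin mu.length → lam.cells.powerset.powerset) :=
    fun T => (fun i => ⟨T.shape i, hle T i⟩, fun i => ⟨T.tiles i, htile T i⟩)
  refine Finite.of_injective g fun S T h => ?_
  have h1 := congrArg Prod.fst h
  have h2 := congrArg Prod.snd h
  refine RibbonTableau.ext (funext fun i => ?_) (funext fun i => ?_)
  · exact congrArg Subtype.val (congrFun h1 i)
  · exact congrArg Subtype.val (congrFun h2 i)

noncomputable instance (n : ℕ) (lam nu : YoungDiagram) (mu : List ℕ) :
    Fintype (RibbonTableau n lam nu mu) := Fintype.ofFinite _

/-- Twice the spin of a ribbon tableau; the spin of a ribbon `R` is `(h(R) - 1) / 2`, and the spin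
of a tableau is the sum of the spins of its ribbons. -/
def RibbonTableau.twiceSpin {n : ℕ} {lam nu : YoungDiagram} {mu : List ℕ}
    (T : RibbonTableau n lam nu mu) : ℕ :=
  ∑ i, ∑ R ∈ T.tiles i, (height R - 1)

/-! ## Fock space and the operators `V_k`, `U_k` -/

/-- The Fock space: the vector space with basis the partitions. Its basis vector
`|lam⟩ = Finsupp.single lam 1` is also denoted by `s_lam`. -/
abbrev Fock (K : Type) [Field K] : Type := YoungDiagram →₀ K

section
variable {K : Type} [Field K]

/-- The sum of `(-q)^(-2 s(T))` over the `n`-ribbon tableaux `T` of shape `lam / nu` and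
weight `mu`. -/
noncomputable def spinSum (n : ℕ) (q : K) (lam nu : YoungDiagram) (mu : List ℕ) : K :=
  ∑ T : RibbonTableau n lam nu mu, (-q) ^ (-(T.twiceSpin : ℤ))

/-- `V_k s_lam = ∑_mu (∑_{T ∈ Tab_n(mu/lam, (k))} (-q)^(-2 s(T))) s_mu`; only partitions `mu` of
size `|lam| + n k` can contribute. -/
noncomputable def V (n : ℕ) (q : K) (k : ℕ) : Module.End K (Fock K) :=
  Finsupp.linearCombination K fun lam : YoungDiagram =>
    ∑ mu ∈ diagramsOfSize (lam.card + n * k), Finsupp.single mu (spinSum n q mu lam [k])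

/-- `U_k s_lam = ∑_nu (∑_{T ∈ Tab_n(lam/nu, (k))} (-q)^(-2 s(T))) s_nu`; only partitions `nu`
contained in `lam` can contribute. -/
noncomputable def U (n : ℕ) (q : K) (k : ℕ) : Module.End K (Fock K) :=
  Finsupp.linearCombination K fun lam : YoungDiagram =>
    ∑ nu ∈ subdiagrams lam, Finsupp.single nu (spinSum n q lam nu [k])

/-- `ψ^n_q(h_mu) = ∑_{T ∈ Tab_n(·, mu)} (-q)^(-2 s(T)) s_T`, where `s_T = s_lam` if `T` has shape
`lam`; only partitions `lam` of size `n |mu|` can contribute. -/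
noncomputable def psiH (n : ℕ) (q : K) (mu : List ℕ) : Fock K :=
  ∑ lam ∈ diagramsOfSize (n * mu.sum), Finsupp.single lam (spinSum n q lam ⊥ mu)

/-- The scalar product for which the `s_lam` form an orthonormal basis. -/
noncomputable def scalarProduct (f g : Fock K) : K := f.sum fun lam a => a * g lam

end

/-! ## Nodes and Hayashi's operators -/

/-- The residue of a cell: column minus row modulo `n`. -/
def residue (n : ℕ) (x : ℕ × ℕ) : ZMod n := (x.2 : ZMod n) - (x.1 : ZMod n)

/-- An indent node: a cell that can be added. -/
def IsIndent (lam : YoungDiagram) (x : ℕ × ℕ) : Prop :=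
  x ∉ lam ∧ IsLowerSet ((insert x lam.cells : Finset (ℕ × ℕ)) : Set (ℕ × ℕ))

/-- A removable node: a cell that can be removed. -/
def IsRemovable (lam : YoungDiagram) (x : ℕ × ℕ) : Prop :=
  x ∈ lam ∧ IsLowerSet ((lam.cells.erase x : Finset (ℕ × ℕ)) : Set (ℕ × ℕ))

theorem finite_indent (lam : YoungDiagram) : {x | IsIndent lam x}.Finite := by
  refine ((Finset.range (lam.card + 1) ×ˢ Finset.range (lam.card + 1)).finite_toSet).subset ?_
  rintro x ⟨h1, h2⟩
  have h3 := lt_card_of_mem (mu := ⟨insert x lam.cells, h2⟩) (x := x) (Finset.mem_insert_self _ _)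
  have h4 : (⟨insert x lam.cells, h2⟩ : YoungDiagram).card = lam.card + 1 :=
    Finset.card_insert_of_notMem h1
  rw [h4] at h3
  exact Finset.mem_coe.2 (Finset.mem_product.2 ⟨Finset.mem_range.2 h3.1, Finset.mem_range.2 h3.2⟩)

open Classical in
/-- The indent `i`-nodes of `lam`. -/
noncomputable def indentNodes (n : ℕ) (i : ZMod n) (lam : YoungDiagram) : Finset (ℕ × ℕ) :=
  (finite_indent lam).toFinset.filter fun x => residue n x = i

open Classical in
/-- The removable `i`-nodes of `lam`. -/
noncomputable def removableNodes (n : ℕ) (i : ZMod n) (lam : YoungDiagram) : Finset (ℕ × ℕ) :=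
  lam.cells.filter fun x => IsRemovable lam x ∧ residue n x = i

open Classical in
/-- `lam` with the indent node `x` added (only used for indent nodes). -/
noncomputable def addNode (lam : YoungDiagram) (x : ℕ × ℕ) : YoungDiagram :=
  if h : IsLowerSet ((insert x lam.cells : Finset (ℕ × ℕ)) : Set (ℕ × ℕ)) then
    ⟨insert x lam.cells, h⟩ else lam

open Classical in
/-- `lam` with the removable node `x` removed (only used for removable nodes). -/
noncomputable def removeNode (lam : YoungDiagram) (x : ℕ × ℕ) : YoungDiagram :=
  if h : IsLowerSet ((lam.cells.erase x : Finset (ℕ × ℕ)) : Set (ℕ × ℕ)) then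
    ⟨lam.cells.erase x, h⟩ else lam

/-- `N_i(lam)`: the number of indent minus the number of removable `i`-nodes. -/
noncomputable def nodeCount (n : ℕ) (i : ZMod n) (lam : YoungDiagram) : ℤ :=
  (indentNodes n i lam).card - (removableNodes n i lam).card

/-- `N_i^l`: the same count, restricted to the nodes of `lam` to the left of the node `x`. -/
noncomputable def nodeCountLeft (n : ℕ) (i : ZMod n) (lam : YoungDiagram) (x : ℕ × ℕ) : ℤ :=
  ((indentNodes n i lam).filter fun y => y.2 < x.2).card
    - ((removableNodes n i lam).filter fun y => y.2 < x.2).card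

/-- `N_i^r`: the same count, restricted to the nodes of `lam` to the right of the node `x`. -/
noncomputable def nodeCountRight (n : ℕ) (i : ZMod n) (lam : YoungDiagram) (x : ℕ × ℕ) : ℤ :=
  ((indentNodes n i lam).filter fun y => x.2 < y.2).card
    - ((removableNodes n i lam).filter fun y => x.2 < y.2).card

/-- `N^0(lam)`: the number of cells of `lam` of residue `0`. -/
def zeroCount (n : ℕ) (lam : YoungDiagram) : ℕ :=
  (lam.cells.filter fun x => residue n x = 0).card

section
variable {K : Type} [Field K]

/-- `q^{h_i} |lam⟩ = q^{N_i(lam)} |lam⟩`. -/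
noncomputable def fockH (n : ℕ) (q : K) (i : ZMod n) : Module.End K (Fock K) :=
  Finsupp.linearCombination K fun lam : YoungDiagram =>
    Finsupp.single lam (q ^ nodeCount n i lam)

/-- `q^D |lam⟩ = q^{-N^0(lam)} |lam⟩`. -/
noncomputable def fockD (n : ℕ) (q : K) : Module.End K (Fock K) :=
  Finsupp.linearCombination K fun lam : YoungDiagram =>
    Finsupp.single lam (q ^ (-(zeroCount n lam : ℤ)))

/-- `f_i |lam⟩ = ∑ q^{N_i^r(lam, nu)} |nu⟩`, sum over the `nu` such that `nu / lam` is an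
`i`-node `x`. -/
noncomputable def fockF (n : ℕ) (q : K) (i : ZMod n) : Module.End K (Fock K) :=
  Finsupp.linearCombination K fun lam : YoungDiagram =>
    ∑ x ∈ indentNodes n i lam,
      Finsupp.single (addNode lam x) (q ^ nodeCountRight n i lam x)

/-- `e_i |nu⟩ = ∑ q^{-N_i^l(lam, nu)} |lam⟩`, sum over the `lam` such that `nu / lam` is an
`i`-node `x`. -/
noncomputable def fockE (n : ℕ) (q : K) (i : ZMod n) : Module.End K (Fock K) :=
  Finsupp.linearCombination K fun nu : YoungDiagram =>
    ∑ x ∈ removableNodes n i nu,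
      Finsupp.single (removeNode nu x) (q ^ (-nodeCountLeft n i (removeNode nu x) x))

end

/-! ## The quantum affine algebra -/

/-- The lattice `P^∨`, with basis `h_i` (`i ∈ ℤ/n`) and `D`; here `n ≥ 1`. -/
abbrev Coweight (n : ℕ) : Type := (ZMod n → ℤ) × ℤ

/-- `h_i`. -/
def coroot (n : ℕ) (i : ZMod n) : Coweight n := (Pi.single i 1, 0)

/-- `D`. -/
def scaling (n : ℕ) : Coweight n := (0, 1)

/-- `⟨alpha_j, h⟩`, where `alpha_j = 2 Λ_j - Λ_{j-1} - Λ_{j+1} + δ_{j0} δ`. -/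
def rootPairing (n : ℕ) (j : ZMod n) (h : Coweight n) : ℤ :=
  2 * h.1 j - h.1 (j - 1) - h.1 (j + 1) + if j = 0 then h.2 else 0

/-- The generators `e_i`, `f_i`, `q^h`. -/
inductive Gen (n : ℕ) : Type
  | e (i : ZMod n)
  | f (i : ZMod n)
  | t (h : Coweight n)

section
variable {K : Type} [Field K]

/-- The symmetric `q`-integer `[k]`. -/
def qInt (q : K) (k : ℕ) : K := (q ^ k - q⁻¹ ^ k) / (q - q⁻¹)

/-- The symmetric `q`-factorial `[k]!`. -/
def qFactorial (q : K) (k : ℕ) : K := ∏ j ∈ Finset.range k, qInt q (j + 1)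

/-- The symmetric `q`-binomial coefficient. -/
def qBinomial (q : K) (m k : ℕ) : K := qFactorial q m / (qFactorial q (m - k) * qFactorial q k)

/-- The `q`-Serre element `∑_k (-1)^k [m choose k] x^{m-k} y x^k`. -/
def serre {A : Type} [Ring A] [Algebra K A] (q : K) (m : ℕ) (x y : A) : A :=
  ∑ k ∈ Finset.range (m + 1), ((-1) ^ k * qBinomial q m k) • (x ^ (m - k) * y * x ^ k)

/-- `1 - ⟨alpha_i, h_j⟩`, a natural number for `i ≠ j`. -/
def serreOrder (n : ℕ) (i j : ZMod n) : ℕ := (1 - rootPairing n i (coroot n j)).toNat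

/-- The defining relations of `U_q(sl_n^)`. -/
inductive UqRel (n : ℕ) (q : K) : FreeAlgebra K (Gen n) → FreeAlgebra K (Gen n) → Prop
  | t_add (h h' : Coweight n) :
      UqRel n q (FreeAlgebra.ι K (.t h) * FreeAlgebra.ι K (.t h')) (FreeAlgebra.ι K (.t (h + h')))
  | t_zero : UqRel n q (FreeAlgebra.ι K (.t 0)) 1
  | t_e (h : Coweight n) (j : ZMod n) :
      UqRel n q (FreeAlgebra.ι K (.t h) * FreeAlgebra.ι K (.e j) * FreeAlgebra.ι K (.t (-h)))
        (q ^ rootPairing n j h • FreeAlgebra.ι K (.e j))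
  | t_f (h : Coweight n) (j : ZMod n) :
      UqRel n q (FreeAlgebra.ι K (.t h) * FreeAlgebra.ι K (.f j) * FreeAlgebra.ι K (.t (-h)))
        (q ^ (-rootPairing n j h) • FreeAlgebra.ι K (.f j))
  | e_f_same (i : ZMod n) :
      UqRel n q
        (FreeAlgebra.ι K (.e i) * FreeAlgebra.ι K (.f i)
          - FreeAlgebra.ι K (.f i) * FreeAlgebra.ι K (.e i))
        ((q - q⁻¹)⁻¹ •
          (FreeAlgebra.ι K (.t (coroot n i)) - FreeAlgebra.ι K (.t (-coroot n i))))
  | e_f_ne (i j : ZMod n) (hij : i ≠ j) :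
      UqRel n q
        (FreeAlgebra.ι K (.e i) * FreeAlgebra.ι K (.f j)
          - FreeAlgebra.ι K (.f j) * FreeAlgebra.ι K (.e i)) 0
  | serre_e (i j : ZMod n) (hij : i ≠ j) :
      UqRel n q
        (serre q (serreOrder n i j) (FreeAlgebra.ι K (.e i)) (FreeAlgebra.ι K (.e j))) 0
  | serre_f (i j : ZMod n) (hij : i ≠ j) :
      UqRel n q
        (serre q (serreOrder n i j) (FreeAlgebra.ι K (.f i)) (FreeAlgebra.ι K (.f j))) 0

/-- The quantum affine algebra `U_q(sl_n^)`. -/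
abbrev Uq (n : ℕ) (q : K) : Type := RingQuot (UqRel n q)

/-- The generators of `U_q(sl_n^)`. -/
noncomputable def gen (n : ℕ) (q : K) (g : Gen n) : Uq n q :=
  RingQuot.mkAlgHom K (UqRel n q) (FreeAlgebra.ι K g)

/-- The subalgebra `U_q'(sl_n^)` generated by all `e_i`, `f_i` and `q^{± h_i}`, that is, by all
generators except those that involve `D`. -/
noncomputable def UqDerived (n : ℕ) (q : K) : Subalgebra K (Uq n q) :=
  Algebra.adjoin K (gen n q ''
    {g | (∃ i, g = .e i) ∨ (∃ i, g = .f i) ∨ (∃ i, g = .t (coroot n i) ∨ g = .t (-coroot n i))})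

/-- `rho` is the Hayashi action of `U_q(sl_n^)` on the Fock space. -/
structure IsHayashiAction (n : ℕ) (q : K) (rho : Uq n q →ₐ[K] Module.End K (Fock K)) : Prop where
  e : ∀ i, rho (gen n q (.e i)) = fockE n q i
  f : ∀ i, rho (gen n q (.f i)) = fockF n q i
  h : ∀ i, rho (gen n q (.t (coroot n i))) = fockH n q i
  D : rho (gen n q (.t (scaling n))) = fockD n q

/-- A highest weight vector: a vector annihilated by all raising operators `e_i`. -/
def IsHighestWeightVector (n : ℕ) (q : K) (rho : Uq n q →ₐ[K] Module.End K (Fock K))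
    (v : Fock K) : Prop :=
  ∀ i, rho (gen n q (.e i)) v = 0

end

/-! ## Schur polynomials -/

/-- The Schur polynomial `s_lam(x_1, …, x_N) = det (h_{lam_i - i + j})`. -/
noncomputable def schur (N : ℕ) (lam : YoungDiagram) : MvPolynomial (Fin N) ℚ :=
  Matrix.det (Matrix.of fun i j : Fin (lam.colLen 0) =>
    if (i : ℕ) ≤ lam.rowLen i + j then
      MvPolynomial.hsymm (Fin N) ℚ (lam.rowLen i + j - i) else 0)

/-- The linear map from the Fock space over `ℚ` to symmetric polynomials, `|lam⟩ ↦ s_lam`. -/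
noncomputable def toSym (N : ℕ) : Fock ℚ →ₗ[ℚ] MvPolynomial (Fin N) ℚ :=
  Finsupp.linearCombination ℚ (schur N)

end RibbonFock

/-! A partition is encoded by its beads, the vertical steps of its boundary; row `r` of length `λ_r`
gives a bead at `λ_r - r`. Adding an `n`-ribbon with contents `p, …, p + n - 1` means moving a bead
from `p` to the empty position `p + n`, and the height of the ribbon minus one is the number of
beads jumped over. Let `J_p` be this move with weight `(-q)⁻¹` for each bead jumped over (`opJump`).
In a horizontal ribbon strip the ribbon with the rightmost initial cell can be taken off, and
conversely a ribbon further to the right can be put on (`IsStripTiling.exists_erase`,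
`IsStripTiling.insert_tile`). So the tilings of strips of weight `k` are the sequences of jumps at
`p_1 < … < p_k`, and `V_k` is the coefficient of `X^k` in the ordered product of the factors `1 + X
J_p`, with larger `p` to the left (`V_single_eq_jumpPoly`). This product and the Chevalley operators
are infinite, so they are treated as limits of finite expressions in operators on the space of all
bead configurations (`IsLimit`); identities between the approximants pass to the limits.

Commutation. The operators `e_i` and `f_i` move beads between `a` and `a + 1` for `a ≡ i`. Finite
truncations of them commute with `J_p` unless `p ≡ i` or `p ≡ i + 1`. For `p ≡ i` two consecutive
factors multiply to `1 + X (J_p + J_{p+1}) + X² J_{p+1} J_p`, and the truncations commute with both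
coefficients (`trunc_commute_pair`). This reduces to the positions `p, p + 1, p + n, p + n + 1`,
where the sixteen occupations are checked; the weight `-q⁻¹` of a bead jumped over cancels the power
of `q` in the Chevalley operator. Grouping the product into blocks of `n` factors that start at
residue `i` gives the claim for `V_k` (`C_commute_jumpPoly`, `V_commute_of_isLimit`).

The operators `U_k` have the transposed matrix coefficients (`isAdjoint_V_U`). The adjoint of `f_i`
is `q⁻¹ q^{h_i} e_i` and that of `e_i` is `q f_i q^{-h_i}`, so commutation with `U_k` follows by
taking adjoints. The statements on `D` hold because an `n`-ribbon has exactly one cell of residue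
`0`. The vacuum is killed by all `e_i`, hence so is every vector obtained from it by operators
`V_k`.

That Hayashi's formulas define an action is checked on the truncations. The commutator of `e_i` and
`f_i` is a telescoping sum (`sum_telescope`). In the Serre relations the summands of one Chevalley
operator `q`-commute with each other and with a single summand of another one, except at the two
neighbouring positions; what remains is an identity in a few noncommuting variables
(`serre_of_family`).

At `q = 1` a bead configuration is read as a wedge product of vectors `φ(b)`, one for each bead, and
the weight of a jump becomes the sign of reordering. Then `1 + z J_p` replaces `φ(p)` by `φ(p) + z
φ(p + n)` (`wedgeMap_jump`). If `φ(b) = ψ(b) - z ψ(b + n)`, the ordered product turns every `φ(b)`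
back into `ψ(b)` (`wedgeSum_jumpPoly`). With `ψ(b)` the vector of powers of the variables, wedge
products are alternants and the passage from `ψ` to `φ` multiplies them by `∏ (1 - z x_k^n)`, whose
inverse is the generating function of the `h_k(x_1^n, x_2^n, …)`. An alternant is a Jacobi-Trudi
determinant times a nonzero factor independent of the partition (`alternant_eq`), which is
cancelled. -/

namespace RibbonFock

/-! ## Profiles and beads -/

/-- The content of a cell. -/
def content (x : ℕ × ℕ) : ℤ := (x.2 : ℤ) - x.1

/-- The cells of `lam` of content `d`. -/
def diagonal (lam : YoungDiagram) (d : ℤ) : Finset (ℕ × ℕ) :=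
  lam.cells.filter fun x => content x = d

/-- The row of the first cell of content `d` outside `lam`. -/
def prof (lam : YoungDiagram) (d : ℤ) : ℤ := (diagonal lam d).card + max 0 (-d)

/-- A diagonal meets a lower set in an initial segment, so the number of cells on the diagonal
locates its first cell outside. -/
theorem mem_iff_lt_prof (lam : YoungDiagram) (r c : ℕ) :
    (r, c) ∈ lam ↔ (r : ℤ) < prof lam ((c : ℤ) - r) := by
  set d : ℤ := (c : ℤ) - r with hd
  set m : ℕ := (max 0 (-d)).toNat with hm
  set S : Finset ℕ := (diagonal lam d).image Prod.fst with hS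
  have hcard : S.card = (diagonal lam d).card := by
    refine Finset.card_image_of_injOn ?_
    intro x hx y hy hxy
    have h1 := (Finset.mem_filter.1 (Finset.mem_coe.1 hx)).2
    have h2 := (Finset.mem_filter.1 (Finset.mem_coe.1 hy)).2
    simp only [content] at h1 h2
    refine Prod.ext hxy ?_
    omega
  have hmem : ∀ t : ℕ, t ∈ S ↔ m ≤ t ∧ (t, ((t : ℤ) + d).toNat) ∈ lam := by
    intro t
    constructor
    · intro ht
      obtain ⟨⟨a, b⟩, hx, hab⟩ := Finset.mem_image.1 ht
      obtain ⟨h1, h2⟩ := Finset.mem_filter.1 hx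
      simp only [content] at h2
      dsimp only at hab
      subst hab
      refine ⟨by omega, ?_⟩
      have : ((a : ℤ) + d).toNat = b := by omega
      rw [this]
      exact h1
    · rintro ⟨h1, h2⟩
      refine Finset.mem_image.2 ⟨_, Finset.mem_filter.2 ⟨h2, ?_⟩, rfl⟩
      simp only [content]
      omega
  have hp : prof lam d = S.card + m := by
    simp only [prof, hcard]
    omega
  have hr : m ≤ r := by omega
  have hc : ((r : ℤ) + d).toNat = c := by omega
  have hrS : (r, c) ∈ lam ↔ r ∈ S := by rw [hmem, hc]; simp [hr]
  rw [hrS, hp]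
  constructor
  · intro h
    have hsub : Finset.Ico m (r + 1) ⊆ S := by
      intro t ht
      rw [Finset.mem_Ico] at ht
      rw [hmem]
      refine ⟨ht.1, ?_⟩
      rw [← hrS] at h
      exact lam.up_left_mem (by omega) (by omega) h
    have := Finset.card_le_card hsub
    simp at this
    omega
  · intro h
    by_contra hn
    have hsub : S ⊆ Finset.Ico m r := by
      intro t ht
      have h1 := (hmem t).1 ht
      rw [Finset.mem_Ico]
      refine ⟨h1.1, ?_⟩
      by_contra h2
      apply hn
      rw [← hrS]
      exact lam.up_left_mem (by omega) (by omega) h1.2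
    have := Finset.card_le_card hsub
    simp at this
    omega

theorem prof_nonneg (lam : YoungDiagram) (d : ℤ) : 0 ≤ prof lam d := by
  unfold prof; positivity

theorem neg_le_prof (lam : YoungDiagram) (d : ℤ) : -d ≤ prof lam d := by
  unfold prof; have := le_max_right 0 (-d); omega

theorem mem_iff_lt_prof' (lam : YoungDiagram) {r c : ℤ} (hr : 0 ≤ r) (hc : 0 ≤ c) :
    (r.toNat, c.toNat) ∈ lam ↔ r < prof lam (c - r) := by
  rw [mem_iff_lt_prof]
  rw [Int.toNat_of_nonneg hr, Int.toNat_of_nonneg hc]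

theorem mem_iff_content (lam : YoungDiagram) (x : ℕ × ℕ) :
    x ∈ lam ↔ (x.1 : ℤ) < prof lam (content x) := mem_iff_lt_prof lam x.1 x.2

/-- The left neighbour of a cell of `lam` again lies in `lam`. In the same way the cell below yields
`prof_pred_le`, so the profile moves by `0` or `1` at each step. -/
theorem prof_le_prof_pred (lam : YoungDiagram) (d : ℤ) : prof lam d ≤ prof lam (d - 1) := by
  by_contra h
  have h0 := prof_nonneg lam (d - 1)
  have h1 := neg_le_prof lam (d - 1)
  have h2 := (mem_iff_lt_prof' lam (r := prof lam d - 1) (c := prof lam d - 1 + d)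
    (by omega) (by omega)).2 (by ring_nf; omega)
  have h3 := lam.up_left_mem (i1 := (prof lam d - 1).toNat) le_rfl
    (show (prof lam d - 1 + d - 1).toNat ≤ _ by omega) h2
  rw [mem_iff_lt_prof' lam (by omega) (by omega)] at h3
  have h4 : prof lam d - 1 + d - 1 - (prof lam d - 1) = d - 1 := by ring
  rw [h4] at h3
  omega

theorem prof_pred_le (lam : YoungDiagram) (d : ℤ) : prof lam (d - 1) ≤ prof lam d + 1 := by
  by_contra h
  have h0 := prof_nonneg lam d
  have h1 := neg_le_prof lam d
  have h2 := (mem_iff_lt_prof' lam (r := prof lam (d - 1) - 1) (c := prof lam (d - 1) + d - 2)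
    (by omega) (by omega)).2 (by
      have h4 : prof lam (d - 1) + d - 2 - (prof lam (d - 1) - 1) = d - 1 := by ring
      rw [h4]; omega)
  have h3 := lam.up_left_mem (i1 := (prof lam (d - 1) - 2).toNat)
    (by omega) le_rfl h2
  rw [mem_iff_lt_prof' lam (by omega) (by omega)] at h3
  have h4 : prof lam (d - 1) + d - 2 - (prof lam (d - 1) - 2) = d := by ring
  rw [h4] at h3
  omega

theorem content_lt_card {lam : YoungDiagram} {x : ℕ × ℕ} (hx : x ∈ lam.cells) :
    content x < lam.card ∧ -(lam.card : ℤ) < content x := by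
  have := lt_card_of_mem hx
  unfold content
  omega

theorem diagonal_eq_empty {lam : YoungDiagram} {d : ℤ} (h : (lam.card : ℤ) ≤ |d|) :
    diagonal lam d = ∅ := by
  refine Finset.filter_eq_empty_iff.2 fun x hx hd => ?_
  have := content_lt_card hx
  rw [hd] at this
  have := abs_lt.2 ⟨this.2, this.1⟩
  omega

theorem prof_of_card_le {lam : YoungDiagram} {d : ℤ} (h : (lam.card : ℤ) ≤ d) :
    prof lam d = 0 := by
  have h1 := diagonal_eq_empty (lam := lam) (d := d) (h.trans (le_abs_self d))
  have : (0 : ℤ) ≤ lam.card := by positivity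
  simp [prof, h1]
  omega

theorem prof_of_le_neg_card {lam : YoungDiagram} {d : ℤ} (h : d ≤ -(lam.card : ℤ)) :
    prof lam d = -d := by
  have h2 : (lam.card : ℤ) ≤ -d := by omega
  have h1 := diagonal_eq_empty (lam := lam) (d := d) (h2.trans (neg_le_abs d))
  have : (0 : ℤ) ≤ lam.card := by positivity
  simp [prof, h1]
  omega

theorem prof_injective : Function.Injective prof := by
  intro lam mu h
  ext ⟨r, c⟩
  rw [YoungDiagram.mem_cells, YoungDiagram.mem_cells, mem_iff_lt_prof, mem_iff_lt_prof, h]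

theorem prof_mono {lam mu : YoungDiagram} : lam ≤ mu ↔ ∀ d, prof lam d ≤ prof mu d := by
  constructor
  · intro h d
    unfold prof
    have : (diagonal lam d).card ≤ (diagonal mu d).card :=
      Finset.card_le_card (Finset.filter_subset_filter _ (YoungDiagram.cells_subset_iff.2 h))
    omega
  · intro h x hx
    rw [mem_iff_content] at hx ⊢
    exact hx.trans_le (h _)

/-- There is a bead at `d` if and only if the boundary of `lam` has a vertical step there. -/
def bead (lam : YoungDiagram) (d : ℤ) : Bool := decide (prof lam d < prof lam (d - 1))

theorem prof_pred (lam : YoungDiagram) (d : ℤ) :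
    prof lam (d - 1) = prof lam d + (if bead lam d then 1 else 0) := by
  have h1 := prof_le_prof_pred lam d
  have h2 := prof_pred_le lam d
  unfold bead
  split_ifs with h
  · simp at h; omega
  · simp at h; omega

theorem prof_succ (lam : YoungDiagram) (d : ℤ) :
    prof lam d = prof lam (d + 1) + (if bead lam (d + 1) then 1 else 0) := by
  have := prof_pred lam (d + 1)
  rwa [add_sub_cancel_right] at this

theorem bead_eq_false_of_card_lt {lam : YoungDiagram} {d : ℤ} (h : (lam.card : ℤ) < d) :
    bead lam d = false := by
  have h1 := prof_of_card_le (lam := lam) (d := d) (by omega)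
  have h2 := prof_of_card_le (lam := lam) (d := d - 1) (by omega)
  simp [bead, h1, h2]

theorem bead_eq_true_of_le_neg_card {lam : YoungDiagram} {d : ℤ} (h : d ≤ -(lam.card : ℤ)) :
    bead lam d = true := by
  have h1 := prof_of_le_neg_card (lam := lam) (d := d) (by omega)
  have h2 := prof_of_le_neg_card (lam := lam) (d := d - 1) (by omega)
  simp [bead, h1, h2]

/-- Diagrams are determined by their beads, compared through profiles. -/
theorem prof_eq_of_step {lam : YoungDiagram} {g : ℤ → ℤ} {N : ℤ} (hN : ∀ d, N ≤ d → g d = 0)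
    (hg : ∀ d, g (d - 1) = g d + (if bead lam d then 1 else 0)) : prof lam = g := by
  funext d
  set M : ℤ := max (max N lam.card) d with hM
  have key : ∀ k : ℕ, prof lam (M - k) = g (M - k) := by
    intro k
    induction k with
    | zero =>
      rw [hN _ (by simp [hM]), prof_of_card_le (by simp [hM])]
    | succ k ih =>
      have e : M - ((k + 1 : ℕ) : ℤ) = M - k - 1 := by push_cast; ring
      rw [e, hg, prof_pred, ih]
  have := key (M - d).toNat
  have e : M - ((M - d).toNat : ℤ) = d := by
    have : d ≤ M := le_max_right _ _
    omega
  rwa [e] at this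

theorem bead_injective : Function.Injective bead := by
  intro lam mu h
  refine prof_injective (prof_eq_of_step (N := mu.card) (fun d hd => prof_of_card_le hd) ?_)
  intro d
  rw [prof_pred, h]

/-- Partitions are built from their profiles: the conditions are the boundary behaviour and the unit
steps that every profile has. The two step conditions make the cells below `g` a lower set, and the
boundary values make them finitely many. -/
theorem exists_prof_eq {g : ℤ → ℤ} (N : ℕ) (h0 : ∀ d, (N : ℤ) ≤ d → g d = 0)
    (h1 : ∀ d, d ≤ -(N : ℤ) → g d = -d) (hle : ∀ d, g d ≤ g (d - 1))
    (hge : ∀ d, g (d - 1) ≤ g d + 1) : ∃ lam : YoungDiagram, prof lam = g := by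
  classical
  have hanti : ∀ (d : ℤ) (k : ℕ), g (d + k) ≤ g d := by
    intro d k
    induction k with
    | zero => simp
    | succ k ih =>
      have := hle (d + (k + 1 : ℕ))
      have e : d + ((k + 1 : ℕ) : ℤ) - 1 = d + k := by push_cast; ring
      rw [e] at this
      exact this.trans ih
  have hlip : ∀ (d : ℤ) (k : ℕ), g d ≤ g (d + k) + k := by
    intro d k
    induction k with
    | zero => simp
    | succ k ih =>
      have := hge (d + (k + 1 : ℕ))
      have e : d + ((k + 1 : ℕ) : ℤ) - 1 = d + k := by push_cast; ring
      rw [e] at this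
      push_cast at this ⊢
      omega
  have hpos : ∀ d, 0 ≤ g d := by
    intro d
    have := hanti d (max (N - d) 0).toNat
    rw [h0 _ (by omega)] at this
    exact this
  have hneg : ∀ d, -d ≤ g d := by
    intro d
    set k := (max (d + N) 0).toNat
    have h2 := hlip (d - k) k
    rw [h1 (d - k) (by omega), sub_add_cancel] at h2
    omega
  have hbd : ∀ r c : ℕ, (r : ℤ) < g ((c : ℤ) - r) → r < N + N + 1 ∧ c < N + N + 1 := by
    intro r c h
    have a1 : ((c : ℤ) - r) < N := by
      by_contra hc
      rw [h0 _ (by omega)] at h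
      omega
    have a2 : -(N : ℤ) < ((c : ℤ) - r) := by
      by_contra hc
      rw [h1 _ (by omega)] at h
      omega
    have a3 := hanti (-(N : ℤ)) ((c : ℤ) - r + N).toNat
    have e : -(N : ℤ) + (((c : ℤ) - r + N).toNat : ℤ) = (c : ℤ) - r := by omega
    rw [e, h1 (-(N : ℤ)) le_rfl] at a3
    omega
  refine ⟨⟨(Finset.range (N + N + 1) ×ˢ Finset.range (N + N + 1)).filter
    fun x => (x.1 : ℤ) < g (content x), ?_⟩, ?_⟩
  · rintro ⟨r, c⟩ ⟨r', c'⟩ hle' hx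
    obtain ⟨hr, hc⟩ := Prod.mk_le_mk.1 hle'
    have hx2 : (r : ℤ) < g ((c : ℤ) - r) := (Finset.mem_filter.1 (Finset.mem_coe.1 hx)).2
    have b1 : (r' : ℤ) < g ((c' : ℤ) - r') := by
      have s1 := hanti ((c' : ℤ) - r) (c - c')
      have e1 : ((c' : ℤ) - r) + ((c - c' : ℕ) : ℤ) = (c : ℤ) - r := by omega
      rw [e1] at s1
      have s2 := hlip ((c' : ℤ) - r) (r - r')
      have e2 : ((c' : ℤ) - r) + ((r - r' : ℕ) : ℤ) = (c' : ℤ) - r' := by omega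
      rw [e2] at s2
      omega
    have b2 := hbd r' c' b1
    exact Finset.mem_coe.2 (Finset.mem_filter.2 ⟨by simpa using b2, b1⟩)
  · funext d
    set mu : YoungDiagram := ⟨(Finset.range (N + N + 1) ×ˢ Finset.range (N + N + 1)).filter
      fun x => (x.1 : ℤ) < g (content x), _⟩ with hmu
    have hmem : ∀ r c : ℕ, (r, c) ∈ mu ↔ (r : ℤ) < g ((c : ℤ) - r) := by
      intro r c
      rw [hmu, YoungDiagram.mem_mk, Finset.mem_filter]
      constructor
      · exact fun h => h.2
      · exact fun h => ⟨by simpa using hbd r c h, h⟩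
    have hz : ∀ r : ℤ, 0 ≤ r → 0 ≤ r + d → (r < prof mu d ↔ r < g d) := by
      intro r hr hc
      have h2 := mem_iff_lt_prof' mu hr hc
      have h3 := hmem r.toNat (r + d).toNat
      rw [Int.toNat_of_nonneg hr, Int.toNat_of_nonneg hc] at h3
      rw [h2] at h3
      simpa using h3
    have p1 := prof_nonneg mu d
    have p2 := neg_le_prof mu d
    have p3 := hpos d
    have p4 := hneg d
    rcases lt_trichotomy (prof mu d) (g d) with h | h | h
    · have := (hz (prof mu d) p1 (by omega)).2 h
      omega
    · exact h
    · have := (hz (g d) p3 (by omega)).1 h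
      omega

end RibbonFock

/-! ### Moving a bead, adding a cell, and counting nodes by content -/

namespace RibbonFock

theorem prof_anti (lam : YoungDiagram) {d d' : ℤ} (h : d ≤ d') : prof lam d' ≤ prof lam d := by
  obtain ⟨k, rfl⟩ := Int.le.dest h
  induction k with
  | zero => simp
  | succ k ih =>
    have h1 := prof_le_prof_pred lam (d + (k + 1 : ℕ))
    have e : d + ((k + 1 : ℕ) : ℤ) - 1 = d + k := by push_cast; ring
    rw [e] at h1
    exact h1.trans (ih (by omega))

theorem prof_le_add (lam : YoungDiagram) {d d' : ℤ} (h : d ≤ d') :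
    prof lam d ≤ prof lam d' + (d' - d) := by
  obtain ⟨k, rfl⟩ := Int.le.dest h
  induction k with
  | zero => simp
  | succ k ih =>
    have h1 := prof_pred_le lam (d + (k + 1 : ℕ))
    have e : d + ((k + 1 : ℕ) : ℤ) - 1 = d + k := by push_cast; ring
    rw [e] at h1
    have := ih (by omega)
    push_cast at this h1 ⊢
    omega

/-- The bead configuration `s` with the bead at `a` moved to `b`. -/
def moveBead (s : ℤ → Bool) (a b : ℤ) : ℤ → Bool :=
  Function.update (Function.update s a false) b true

/-- `mu` arises from `lam` by moving the bead at `p` to `p + n`. -/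
def IsJump (n : ℕ) (p : ℤ) (lam mu : YoungDiagram) : Prop :=
  ∀ d, prof mu d = prof lam d + if p ≤ d ∧ d < p + n then 1 else 0

/-- The profile is raised at `p` but not at `p - 1` and must stay weakly decreasing, so it had a
strict drop there. The target `p + n` is treated in the same way, with the bound on the size of a
drop. -/
theorem IsJump.bead_source {n : ℕ} (hn : 1 ≤ n) {p : ℤ} {lam mu : YoungDiagram}
    (h : IsJump n p lam mu) : bead lam p = true := by
  by_contra hb
  have h1 := h p
  have h2 := h (p - 1)
  have h3 := prof_pred lam p
  have h4 := prof_le_prof_pred mu p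
  rw [if_pos (by omega)] at h1
  rw [if_neg (by omega)] at h2
  rw [if_neg hb] at h3
  omega

theorem IsJump.bead_target {n : ℕ} (hn : 1 ≤ n) {p : ℤ} {lam mu : YoungDiagram}
    (h : IsJump n p lam mu) : bead lam (p + n) = false := by
  by_contra hb
  have h1 := h (p + n)
  have h2 := h (p + n - 1)
  have h3 := prof_pred lam (p + n)
  have h4 := prof_pred_le mu (p + n)
  rw [if_neg (by omega)] at h1
  rw [if_pos (by omega)] at h2
  rw [if_pos (by simpa using hb)] at h3
  omega

theorem IsJump.bead_eq {n : ℕ} (hn : 1 ≤ n) {p : ℤ} {lam mu : YoungDiagram}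
    (h : IsJump n p lam mu) : bead mu = moveBead (bead lam) p (p + n) := by
  funext d
  have hs := h.bead_source hn
  have ht := h.bead_target hn
  have h1 := h d
  have h2 := h (d - 1)
  have h3 := prof_pred lam d
  have h4 := prof_pred mu d
  unfold moveBead
  by_cases e1 : d = p + n
  · subst e1
    rw [Function.update_self]
    rw [ht] at h3
    rw [if_neg (by omega)] at h1
    rw [if_pos (by omega)] at h2
    by_contra hb
    rw [if_neg hb] at h4
    simp at h3
    omega
  · rw [Function.update_of_ne e1]
    by_cases e2 : d = p
    · subst e2
      rw [Function.update_self]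
      rw [hs] at h3
      rw [if_pos (by omega)] at h1
      rw [if_neg (by omega)] at h2
      by_contra hb
      rw [if_pos (by simpa using hb)] at h4
      simp at h3
      omega
    · rw [Function.update_of_ne e2]
      have e3 : (p ≤ d ∧ d < p + n) ↔ (p ≤ d - 1 ∧ d - 1 < p + n) := by omega
      simp only [e3] at h1
      have e4 : (if bead mu d = true then (1 : ℤ) else 0) = if bead lam d = true then 1 else 0 := by
        omega
      by_contra hb
      cases hx : bead lam d <;> cases hy : bead mu d <;> simp_all

theorem exists_isJump {n : ℕ} {p : ℤ} {lam : YoungDiagram} (hs : bead lam p = true)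
    (ht : bead lam (p + n) = false) : ∃ mu, IsJump n p lam mu := by
  have hlo : -(lam.card : ℤ) < p + n := by
    by_contra h
    rw [bead_eq_true_of_le_neg_card (by omega)] at ht
    simp at ht
  have hhi : p ≤ lam.card := by
    by_contra h
    rw [bead_eq_false_of_card_lt (by omega)] at hs
    simp at hs
  have hp := prof_pred lam p
  have hpn := prof_pred lam (p + n)
  rw [hs] at hp
  rw [ht] at hpn
  simp at hp hpn
  suffices h : ∃ mu, prof mu = fun d => prof lam d + if p ≤ d ∧ d < p + n then 1 else 0 from
    h.imp fun mu hmu d => by rw [hmu]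
  -- The known positions of beads and gaps give `-|lam| - n < p ≤ |lam|`, so beyond this bound the
  -- profile of `lam` is trivial and is not raised.
  refine exists_prof_eq (lam.card + n + n) ?_ ?_ ?_ ?_
  · intro d hd
    push_cast at hd
    rw [prof_of_card_le (by omega), if_neg (by omega), add_zero]
  · intro d hd
    push_cast at hd
    rw [prof_of_le_neg_card (by omega), if_neg (by omega), add_zero]
  · intro d
    have := prof_le_prof_pred lam d
    by_cases e : d = p
    · subst e
      split_ifs <;> omega
    · split_ifs <;> omega
  · intro d
    have := prof_pred_le lam d
    by_cases e : d = p + n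
    · subst e
      split_ifs <;> omega
    · split_ifs <;> omega

theorem exists_isJump_to {n : ℕ} {p : ℤ} {mu : YoungDiagram} (hs : bead mu p = false)
    (ht : bead mu (p + n) = true) : ∃ lam, IsJump n p lam mu := by
  have hlo : -(mu.card : ℤ) < p := by
    by_contra h
    rw [bead_eq_true_of_le_neg_card (by omega)] at hs
    simp at hs
  have hhi : p + n ≤ mu.card := by
    by_contra h
    rw [bead_eq_false_of_card_lt (by omega)] at ht
    simp at ht
  have hp := prof_pred mu p
  have hpn := prof_pred mu (p + n)
  rw [hs] at hp
  rw [ht] at hpn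
  simp at hp hpn
  obtain ⟨lam, hlam⟩ := exists_prof_eq
    (g := fun d => prof mu d - if p ≤ d ∧ d < p + n then 1 else 0)
    mu.card (by
      intro d hd
      rw [prof_of_card_le (by omega), if_neg (by omega), sub_zero]) (by
      intro d hd
      rw [prof_of_le_neg_card (by omega), if_neg (by omega), sub_zero]) (by
      intro d
      have := prof_le_prof_pred mu d
      by_cases e : d = p + n
      · subst e
        split_ifs <;> omega
      · split_ifs <;> omega) (by
      intro d
      have := prof_pred_le mu d
      by_cases e : d = p
      · subst e
        split_ifs <;> omega
      · split_ifs <;> omega)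
  exact ⟨lam, fun d => by rw [hlam]; ring⟩

theorem IsJump.right_unique {n : ℕ} {p : ℤ} {lam mu mu' : YoungDiagram} (h : IsJump n p lam mu)
    (h' : IsJump n p lam mu') : mu = mu' :=
  prof_injective (funext fun d => by rw [h d, h' d])

theorem IsJump.left_unique {n : ℕ} {p : ℤ} {lam lam' mu : YoungDiagram} (h : IsJump n p lam mu)
    (h' : IsJump n p lam' mu) : lam = lam' :=
  prof_injective (funext fun d => by have := h d; have := h' d; omega)

theorem IsJump.le {n : ℕ} {p : ℤ} {lam mu : YoungDiagram} (h : IsJump n p lam mu) : lam ≤ mu :=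
  prof_mono.2 fun d => by rw [h d]; split_ifs <;> omega

theorem prof_eq_add_of_cells {lam mu : YoungDiagram} (hle : lam ≤ mu) (d : ℤ) :
    prof mu d = prof lam d + ((mu.cells \ lam.cells).filter fun x => content x = d).card := by
  have h1 : diagonal mu d = diagonal lam d ∪
      (mu.cells \ lam.cells).filter fun x => content x = d := by
    unfold diagonal
    rw [← Finset.filter_union, Finset.union_sdiff_of_subset (YoungDiagram.cells_subset_iff.2 hle)]
  have h2 : Disjoint (diagonal lam d) ((mu.cells \ lam.cells).filter fun x => content x = d) :=
    Finset.disjoint_filter_filter Finset.disjoint_sdiff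
  unfold prof
  rw [h1, Finset.card_union_of_disjoint h2]
  push_cast
  ring

/-- The cell of content `d` in the row `r`. -/
def diagCell (r d : ℤ) : ℕ × ℕ := (r.toNat, (r + d).toNat)

theorem content_diagCell {r d : ℤ} (hr : 0 ≤ r) (hc : 0 ≤ r + d) : content (diagCell r d) = d := by
  simp only [content, diagCell]; omega

theorem diagCell_content (x : ℕ × ℕ) : diagCell x.1 (content x) = x := by
  refine Prod.ext ?_ ?_ <;> simp [diagCell, content]

theorem diagCell_mem {lam : YoungDiagram} {r d : ℤ} (hr : 0 ≤ r) (hc : 0 ≤ r + d) :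
    diagCell r d ∈ lam ↔ r < prof lam d := by
  rw [mem_iff_content, content_diagCell hr hc]
  simp [diagCell, Int.toNat_of_nonneg hr]

/-- `mu` arises from `lam` by adding the cell `x`. -/
def IsNode (lam mu : YoungDiagram) (x : ℕ × ℕ) : Prop :=
  x ∉ lam ∧ mu.cells = insert x lam.cells

/-- A cell is a ribbon of length one, so everything proved for jumps applies to nodes. The condition
on the row selects the one cell of the diagonal that can be added. -/
theorem isNode_iff (lam mu : YoungDiagram) (x : ℕ × ℕ) :
    IsNode lam mu x ↔ IsJump 1 (content x) lam mu ∧ (x.1 : ℤ) = prof lam (content x) := by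
  constructor
  · rintro ⟨h1, h2⟩
    have hle : lam ≤ mu := YoungDiagram.cells_subset_iff.1 (h2 ▸ Finset.subset_insert _ _)
    have hd : mu.cells \ lam.cells = {x} := by
      rw [h2]
      exact Finset.insert_sdiff_cancel h1
    have hj : IsJump 1 (content x) lam mu := by
      intro d
      rw [prof_eq_add_of_cells hle d, hd, Finset.filter_singleton]
      by_cases e : content x = d
      · rw [if_pos e, if_pos (by omega)]; simp
      · rw [if_neg e, if_neg (by omega)]; simp
    refine ⟨hj, ?_⟩
    have h3 : x ∈ mu := by
      rw [← YoungDiagram.mem_cells, h2]; exact Finset.mem_insert_self _ _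
    rw [mem_iff_content] at h1 h3
    rw [hj, if_pos (by omega)] at h3
    omega
  · rintro ⟨h1, h2⟩
    refine ⟨by rw [mem_iff_content]; omega, ?_⟩
    ext y
    rw [Finset.mem_insert, YoungDiagram.mem_cells, YoungDiagram.mem_cells, mem_iff_content,
      mem_iff_content, h1]
    constructor
    · intro h
      by_cases e : content x = content y
      · rw [if_pos (by omega)] at h
        by_cases e2 : x.1 = y.1
        · left
          rw [← diagCell_content x, ← diagCell_content y, e, e2]
        · right
          rw [← e] at h ⊢
          omega
      · rw [if_neg (by omega)] at h
        right
        omega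
    · rintro (rfl | h)
      · rw [if_pos (by omega)]; omega
      · split_ifs <;> omega

theorem isIndent_iff_exists (lam : YoungDiagram) (x : ℕ × ℕ) :
    IsIndent lam x ↔ ∃ mu, IsNode lam mu x := by
  constructor
  · rintro ⟨h1, h2⟩
    exact ⟨⟨_, h2⟩, h1, rfl⟩
  · rintro ⟨mu, h1, h2⟩
    exact ⟨h1, h2 ▸ mu.isLowerSet⟩

theorem IsNode.addNode_eq {lam mu : YoungDiagram} {x : ℕ × ℕ} (h : IsNode lam mu x) :
    addNode lam x = mu := by
  have h2 : IsLowerSet ((insert x lam.cells : Finset (ℕ × ℕ)) : Set (ℕ × ℕ)) :=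
    h.2 ▸ mu.isLowerSet
  unfold addNode
  rw [dif_pos h2]
  exact YoungDiagram.ext h.2.symm

theorem isRemovable_iff_exists (mu : YoungDiagram) (x : ℕ × ℕ) :
    IsRemovable mu x ↔ ∃ lam, IsNode lam mu x := by
  constructor
  · rintro ⟨h1, h2⟩
    exact ⟨⟨_, h2⟩, by simp [YoungDiagram.mem_mk], (Finset.insert_erase h1).symm⟩
  · rintro ⟨lam, h1, h2⟩
    refine ⟨?_, ?_⟩
    · rw [← YoungDiagram.mem_cells, h2]; exact Finset.mem_insert_self _ _
    · rw [h2, Finset.erase_insert h1]; exact lam.isLowerSet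

theorem IsNode.removeNode_eq {lam mu : YoungDiagram} {x : ℕ × ℕ} (h : IsNode lam mu x) :
    removeNode mu x = lam := by
  have e : mu.cells.erase x = lam.cells := by rw [h.2, Finset.erase_insert h.1]
  have h2 : IsLowerSet ((mu.cells.erase x : Finset (ℕ × ℕ)) : Set (ℕ × ℕ)) := by
    rw [e]; exact lam.isLowerSet
  unfold removeNode
  rw [dif_pos h2]
  exact YoungDiagram.ext e

theorem isIndent_iff (lam : YoungDiagram) (x : ℕ × ℕ) :
    IsIndent lam x ↔ bead lam (content x) = true ∧ bead lam (content x + 1) = false ∧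
      x = diagCell (prof lam (content x)) (content x) := by
  rw [isIndent_iff_exists]
  constructor
  · rintro ⟨mu, h⟩
    rw [isNode_iff] at h
    refine ⟨h.1.bead_source le_rfl, by simpa using h.1.bead_target le_rfl, ?_⟩
    rw [← h.2, diagCell_content]
  · rintro ⟨h1, h2, h3⟩
    obtain ⟨mu, hmu⟩ := exists_isJump (n := 1) h1 (by simpa using h2)
    refine ⟨mu, (isNode_iff _ _ _).2 ⟨hmu, ?_⟩⟩
    have := congrArg Prod.fst h3
    have h0 := prof_nonneg lam (content x)
    simp only [diagCell] at this
    omega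

theorem isRemovable_iff (mu : YoungDiagram) (x : ℕ × ℕ) :
    IsRemovable mu x ↔ bead mu (content x) = false ∧ bead mu (content x + 1) = true ∧
      x = diagCell (prof mu (content x) - 1) (content x) := by
  rw [isRemovable_iff_exists]
  constructor
  · rintro ⟨lam, h⟩
    rw [isNode_iff] at h
    have hb := h.1.bead_eq le_rfl
    have h1 := h.1 (content x)
    rw [if_pos (by omega)] at h1
    refine ⟨by simp [hb, moveBead], by simp [hb, moveBead], ?_⟩
    rw [h1, add_sub_cancel_right, ← h.2, diagCell_content]
  · rintro ⟨h1, h2, h3⟩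
    obtain ⟨lam, hlam⟩ := exists_isJump_to (n := 1) h1 (by simpa using h2)
    refine ⟨lam, (isNode_iff _ _ _).2 ⟨hlam, ?_⟩⟩
    have := congrArg Prod.fst h3
    have h0 := prof_nonneg lam (content x)
    have h4 := hlam (content x)
    rw [if_pos (by omega)] at h4
    simp only [diagCell] at this
    omega

theorem residue_eq (n : ℕ) (x : ℕ × ℕ) : residue n x = ((content x : ℤ) : ZMod n) := by
  simp [residue, content]

theorem mem_indentNodes {n : ℕ} {i : ZMod n} {lam : YoungDiagram} {x : ℕ × ℕ} :
    x ∈ indentNodes n i lam ↔ IsIndent lam x ∧ ((content x : ℤ) : ZMod n) = i := by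
  rw [indentNodes, Finset.mem_filter, residue_eq]
  simp

open Classical in
theorem mem_removableNodes {n : ℕ} {i : ZMod n} {lam : YoungDiagram} {x : ℕ × ℕ} :
    x ∈ removableNodes n i lam ↔ IsRemovable lam x ∧ ((content x : ℤ) : ZMod n) = i := by
  rw [removableNodes, Finset.mem_filter, residue_eq]
  exact ⟨fun h => h.2, fun h => ⟨h.1.1, h⟩⟩

/-- The contents `d` of residue `i` such that `|d| ≤ N`. -/
noncomputable def window (n : ℕ) (i : ZMod n) (N : ℕ) : Finset ℤ :=
  (Finset.Icc (-(N : ℤ)) N).filter fun d => (d : ZMod n) = i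

theorem mem_window {n : ℕ} {i : ZMod n} {N : ℕ} {d : ℤ} :
    d ∈ window n i N ↔ (-(N : ℤ) ≤ d ∧ d ≤ N) ∧ (d : ZMod n) = i := by
  simp [window]

/-- An indent node is determined by its content, and beyond `|lam|` the bead sequence is constant,
so a finite window of contents sees all nodes. -/
theorem sum_indentNodes {M : Type*} [AddCommMonoid M] {n : ℕ} {i : ZMod n} {lam : YoungDiagram}
    {N : ℕ} (hN : lam.card ≤ N) (g : ℕ × ℕ → M) :
    ∑ x ∈ indentNodes n i lam, g x = ∑ d ∈ window n i N,
      if bead lam d = true ∧ bead lam (d + 1) = false then g (diagCell (prof lam d) d) else 0 := by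
  rw [← Finset.sum_filter]
  refine Finset.sum_bij' (fun x _ => content x) (fun d _ => diagCell (prof lam d) d) ?_ ?_ ?_ ?_ ?_
  · intro x hx
    obtain ⟨h1, h2⟩ := mem_indentNodes.1 hx
    rw [isIndent_iff] at h1
    refine Finset.mem_filter.2 ⟨mem_window.2 ⟨⟨?_, ?_⟩, h2⟩, h1.1, h1.2.1⟩
    · by_contra hc
      have := bead_eq_true_of_le_neg_card (lam := lam) (d := content x + 1) (by omega)
      rw [h1.2.1] at this
      simp at this
    · by_contra hc
      have := bead_eq_false_of_card_lt (lam := lam) (d := content x) (by omega)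
      rw [h1.1] at this
      simp at this
  · intro d hd
    obtain ⟨h1, h2, h3⟩ := Finset.mem_filter.1 hd
    have hc := content_diagCell (d := d) (prof_nonneg lam d) (by have := neg_le_prof lam d; omega)
    refine mem_indentNodes.2 ⟨(isIndent_iff _ _).2 ?_, ?_⟩
    · rw [hc]; exact ⟨h2, h3, rfl⟩
    · rw [hc]; exact (mem_window.1 h1).2
  · intro x hx
    exact (((isIndent_iff _ _).1 (mem_indentNodes.1 hx).1).2.2).symm
  · intro d hd
    exact content_diagCell (prof_nonneg lam d) (by have := neg_le_prof lam d; omega)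
  · intro x hx
    rw [← ((isIndent_iff _ _).1 (mem_indentNodes.1 hx).1).2.2]

theorem prof_sub_one_bounds {lam : YoungDiagram} {d : ℤ} (h2 : bead lam d = false)
    (h3 : bead lam (d + 1) = true) : 0 ≤ prof lam d - 1 ∧ 0 ≤ prof lam d - 1 + d := by
  have e1 := prof_pred lam d
  have e2 := prof_succ lam d
  simp [h2] at e1
  simp [h3] at e2
  have e3 := prof_nonneg lam (d + 1)
  have e4 := neg_le_prof lam (d - 1)
  omega

theorem sum_removableNodes {M : Type*} [AddCommMonoid M] {n : ℕ} {i : ZMod n} {lam : YoungDiagram}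
    {N : ℕ} (hN : lam.card ≤ N) (g : ℕ × ℕ → M) :
    ∑ x ∈ removableNodes n i lam, g x = ∑ d ∈ window n i N,
      if bead lam d = false ∧ bead lam (d + 1) = true then g (diagCell (prof lam d - 1) d)
      else 0 := by
  rw [← Finset.sum_filter]
  refine Finset.sum_bij' (fun x _ => content x) (fun d _ => diagCell (prof lam d - 1) d)
    ?_ ?_ ?_ ?_ ?_
  · intro x hx
    obtain ⟨h1, h2⟩ := mem_removableNodes.1 hx
    have h3 := content_lt_card h1.1
    rw [isRemovable_iff] at h1
    exact Finset.mem_filter.2 ⟨mem_window.2 ⟨⟨by omega, by omega⟩, h2⟩, h1.1, h1.2.1⟩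
  · intro d hd
    obtain ⟨h1, h2, h3⟩ := Finset.mem_filter.1 hd
    have hb := prof_sub_one_bounds h2 h3
    have hc := content_diagCell (d := d) hb.1 hb.2
    refine mem_removableNodes.2 ⟨(isRemovable_iff _ _).2 ?_, ?_⟩
    · rw [hc]; exact ⟨h2, h3, rfl⟩
    · rw [hc]; exact (mem_window.1 h1).2
  · intro x hx
    exact (((isRemovable_iff _ _).1 (mem_removableNodes.1 hx).1).2.2).symm
  · intro d hd
    obtain ⟨h1, h2, h3⟩ := Finset.mem_filter.1 hd
    have hb := prof_sub_one_bounds h2 h3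
    exact content_diagCell hb.1 hb.2
  · intro x hx
    rw [← ((isRemovable_iff _ _).1 (mem_removableNodes.1 hx).1).2.2]

/-- The contribution of the position `m` to the count of indent minus removable nodes. -/
def stepAt (s : ℤ → Bool) (m : ℤ) : ℤ := (if s m then 1 else 0) - if s (m + 1) then 1 else 0

theorem stepAt_eq (s : ℤ → Bool) (m : ℤ) : stepAt s m =
    (if s m = true ∧ s (m + 1) = false then 1 else 0) -
      if s m = false ∧ s (m + 1) = true then 1 else 0 := by
  unfold stepAt
  cases s m <;> cases s (m + 1) <;> simp

/-- An indent node is a bead followed by a gap and a removable node is a gap followed by a bead, so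
their signed count is a difference of occupation numbers. Being linear in the occupation, it changes
in a simple way when a bead moves. -/
theorem nodeCount_eq {n : ℕ} (i : ZMod n) {lam : YoungDiagram} {N : ℕ} (hN : lam.card ≤ N) :
    nodeCount n i lam = ∑ m ∈ window n i N, stepAt (bead lam) m := by
  unfold nodeCount
  rw [Finset.card_eq_sum_ones, Finset.card_eq_sum_ones]
  push_cast
  rw [sum_indentNodes hN, sum_removableNodes hN, ← Finset.sum_sub_distrib]
  exact Finset.sum_congr rfl fun m _ => (stepAt_eq _ _).symm

theorem ne_add_one_of_residue {n : ℕ} (hn : 2 ≤ n) {d d' : ℤ} (h : (d : ZMod n) = d') :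
    d' ≠ d + 1 := by
  rintro rfl
  push_cast at h
  have h1 : ((1 : ℕ) : ZMod n) = 0 := by simpa using h
  rw [ZMod.natCast_eq_zero_iff] at h1
  have := Nat.le_of_dvd one_pos h1
  omega

/-- Columns grow weakly with the content along the boundary, and strictly between two indent nodes.
This replaces "left" and "right" in Hayashi's formulas by the order of contents. -/
theorem indent_col_iff {lam : YoungDiagram} {d d' : ℤ}
    (h2 : bead lam (d + 1) = false)
    (h2' : bead lam (d' + 1) = false) :
    (diagCell (prof lam d) d).2 < (diagCell (prof lam d') d').2 ↔ d < d' := by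
  have a1 := prof_succ lam d
  have a2 := prof_succ lam d'
  simp [h2] at a1
  simp [h2'] at a2
  have b1 := neg_le_prof lam d
  have b2 := neg_le_prof lam d'
  simp only [diagCell]
  rcases lt_trichotomy d d' with h | h | h
  · have := prof_le_add lam (show d + 1 ≤ d' by omega)
    simp only [h, iff_true]
    omega
  · subst h; simp
  · have := prof_le_add lam (show d' + 1 ≤ d by omega)
    simp only [h.not_gt, iff_false]
    omega

/-- The excluded case `d' = d + 1` is that of a removable node directly below the indent node, in
the same column. For `n ≥ 2` two such nodes have different residues, so the exclusion does no harm.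
-/
theorem indent_removable_col_lt_iff {lam : YoungDiagram} {d d' : ℤ} (h1 : bead lam d = true)
    (h2 : bead lam (d + 1) = false) (h1' : bead lam d' = false)
    (h2' : bead lam (d' + 1) = true) (hne : d' ≠ d + 1) :
    (diagCell (prof lam d) d).2 < (diagCell (prof lam d' - 1) d').2 ↔ d < d' := by
  have a1 := prof_succ lam d
  simp [h2] at a1
  have a2 := prof_pred lam d'
  simp [h1'] at a2
  have b1 := neg_le_prof lam d
  have b2 := prof_sub_one_bounds h1' h2'
  simp only [diagCell]
  have hdd : d ≠ d' := by rintro rfl; simp_all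
  rcases lt_or_gt_of_ne hdd with h | h
  · have := prof_le_add lam (show d + 1 ≤ d' - 1 by omega)
    simp only [h, iff_true]
    omega
  · have := prof_le_add lam (show d' ≤ d by omega)
    simp only [h.not_gt, iff_false]
    omega

theorem removable_indent_col_lt_iff {lam : YoungDiagram} {d d' : ℤ} (h1 : bead lam d = true)
    (h2 : bead lam (d + 1) = false) (h1' : bead lam d' = false)
    (h2' : bead lam (d' + 1) = true) (hne : d' ≠ d + 1) :
    (diagCell (prof lam d' - 1) d').2 < (diagCell (prof lam d) d).2 ↔ d' < d := by
  have a1 := prof_succ lam d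
  simp [h2] at a1
  have a2 := prof_pred lam d'
  simp [h1'] at a2
  have b1 := neg_le_prof lam d
  have b2 := prof_sub_one_bounds h1' h2'
  simp only [diagCell]
  have hdd : d ≠ d' := by rintro rfl; simp_all
  rcases lt_or_gt_of_ne hdd with h | h
  · have := prof_le_add lam (show d + 1 ≤ d' - 1 by omega)
    simp only [h.not_gt, iff_false]
    omega
  · have := prof_le_add lam (show d' ≤ d by omega)
    simp only [h, iff_true]
    omega

theorem nodeCountRight_eq {n : ℕ} (hn : 2 ≤ n) (i : ZMod n) {lam : YoungDiagram} {N : ℕ}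
    (hN : lam.card ≤ N) {d : ℤ} (hd : (d : ZMod n) = i) (h1 : bead lam d = true)
    (h2 : bead lam (d + 1) = false) :
    nodeCountRight n i lam (diagCell (prof lam d) d) =
      ∑ m ∈ (window n i N).filter (fun m => d < m), stepAt (bead lam) m := by
  unfold nodeCountRight
  rw [Finset.card_filter, Finset.card_filter]
  push_cast
  rw [sum_indentNodes hN, sum_removableNodes hN, ← Finset.sum_sub_distrib, Finset.sum_filter]
  refine Finset.sum_congr rfl fun m hm => ?_
  have hm' := (mem_window.1 hm).2
  have hne : m ≠ d + 1 := ne_add_one_of_residue hn (hd.trans hm'.symm)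
  rw [stepAt_eq]
  by_cases c1 : bead lam m = true ∧ bead lam (m + 1) = false
  · simp only [c1, and_self, if_true, indent_col_iff h2 c1.2]
    simp
  · by_cases c2 : bead lam m = false ∧ bead lam (m + 1) = true
    · rw [if_neg c1, if_pos c2, if_neg c1, if_pos c2]
      simp only [indent_removable_col_lt_iff h1 h2 c2.1 c2.2 hne]
      split_ifs <;> simp
    · simp only [c1, c2, if_false]
      simp

theorem nodeCountLeft_eq {n : ℕ} (hn : 2 ≤ n) (i : ZMod n) {lam : YoungDiagram} {N : ℕ}
    (hN : lam.card ≤ N) {d : ℤ} (hd : (d : ZMod n) = i) (h1 : bead lam d = true)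
    (h2 : bead lam (d + 1) = false) :
    nodeCountLeft n i lam (diagCell (prof lam d) d) =
      ∑ m ∈ (window n i N).filter (fun m => m < d), stepAt (bead lam) m := by
  unfold nodeCountLeft
  rw [Finset.card_filter, Finset.card_filter]
  push_cast
  rw [sum_indentNodes hN, sum_removableNodes hN, ← Finset.sum_sub_distrib, Finset.sum_filter]
  refine Finset.sum_congr rfl fun m hm => ?_
  have hm' := (mem_window.1 hm).2
  have hne : m ≠ d + 1 := ne_add_one_of_residue hn (hd.trans hm'.symm)
  rw [stepAt_eq]
  by_cases c1 : bead lam m = true ∧ bead lam (m + 1) = false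
  · simp only [c1, and_self, if_true, indent_col_iff c1.2 h2]
    simp
  · by_cases c2 : bead lam m = false ∧ bead lam (m + 1) = true
    · rw [if_neg c1, if_pos c2, if_neg c1, if_pos c2]
      simp only [removable_indent_col_lt_iff h1 h2 c2.1 c2.2 hne]
      split_ifs <;> simp
    · simp only [c1, c2, if_false]
      simp

end RibbonFock

namespace RibbonFock

/-! ## Ribbons and jumps -/

/-- The row function `ρ` describes the ribbon with the contents `p, …, p + n - 1`: its cell of
content `d` lies in the row `ρ d`. -/
structure IsRibbonRows (n : ℕ) (p : ℤ) (ρ : ℤ → ℤ) (R : Finset (ℕ × ℕ)) : Prop where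
  nonneg : ∀ d, p ≤ d → d < p + n → 0 ≤ ρ d ∧ 0 ≤ ρ d + d
  step : ∀ d, p < d → d < p + n → ρ d ≤ ρ (d - 1) ∧ ρ (d - 1) ≤ ρ d + 1
  eq : R = (Finset.Ico p (p + n)).image fun d => diagCell (ρ d) d

theorem IsRibbonRows.mem_iff {n : ℕ} {p : ℤ} {ρ : ℤ → ℤ} {R : Finset (ℕ × ℕ)}
    (h : IsRibbonRows n p ρ R) (x : ℕ × ℕ) :
    x ∈ R ↔ p ≤ content x ∧ content x < p + n ∧ (x.1 : ℤ) = ρ (content x) := by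
  rw [h.eq, Finset.mem_image]
  constructor
  · rintro ⟨d, hd, rfl⟩
    rw [Finset.mem_Ico] at hd
    have h1 := h.nonneg d hd.1 hd.2
    rw [content_diagCell h1.1 h1.2]
    exact ⟨hd.1, hd.2, by simp [diagCell, h1.1]⟩
  · rintro ⟨h1, h2, h3⟩
    exact ⟨content x, Finset.mem_Ico.2 ⟨h1, h2⟩, by rw [← h3, diagCell_content]⟩

theorem IsRibbonRows.diagCell_mem {n : ℕ} {p : ℤ} {ρ : ℤ → ℤ} {R : Finset (ℕ × ℕ)}
    (h : IsRibbonRows n p ρ R) {d : ℤ} (h1 : p ≤ d) (h2 : d < p + n) :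
    diagCell (ρ d) d ∈ R := by
  rw [h.eq]
  exact Finset.mem_image_of_mem _ (Finset.mem_Ico.2 ⟨h1, h2⟩)

/-- Each step of the path lowers the content by one, so the content is a parameter for the cells and
the path becomes a function from contents to rows. -/
theorem IsRibbon.exists_rows {n : ℕ} {x : ℕ × ℕ} {R : Finset (ℕ × ℕ)}
    (h : IsRibbon n x R) : ∃ ρ : ℤ → ℤ, IsRibbonRows n (content x + 1 - n) ρ R ∧
      ρ (content x) = x.1 := by
  obtain ⟨f, hf0, hf, rfl⟩ := h
  have hcont : ∀ t, t < n → content (f t) = content x - t := by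
    intro t
    induction t with
    | zero => intro _; rw [hf0]; simp
    | succ t ih =>
      intro ht
      have h1 := ih (by omega)
      unfold content at h1 ⊢
      rcases hf t ht with h2 | h2
      · rw [h2.1, h2.2]; push_cast; omega
      · push_cast; omega
  have hz : ∀ t : ℕ, ((f (content x - (content x - t)).toNat).1 : ℤ) = (f t).1 := by
    intro t
    have : (content x - (content x - t)).toNat = t := by omega
    rw [this]
  refine ⟨fun d => (f (content x - d).toNat).1, ⟨?_, ?_, ?_⟩, by simp [hf0]⟩
  · intro d h1 h2
    have h3 := hcont (content x - d).toNat (by omega)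
    unfold content at h3
    unfold content at h1 h2 ⊢
    omega
  · intro d h1 h2
    obtain ⟨t, ht⟩ : ∃ t : ℕ, content x - d = t := ⟨(content x - d).toNat, by omega⟩
    have e1 : (content x - d).toNat = t := by omega
    have e2 : (content x - (d - 1)).toNat = t + 1 := by omega
    simp only [e1, e2]
    rcases hf t (by omega) with h3 | h3 <;> omega
  · ext y
    simp only [Finset.mem_image, Finset.mem_range, Finset.mem_Ico]
    constructor
    · rintro ⟨t, ht, rfl⟩
      refine ⟨content x - t, by omega, ?_⟩
      rw [hz, ← hcont t ht, diagCell_content]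
    · rintro ⟨d, hd, rfl⟩
      refine ⟨(content x - d).toNat, by omega, ?_⟩
      have h3 := hcont (content x - d).toNat (by omega)
      have e : content x - ((content x - d).toNat : ℤ) = d := by omega
      rw [e] at h3
      conv_rhs => rw [← h3]
      rw [h3]
      conv_lhs => rw [← diagCell_content (f (content x - d).toNat), h3]

theorem IsRibbonRows.height_eq {n : ℕ} (hn : 1 ≤ n) {p : ℤ} {ρ : ℤ → ℤ} {R : Finset (ℕ × ℕ)}
    (h : IsRibbonRows n p ρ R) : ((height R - 1 : ℕ) : ℤ) = ρ p - ρ (p + n - 1) := by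
  -- Starting from the initial cell, the row stays or grows by one at each step, so the rows met so
  -- far always fill an interval.
  have key : ∀ k : ℕ, k < n → ((Finset.Ico (p + n - 1 - k) (p + n)).image
      fun d => (ρ d).toNat) = Finset.Icc (ρ (p + n - 1)).toNat (ρ (p + n - 1 - k)).toNat ∧
      ρ (p + n - 1) ≤ ρ (p + n - 1 - k) := by
    intro k
    induction k with
    | zero =>
      intro _
      have : Finset.Ico (p + n - 1 - (0 : ℕ)) (p + n) = {p + n - 1} := by
        ext; simp; omega
      rw [this]
      simp
    | succ k ih =>
      intro hk
      obtain ⟨h1, h2⟩ := ih (by omega)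
      have e : p + n - 1 - ((k + 1 : ℕ) : ℤ) = p + n - 1 - k - 1 := by push_cast; ring
      have h3 := h.step (p + n - 1 - k) (by omega) (by omega)
      have h4 := h.nonneg (p + n - 1) (by omega) (by omega)
      have : Finset.Ico (p + n - 1 - ((k + 1 : ℕ) : ℤ)) (p + n) =
          insert (p + n - 1 - k - 1) (Finset.Ico (p + n - 1 - k) (p + n)) := by
        ext; simp; omega
      rw [this, Finset.image_insert, h1, e]
      refine ⟨?_, by omega⟩
      ext y
      simp only [Finset.mem_insert, Finset.mem_Icc]
      omega
  have h5 := (key (n - 1) (by omega))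
  have e : p + n - 1 - ((n - 1 : ℕ) : ℤ) = p := by omega
  rw [e] at h5
  have h6 : R.image Prod.fst = Finset.Icc (ρ (p + n - 1)).toNat (ρ p).toNat := by
    rw [← h5.1, h.eq, Finset.image_image]
    rfl
  have h7 := h.nonneg (p + n - 1) (by omega) (by omega)
  rw [height, h6, Nat.card_Icc]
  omega

theorem IsRibbonRows.isRibbon {n : ℕ} (hn : 1 ≤ n) {p : ℤ} {ρ : ℤ → ℤ} {R : Finset (ℕ × ℕ)}
    (h : IsRibbonRows n p ρ R) : IsRibbon n (diagCell (ρ (p + n - 1)) (p + n - 1)) R := by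
  refine ⟨fun t => diagCell (ρ (p + n - 1 - t)) (p + n - 1 - t), by simp, ?_, ?_⟩
  · intro t ht
    have e : p + n - 1 - ((t + 1 : ℕ) : ℤ) = p + n - 1 - t - 1 := by push_cast; ring
    have h1 := h.step (p + n - 1 - t) (by omega) (by omega)
    have h2 := h.nonneg (p + n - 1 - t) (by omega) (by omega)
    have h3 := h.nonneg (p + n - 1 - t - 1) (by omega) (by omega)
    simp only [e, diagCell]
    omega
  · rw [h.eq]
    ext y
    simp only [Finset.mem_image, Finset.mem_range, Finset.mem_Ico]
    constructor
    · rintro ⟨d, hd, rfl⟩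
      refine ⟨(p + n - 1 - d).toNat, by omega, ?_⟩
      have e : p + n - 1 - ((p + n - 1 - d).toNat : ℤ) = d := by omega
      rw [e]
    · rintro ⟨t, ht, rfl⟩
      exact ⟨p + n - 1 - t, by omega, rfl⟩

theorem IsRibbonRows.isJump {n : ℕ} {p : ℤ} {ρ : ℤ → ℤ} {R : Finset (ℕ × ℕ)}
    (h : IsRibbonRows n p ρ R) {lam mu : YoungDiagram} (hle : lam ≤ mu)
    (hR : mu.cells \ lam.cells = R) : IsJump n p lam mu := by
  intro d
  rw [prof_eq_add_of_cells hle d, hR]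
  congr 1
  by_cases hd : p ≤ d ∧ d < p + n
  · have h1 := h.nonneg d hd.1 hd.2
    have : R.filter (fun x => content x = d) = {diagCell (ρ d) d} := by
      ext x
      rw [Finset.mem_filter, h.mem_iff, Finset.mem_singleton]
      constructor
      · rintro ⟨⟨_, _, h2⟩, rfl⟩
        rw [← h2, diagCell_content]
      · rintro rfl
        rw [content_diagCell h1.1 h1.2]
        exact ⟨⟨hd.1, hd.2, by simp [diagCell, h1.1]⟩, rfl⟩
    rw [if_pos hd, this]
    simp
  · have : R.filter (fun x => content x = d) = ∅ := by
      refine Finset.filter_eq_empty_iff.2 fun x hx e => hd ?_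
      have := (h.mem_iff x).1 hx
      omega
    rw [if_neg hd, this]
    simp

/-- On each diagonal of the range exactly one cell is added, the first one outside `lam`, so the
ribbon runs along the boundary of `lam` with row function `prof lam`. -/
theorem IsJump.isRibbonRows {n : ℕ} {p : ℤ} {lam mu : YoungDiagram} (h : IsJump n p lam mu) :
    IsRibbonRows n p (prof lam) (mu.cells \ lam.cells) := by
  refine ⟨fun d _ _ => ⟨prof_nonneg _ _, by have := neg_le_prof lam d; omega⟩,
    fun d _ _ => ⟨prof_le_prof_pred _ _, prof_pred_le _ _⟩, ?_⟩
  ext x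
  rw [Finset.mem_sdiff, YoungDiagram.mem_cells, YoungDiagram.mem_cells, mem_iff_content,
    mem_iff_content, h, Finset.mem_image]
  constructor
  · rintro ⟨h1, h2⟩
    refine ⟨content x, ?_, ?_⟩
    · rw [Finset.mem_Ico]
      by_contra hc
      rw [if_neg hc] at h1
      omega
    · have : (x.1 : ℤ) = prof lam (content x) := by
        split_ifs at h1 <;> omega
      rw [← this, diagCell_content]
  · rintro ⟨d, hd, rfl⟩
    have h0 := prof_nonneg lam d
    rw [Finset.mem_Ico] at hd
    rw [content_diagCell h0 (by have := neg_le_prof lam d; omega), if_pos hd]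
    simp only [diagCell]
    omega

/-- The number of beads of `s` strictly between `p` and `p + n`. -/
noncomputable def beadsBetween (n : ℕ) (s : ℤ → Bool) (p : ℤ) : ℕ :=
  ((Finset.Ioo p (p + n)).filter fun m => s m = true).card

theorem prof_sub_eq_card (lam : YoungDiagram) (p : ℤ) (k : ℕ) :
    prof lam p - prof lam (p + k) =
      ((Finset.Ioc p (p + k)).filter fun m => bead lam m = true).card := by
  induction k with
  | zero => simp
  | succ k ih =>
    have e : Finset.Ioc p (p + ((k + 1 : ℕ) : ℤ)) =
        insert (p + k + 1) (Finset.Ioc p (p + k)) := by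
      ext; simp; omega
    have e2 : p + ((k + 1 : ℕ) : ℤ) = p + k + 1 := by push_cast; ring
    have h := prof_succ lam (p + k)
    rw [e, Finset.filter_insert, e2]
    split_ifs with hb
    · rw [Finset.card_insert_of_notMem (by simp)]
      rw [if_pos hb] at h
      push_cast
      omega
    · rw [if_neg hb] at h
      omega

/-- The row of the ribbon follows the profile, which drops by one exactly at the beads, so the
exponent of the spin weight counts the beads jumped over. -/
theorem IsJump.height_sub_one {n : ℕ} (hn : 1 ≤ n) {p : ℤ} {lam mu : YoungDiagram}
    (h : IsJump n p lam mu) :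
    height (mu.cells \ lam.cells) - 1 = beadsBetween n (bead lam) p := by
  have h1 := h.isRibbonRows.height_eq hn
  have h2 := prof_sub_eq_card lam p (n - 1)
  have e : p + ((n - 1 : ℕ) : ℤ) = p + n - 1 := by omega
  rw [e] at h2
  have e2 : Finset.Ioc p (p + n - 1) = Finset.Ioo p (p + n) := by ext; simp
  rw [e2] at h2
  unfold beadsBetween
  omega

/-! ## Tilings of horizontal strips -/

/-- A ribbon with rows `ρ` outside `alp`, whose initial cell lies directly above `alp`. -/
structure IsTile (n : ℕ) (alp : YoungDiagram) (p : ℤ) (ρ : ℤ → ℤ) (R : Finset (ℕ × ℕ)) : Prop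
    extends IsRibbonRows n p ρ R where
  outside : ∀ d, p ≤ d → d < p + n → prof alp d ≤ ρ d
  initial : ρ (p + n - 1) ≤ prof alp (p + n)

theorem IsStripTiling.subset {n m : ℕ} {alp bet : YoungDiagram} {T : Finset (Finset (ℕ × ℕ))}
    (h : IsStripTiling n m alp bet T) {R : Finset (ℕ × ℕ)} (hR : R ∈ T) :
    R ⊆ bet.cells \ alp.cells := by
  rw [← h.cover]
  exact Finset.subset_biUnion_of_mem id hR

theorem IsStripTiling.exists_isTile {n m : ℕ} {alp bet : YoungDiagram}
    {T : Finset (Finset (ℕ × ℕ))} (h : IsStripTiling n m alp bet T) {R : Finset (ℕ × ℕ)}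
    (hR : R ∈ T) : ∃ (p : ℤ) (ρ : ℤ → ℤ), IsTile n alp p ρ R := by
  obtain ⟨r, c, h1, h2⟩ := h.initial R hR
  obtain ⟨ρ, h3, h4⟩ := h1.exists_rows
  refine ⟨_, ρ, h3, ?_, ?_⟩
  · intro d hd1 hd2
    have h5 := (Finset.mem_sdiff.1 (h.subset hR (h3.diagCell_mem hd1 hd2))).2
    have h6 := h3.nonneg d hd1 hd2
    rw [YoungDiagram.mem_cells, RibbonFock.diagCell_mem h6.1 h6.2] at h5
    omega
  · have e : content (r, c) + 1 - (n : ℤ) + n - 1 = content (r, c) := by ring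
    have e' : content (r, c) + 1 - (n : ℤ) + n = content (r, c) + 1 := by ring
    rw [e, e', h4]
    have h0 := prof_nonneg alp (content (r, c) + 1)
    rcases h2 with rfl | h2
    · simpa using h0
    · rw [mem_iff_lt_prof] at h2
      -- For `r = 0` the natural number `r - 1` is again `0`, so the membership says nothing about a
      -- cell below and this case must be separated.
      by_cases hr : r = 0
      · subst hr; simpa using h0
      · have e2 : (c : ℤ) - ((r - 1 : ℕ) : ℤ) = content (r, c) + 1 := by
          simp only [content]
          omega
        rw [e2] at h2
        dsimp only
        omega

theorem IsTile.initial_cell {n : ℕ} (hn : 1 ≤ n) {alp : YoungDiagram} {p : ℤ} {ρ : ℤ → ℤ}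
    {R : Finset (ℕ × ℕ)} (h : IsTile n alp p ρ R) :
    ∃ r c : ℕ, IsRibbon n (r, c) R ∧ (r = 0 ∨ (r - 1, c) ∈ alp) := by
  refine ⟨_, _, h.isRibbon hn, ?_⟩
  by_cases h0 : ρ (p + n - 1) ≤ 0
  · left; omega
  · right
    have h1 := h.nonneg (p + n - 1) (by omega) (by omega)
    have h2 := h.initial
    rw [mem_iff_lt_prof]
    have e : ((ρ (p + n - 1) + (p + n - 1)).toNat : ℤ) - (((ρ (p + n - 1)).toNat - 1 : ℕ) : ℤ) =
        p + n := by omega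
    rw [e]
    omega

/-- No tile runs above another tile that reaches at least as far to the right. -/
theorem IsTile.not_above {n : ℕ} {alp : YoungDiagram} {p p' : ℤ} {ρ ρ' : ℤ → ℤ}
    {R R' : Finset (ℕ × ℕ)} (h : IsTile n alp p ρ R) (h' : IsTile n alp p' ρ' R')
    (hdis : Disjoint R R') (hp : p' ≤ p) {d : ℤ} (h1 : p ≤ d) (h2 : d < p' + n) :
    ρ' d ≤ ρ d := by
  by_contra hlt
  -- Once `R` runs below `R'` it stays below further to the right, since unit steps cannot cross
  -- without a common cell. At the initial cell of `R'` this would put a cell of `R` inside `alp`.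
  have key : ∀ k : ℕ, d + k < p' + n → ρ (d + k) < ρ' (d + k) := by
    intro k
    induction k with
    | zero => intro _; simpa using hlt
    | succ k ih =>
      intro hk
      push_cast at hk ⊢
      have i1 := ih (by omega)
      have i2 := h.step (d + k + 1) (by omega) (by omega)
      have i3 := h'.step (d + k + 1) (by omega) (by omega)
      rw [add_sub_cancel_right] at i2 i3
      have i4 : ρ (d + k + 1) ≠ ρ' (d + k + 1) := by
        intro e
        have m1 := h.diagCell_mem (d := d + k + 1) (by omega) (by omega)
        have m2 := h'.diagCell_mem (d := d + k + 1) (by omega) (by omega)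
        rw [← e] at m2
        exact Finset.disjoint_left.1 hdis m1 m2
      rw [← add_assoc]
      omega
  have h3 := key (p' + n - 1 - d).toNat (by omega)
  have e : d + ((p' + n - 1 - d).toNat : ℤ) = p' + n - 1 := by omega
  rw [e] at h3
  have h4 := h.outside (p' + n - 1) (by omega) (by omega)
  have h5 := h'.initial
  have h6 := prof_le_prof_pred alp (p' + n)
  omega

/-- All cells of `mu / lam` have content less than `M`. -/
def ContentsLT (M : ℤ) (lam mu : YoungDiagram) : Prop :=
  ∀ x ∈ mu.cells \ lam.cells, content x < M

theorem IsStripTiling.add_le {n m : ℕ} (hn : 1 ≤ n) {alp bet : YoungDiagram}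
    {T : Finset (Finset (ℕ × ℕ))} (h : IsStripTiling n m alp bet T) {M : ℤ}
    (hM : ContentsLT M alp bet) {R : Finset (ℕ × ℕ)} (hR : R ∈ T) {p : ℤ} {ρ : ℤ → ℤ}
    (ht : IsTile n alp p ρ R) : p + n ≤ M := by
  have h1 := h.subset hR (ht.diagCell_mem (d := p + n - 1) (by omega) (by omega))
  have h2 := hM _ h1
  have h3 := ht.nonneg (p + n - 1) (by omega) (by omega)
  rw [content_diagCell h3.1 h3.2] at h2
  omega

/-- Two different tiles have initial cells of different contents. -/
theorem IsTile.ne_of_disjoint {n : ℕ} (hn : 1 ≤ n) {alp : YoungDiagram} {p p' : ℤ} {ρ ρ' : ℤ → ℤ}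
    {R R' : Finset (ℕ × ℕ)} (h : IsTile n alp p ρ R) (h' : IsTile n alp p' ρ' R')
    (hdis : Disjoint R R') : p ≠ p' := by
  rintro rfl
  have h1 := h.not_above h' hdis le_rfl (d := p) le_rfl (by omega)
  have h2 := h'.not_above h hdis.symm le_rfl (d := p) le_rfl (by omega)
  have m1 := h.diagCell_mem (d := p) le_rfl (by omega)
  have m2 := h'.diagCell_mem (d := p) le_rfl (by omega)
  rw [le_antisymm h1 h2] at m2
  exact Finset.disjoint_left.1 hdis m1 m2

/-- The tile with the rightmost initial cell can be removed. -/
theorem IsStripTiling.isLowerSet_sdiff {n m : ℕ} (hn : 1 ≤ n) {alp bet : YoungDiagram}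
    {T : Finset (Finset (ℕ × ℕ))} (h : IsStripTiling n m alp bet T) {R : Finset (ℕ × ℕ)}
    (hR : R ∈ T) {p : ℤ} {ρ : ℤ → ℤ} (ht : IsTile n alp p ρ R)
    (hM : ContentsLT (p + n) alp bet) :
    IsLowerSet ((bet.cells \ R : Finset (ℕ × ℕ)) : Set (ℕ × ℕ)) := by
  -- It suffices that no remaining cell lies directly to the right of or directly above a cell of
  -- `R`. Such a cell belongs to another tile, which starts further left and so never runs above `R`
  -- on common contents. In the first case the row steps of `R` force the cell into `R`; in the
  -- second case the lower cell lies in both tiles, or lies below the initial cell of the other tile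
  -- and hence in `alp`.
  have step : ∀ x y : ℕ × ℕ, x ∈ R → y ∈ bet.cells \ R →
      ¬ ((y.1 = x.1 ∧ y.2 = x.2 + 1) ∨ (y.1 = x.1 + 1 ∧ y.2 = x.2)) := by
    intro x y hx hy hxy
    obtain ⟨hy1, hy2⟩ := Finset.mem_sdiff.1 hy
    have hxa := (Finset.mem_sdiff.1 (h.subset hR hx)).2
    have hya : y ∉ alp.cells := fun hc => hxa
      (alp.up_left_mem (by rcases hxy with hxy | hxy <;> omega)
        (by rcases hxy with hxy | hxy <;> omega) hc)
    have hyT : y ∈ T.biUnion id := by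
      rw [h.cover]; exact Finset.mem_sdiff.2 ⟨hy1, hya⟩
    obtain ⟨R', hR', hyR'⟩ := Finset.mem_biUnion.1 hyT
    have hne : R ≠ R' := by rintro rfl; exact hy2 hyR'
    have hdis := h.disjoint R hR R' hR' hne
    obtain ⟨p', ρ', ht'⟩ := h.exists_isTile hR'
    have hp := h.add_le hn hM hR' ht'
    obtain ⟨x1, x2, x3⟩ := (ht.mem_iff x).1 hx
    obtain ⟨y1, y2, y3⟩ := (ht'.mem_iff y).1 hyR'
    rcases hxy with ⟨e1, e2⟩ | ⟨e1, e2⟩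
    · have ec : content y = content x + 1 := by unfold content; omega
      have h1 := ht.not_above ht' hdis (by omega) (d := content y) (by omega) (by omega)
      have h2 := ht.step (content y) (by omega) (by omega)
      have e3 : content y - 1 = content x := by omega
      rw [e3] at h2
      refine hy2 ((ht.mem_iff y).2 ⟨by omega, by omega, by omega⟩)
    · have ec : content y = content x - 1 := by unfold content; omega
      by_cases hc : content x < p' + n
      · have h1 := ht.not_above ht' hdis (by omega) (d := content x) (by omega) (by omega)
        have h2 := ht'.step (content x) (by omega) (by omega)
        rw [← ec] at h2
        refine Finset.disjoint_left.1 hdis hx ((ht'.mem_iff x).2 ⟨by omega, by omega, by omega⟩)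
      · have h1 := ht'.initial
        have e3 : p' + n - 1 = content y := by omega
        have e4 : p' + n = content x := by omega
        rw [e3, e4] at h1
        apply hxa
        rw [YoungDiagram.mem_cells, mem_iff_content]
        omega
  intro y x hxy hy
  have hyb := (Finset.mem_sdiff.1 (Finset.mem_coe.1 hy)).1
  obtain ⟨r, c⟩ := x
  obtain ⟨r', c'⟩ := y
  obtain ⟨hr, hc⟩ := Prod.mk_le_mk.1 hxy
  have hmem : ∀ a b : ℕ, a ≤ r' → b ≤ c' → (a, b) ∈ bet.cells := fun a b ha hb =>
    bet.up_left_mem ha hb hyb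
  -- A smaller cell is reached by going down the column of the larger one and then left along the
  -- row.
  have down : ∀ k : ℕ, k ≤ r' → (r' - k, c') ∈ bet.cells \ R := by
    intro k
    induction k with
    | zero => intro _; exact hy
    | succ k ih =>
      intro hk
      refine Finset.mem_sdiff.2 ⟨hmem _ _ (by omega) le_rfl, fun hx => ?_⟩
      exact step _ _ hx (ih (by omega)) (Or.inr ⟨by dsimp only; omega, rfl⟩)
  have left : ∀ k : ℕ, k ≤ c' → (r, c' - k) ∈ bet.cells \ R := by
    intro k
    induction k with
    | zero =>
      intro _
      have := down (r' - r) (by omega)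
      have e : r' - (r' - r) = r := by omega
      rwa [e] at this
    | succ k ih =>
      intro hk
      refine Finset.mem_sdiff.2 ⟨hmem _ _ hr (by omega), fun hx => ?_⟩
      exact step _ _ hx (ih (by omega)) (Or.inl ⟨rfl, by dsimp only; omega⟩)
  have := left (c' - c) (by omega)
  have e : c' - (c' - c) = c := by omega
  rw [e] at this
  exact Finset.mem_coe.2 this

/-- Removal of the tile with the rightmost initial cell. -/
theorem IsStripTiling.exists_erase {n k : ℕ} (hn : 1 ≤ n) {alp bet : YoungDiagram}
    {T : Finset (Finset (ℕ × ℕ))} (h : IsStripTiling n (k + 1) alp bet T) {p : ℤ}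
    (hM : ContentsLT (p + n) alp bet) (hM' : ¬ ContentsLT (p + n - 1) alp bet) :
    ∃ gam : YoungDiagram, IsJump n p gam bet ∧ bet.cells \ gam.cells ∈ T ∧
      IsStripTiling n k alp gam (T.erase (bet.cells \ gam.cells)) ∧
      ContentsLT (p + n - 1) alp gam := by
  unfold ContentsLT at hM'
  push Not at hM'
  obtain ⟨x, hx, hxc⟩ := hM'
  have hxT := hx
  rw [← h.cover] at hxT
  obtain ⟨R, hR, hxR⟩ := Finset.mem_biUnion.1 hxT
  obtain ⟨p', ρ, ht⟩ := h.exists_isTile hR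
  -- The tile covers a cell of the largest content that occurs, `p + n - 1`, and no tile reaches
  -- beyond it.
  have hp : p' = p := by
    have h1 := h.add_le hn hM hR ht
    have h2 := (ht.mem_iff x).1 hxR
    omega
  subst hp
  have hRsub := h.subset hR
  have hlow := h.isLowerSet_sdiff hn hR ht hM
  set gam : YoungDiagram := ⟨bet.cells \ R, hlow⟩ with hgam
  have hcells : gam.cells = bet.cells \ R := rfl
  have hRb : R ⊆ bet.cells := hRsub.trans Finset.sdiff_subset
  have hRe : bet.cells \ gam.cells = R := by
    rw [hcells]; exact Finset.sdiff_sdiff_eq_self hRb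
  have hle : gam ≤ bet := YoungDiagram.cells_subset_iff.1 (hcells ▸ Finset.sdiff_subset)
  have hale : alp ≤ gam := by
    refine YoungDiagram.cells_subset_iff.1 fun y hy => ?_
    rw [hcells]
    exact Finset.mem_sdiff.2 ⟨YoungDiagram.cells_subset_iff.2 h.le hy, fun hyR =>
      (Finset.mem_sdiff.1 (hRsub hyR)).2 hy⟩
  have hcov : (T.erase R).biUnion id = gam.cells \ alp.cells := by
    have h1 : gam.cells \ alp.cells = (bet.cells \ alp.cells) \ R := by
      rw [hcells, sdiff_right_comm]
    rw [h1, ← h.cover]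
    ext y
    simp only [Finset.mem_biUnion, Finset.mem_erase, Finset.mem_sdiff, id]
    constructor
    · rintro ⟨S, ⟨hS1, hS2⟩, hS3⟩
      exact ⟨⟨S, hS2, hS3⟩, fun hy => Finset.disjoint_left.1 (h.disjoint S hS2 R hR hS1) hS3 hy⟩
    · rintro ⟨⟨S, hS2, hS3⟩, hy⟩
      exact ⟨S, ⟨by rintro rfl; exact hy hS3, hS2⟩, hS3⟩
  refine ⟨gam, ht.isJump hle hRe, by rwa [hRe], ?_, ?_⟩
  · rw [hRe]
    exact ⟨hale, by rw [Finset.card_erase_of_mem hR, h.card_eq, Nat.add_sub_cancel],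
      fun S hS S' hS' => h.disjoint S (Finset.mem_of_mem_erase hS) S' (Finset.mem_of_mem_erase hS'),
      hcov, fun S hS => h.initial S (Finset.mem_of_mem_erase hS)⟩
  · intro y hy
    rw [← hcov] at hy
    obtain ⟨S, hS, hyS⟩ := Finset.mem_biUnion.1 hy
    obtain ⟨hS1, hS2⟩ := Finset.mem_erase.1 hS
    obtain ⟨p2, ρ2, ht2⟩ := h.exists_isTile hS2
    have h1 := h.add_le hn hM hS2 ht2
    have h2 := ht2.ne_of_disjoint hn ht (h.disjoint S hS2 R hR hS1)
    have h3 := (ht2.mem_iff y).1 hyS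
    omega

/-- Insertion of a tile to the right of all others. -/
theorem IsStripTiling.insert_tile {n k : ℕ} (hn : 1 ≤ n) {alp bet gam : YoungDiagram}
    {T : Finset (Finset (ℕ × ℕ))} {p : ℤ} (hj : IsJump n p gam bet)
    (h : IsStripTiling n k alp gam T) (hM : ContentsLT (p + n - 1) alp gam) :
    bet.cells \ gam.cells ∉ T ∧
      IsStripTiling n (k + 1) alp bet (insert (bet.cells \ gam.cells) T) ∧
      ContentsLT (p + n) alp bet ∧ ¬ ContentsLT (p + n - 1) alp bet := by
  set R := bet.cells \ gam.cells with hR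
  have hrows := hj.isRibbonRows
  rw [← hR] at hrows
  have hagam := YoungDiagram.cells_subset_iff.2 h.le
  have hgbet := YoungDiagram.cells_subset_iff.2 hj.le
  have hdis : ∀ S ∈ T, Disjoint R S := fun S hS => Finset.disjoint_left.2 fun x hx hxS =>
    (Finset.mem_sdiff.1 hx).2 (Finset.mem_sdiff.1 (h.subset hS hxS)).1
  have hRne : diagCell (prof gam (p + n - 1)) (p + n - 1) ∈ R :=
    hrows.diagCell_mem (by omega) (by omega)
  have hRT : R ∉ T := fun hc => by
    have := hdis R hc
    rw [disjoint_self] at this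
    rw [this] at hRne
    exact absurd hRne (Finset.notMem_empty _)
  have hcov : (insert R T).biUnion id = bet.cells \ alp.cells := by
    rw [Finset.biUnion_insert, h.cover, id, hR]
    exact Finset.sdiff_union_sdiff_cancel hgbet hagam
  have hcont := content_diagCell (d := p + n - 1) (prof_nonneg gam (p + n - 1))
    (by have := neg_le_prof gam (p + n - 1); omega)
  -- The old tiles do not reach the content `p + n`, so there `gam` and `alp` have the same
  -- boundary; hence the initial cell of the new tile rests on `alp` itself.
  have hprof : prof gam (p + n) = prof alp (p + n) := by
    rw [prof_eq_add_of_cells h.le, Finset.filter_eq_empty_iff.2]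
    · simp
    · intro x hx e
      have := hM x hx
      omega
  have htile : IsTile n alp p (prof gam) R := ⟨hrows, fun d _ _ => prof_mono.1 h.le d, by
    have h1 := hj.bead_target hn
    have h2 := prof_pred gam (p + n)
    rw [h1] at h2
    simp at h2
    omega⟩
  refine ⟨hRT, ⟨h.le.trans hj.le, by rw [Finset.card_insert_of_notMem hRT, h.card_eq], ?_, hcov,
    ?_⟩, ?_, ?_⟩
  · intro S hS S' hS' hne
    rcases Finset.mem_insert.1 hS with rfl | hS
    · rcases Finset.mem_insert.1 hS' with rfl | hS'
      · exact absurd rfl hne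
      · exact hdis S' hS'
    · rcases Finset.mem_insert.1 hS' with rfl | hS'
      · exact (hdis S hS).symm
      · exact h.disjoint S hS S' hS' hne
  · intro S hS
    rcases Finset.mem_insert.1 hS with rfl | hS
    · exact htile.initial_cell hn
    · exact h.initial S hS
  · intro x hx
    rw [← hcov, Finset.biUnion_insert, Finset.mem_union, h.cover] at hx
    rcases hx with hx | hx
    · exact ((hrows.mem_iff x).1 hx).2.1
    · have := hM x hx; omega
  · intro hc
    have := hc (diagCell (prof gam (p + n - 1)) (p + n - 1)) (by
      rw [← hcov]
      exact Finset.mem_biUnion.2 ⟨R, Finset.mem_insert_self _ _, hRne⟩)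
    omega

end RibbonFock

/-! ### Spin sums over tilings and their recursion on the rightmost ribbon -/

namespace RibbonFock

theorem IsRibbonRows.card_eq {n : ℕ} {p : ℤ} {ρ : ℤ → ℤ} {R : Finset (ℕ × ℕ)}
    (h : IsRibbonRows n p ρ R) : R.card = n := by
  rw [h.eq, Finset.card_image_of_injOn]
  · simp
  · intro d hd d' hd' e
    rw [Finset.mem_coe, Finset.mem_Ico] at hd hd'
    have h1 := h.nonneg d hd.1 hd.2
    have h2 := h.nonneg d' hd'.1 hd'.2
    have := congrArg content e
    simpa only [content_diagCell h1.1 h1.2, content_diagCell h2.1 h2.2] using this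

theorem IsJump.card_eq {n : ℕ} {p : ℤ} {lam mu : YoungDiagram} (h : IsJump n p lam mu) :
    mu.card = lam.card + n := by
  have h1 := h.isRibbonRows.card_eq
  have h3 := Finset.card_sdiff_add_card_eq_card (YoungDiagram.cells_subset_iff.2 h.le)
  unfold YoungDiagram.card
  omega

theorem IsStripTiling.card_eq_add {n m : ℕ} {alp bet : YoungDiagram}
    {T : Finset (Finset (ℕ × ℕ))} (h : IsStripTiling n m alp bet T) :
    bet.card = alp.card + n * m := by
  have h1 : (bet.cells \ alp.cells).card = n * m := by
    rw [← h.cover, Finset.card_biUnion (t := id) fun R hR S hS hne => h.disjoint R hR S hS hne,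
      Finset.sum_const_nat (m := n), h.card_eq, mul_comm]
    intro R hR
    obtain ⟨p, ρ, ht⟩ := h.exists_isTile hR
    exact ht.card_eq
  have h2 := YoungDiagram.cells_subset_iff.2 h.le
  have h3 := Finset.card_sdiff_add_card_eq_card h2
  unfold YoungDiagram.card
  omega

open Classical in
/-- The tilings of `bet / alp` as a horizontal `n`-ribbon strip of weight `k`. -/
noncomputable def tilings (n k : ℕ) (alp bet : YoungDiagram) : Finset (Finset (Finset (ℕ × ℕ))) :=
  bet.cells.powerset.powerset.filter fun T => IsStripTiling n k alp bet T

theorem mem_tilings {n k : ℕ} {alp bet : YoungDiagram} {T : Finset (Finset (ℕ × ℕ))} :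
    T ∈ tilings n k alp bet ↔ IsStripTiling n k alp bet T := by
  simp only [tilings, Finset.mem_filter, and_iff_right_iff_imp]
  intro h
  exact Finset.mem_powerset.2 fun R hR => Finset.mem_powerset.2
    ((h.subset hR).trans Finset.sdiff_subset)

section
variable {K : Type} [Field K]

/-- The sum of `(-q)^(-2 s)` over the tilings of `bet / alp`. -/
noncomputable def stripSum (n : ℕ) (q : K) (k : ℕ) (alp bet : YoungDiagram) : K :=
  ∑ T ∈ tilings n k alp bet, (-q) ^ (-((∑ R ∈ T, (height R - 1) : ℕ) : ℤ))

theorem stripSum_eq_zero {n : ℕ} (q : K) {k : ℕ} {alp bet : YoungDiagram}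
    (h : bet.card ≠ alp.card + n * k) : stripSum n q k alp bet = 0 :=
  Finset.sum_eq_zero fun _ hT => absurd ((mem_tilings.1 hT).card_eq_add) h

theorem mem_diagramsOfSize {m : ℕ} {mu : YoungDiagram} : mu ∈ diagramsOfSize m ↔ mu.card = m := by
  simp [diagramsOfSize]

theorem mem_subdiagrams {lam nu : YoungDiagram} : nu ∈ subdiagrams lam ↔ nu ≤ lam := by
  simp [subdiagrams]

theorem spinSum_nil (n : ℕ) (q : K) (lam nu : YoungDiagram) [Decidable (lam = nu)] :
    spinSum n q lam nu [] = if lam = nu then 1 else 0 := by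
  unfold spinSum
  split_ifs with h
  · subst h
    have hu : Unique (RibbonTableau n lam lam []) :=
      { default := ⟨fun _ => lam, fun i => i.elim0, rfl, rfl, fun i => i.elim0⟩
        uniq := fun T => RibbonTableau.ext (funext fun i => by
          have : i = 0 := Subsingleton.elim (α := Fin 1) i 0
          rw [this, T.shape_zero]) (funext fun i => i.elim0) }
    rw [Fintype.sum_eq_single (@default _ hu.toInhabited)
      (fun T hT => absurd (hu.uniq T) hT)]
    simp [RibbonTableau.twiceSpin]
  · have : IsEmpty (RibbonTableau n lam nu []) := ⟨fun T => h
      (T.shape_last.symm.trans T.shape_zero)⟩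
    exact Finset.sum_eq_zero fun T _ => this.elim T

theorem RibbonTableau.isStrip_zero {n : ℕ} {lam nu : YoungDiagram} {k : ℕ} {mu : List ℕ}
    (T : RibbonTableau n lam nu (k :: mu)) :
    IsStripTiling n k nu (T.shape 1) (T.tiles 0) :=
  Eq.subst (motive := fun a => IsStripTiling n k a (T.shape 1) (T.tiles 0)) T.shape_zero
    (T.isStrip 0)

/-- The first step of a ribbon tableau. -/
noncomputable def RibbonTableau.consEquiv (n : ℕ) (lam nu : YoungDiagram) (k : ℕ)
    (mu : List ℕ) : RibbonTableau n lam nu (k :: mu) ≃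
      Σ kap : {kap : YoungDiagram // kap ∈ diagramsOfSize (nu.card + n * k)},
        {T // T ∈ tilings n k nu kap.1} × RibbonTableau n lam kap.1 mu where
  toFun T := ⟨⟨T.shape 1, mem_diagramsOfSize.2 (T.isStrip_zero.card_eq_add)⟩,
    ⟨T.tiles 0, mem_tilings.2 T.isStrip_zero⟩,
    ⟨fun i => T.shape i.succ, fun i => T.tiles i.succ, rfl, T.shape_last,
      fun i => T.isStrip i.succ⟩⟩
  invFun p := ⟨Fin.cons nu p.2.2.shape, Fin.cons p.2.1.1 p.2.2.tiles, rfl, p.2.2.shape_last, by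
    intro i
    refine Fin.cases ?_ (fun j => ?_) i
    · exact Eq.subst (motive := fun a => IsStripTiling n k nu a p.2.1.1) p.2.2.shape_zero.symm
        (mem_tilings.1 p.2.1.2)
    · exact p.2.2.isStrip j⟩
  left_inv T := by
    refine RibbonTableau.ext (funext fun i => ?_) (funext fun i => ?_)
    · refine Fin.cases ?_ (fun j => ?_) i
      · exact T.shape_zero.symm
      · rfl
    · refine Fin.cases ?_ (fun j => ?_) i
      · rfl
      · rfl
  right_inv := by
    rintro ⟨⟨kap, hk⟩, ⟨T, hT⟩, ⟨s, t, h0, h1, h2⟩⟩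
    obtain rfl : s 0 = kap := h0
    rfl

theorem spinSum_cons (n : ℕ) {q : K} (hq : q ≠ 0) (lam nu : YoungDiagram) (k : ℕ)
    (mu : List ℕ) : spinSum n q lam nu (k :: mu) =
      ∑ kap ∈ diagramsOfSize (nu.card + n * k), stripSum n q k nu kap * spinSum n q lam kap mu := by
  unfold spinSum
  rw [Fintype.sum_equiv (RibbonTableau.consEquiv n lam nu k mu) _ (fun p =>
    (-q) ^ (-((∑ R ∈ p.2.1.1, (height R - 1) : ℕ) : ℤ)) * (-q) ^ (-(p.2.2.twiceSpin : ℤ))),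
    Fintype.sum_sigma]
  · rw [← Finset.sum_coe_sort (diagramsOfSize (nu.card + n * k))]
    refine Finset.sum_congr rfl fun kap _ => ?_
    rw [Fintype.sum_prod_type, stripSum, Finset.sum_mul_sum,
      ← Finset.sum_coe_sort (tilings n k nu kap.1)]
  · intro T
    rw [← zpow_add₀ (neg_ne_zero.2 hq)]
    congr 1
    have h : T.twiceSpin = ∑ R ∈ T.tiles 0, (height R - 1) +
        ∑ i : Fin mu.length, ∑ R ∈ T.tiles i.succ, (height R - 1) :=
      Fin.sum_univ_succ (n := mu.length) fun i => ∑ R ∈ T.tiles i, (height R - 1)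
    rw [h, Nat.cast_add, neg_add]
    rfl

theorem spinSum_singleton (n : ℕ) {q : K} (hq : q ≠ 0) (mu lam : YoungDiagram)
    (k : ℕ) : spinSum n q mu lam [k] = stripSum n q k lam mu := by
  classical
  rw [spinSum_cons n hq]
  simp only [spinSum_nil, mul_ite, mul_one, mul_zero]
  rw [Finset.sum_ite_eq]
  split_ifs with h
  · rfl
  · rw [mem_diagramsOfSize] at h
    exact (stripSum_eq_zero q h).symm

/-- A horizontal strip of weight `0` is empty. -/
theorem stripSum_zero (n : ℕ) (q : K) (lam mu : YoungDiagram) [Decidable (mu = lam)] :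
    stripSum n q 0 lam mu = if mu = lam then 1 else 0 := by
  have hz : ∀ T, IsStripTiling n 0 lam mu T → T = ∅ ∧ mu = lam := by
    intro T hT
    have h1 : T = ∅ := Finset.card_eq_zero.1 hT.card_eq
    refine ⟨h1, ?_⟩
    have h2 := hT.cover
    rw [h1, Finset.biUnion_empty, eq_comm, Finset.sdiff_eq_empty_iff_subset] at h2
    exact le_antisymm (YoungDiagram.cells_subset_iff.1 h2) hT.le
  split_ifs with h
  · subst h
    have : tilings n 0 mu mu = {∅} := by
      ext T
      rw [mem_tilings, Finset.mem_singleton]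
      constructor
      · exact fun hT => (hz T hT).1
      · rintro rfl
        exact ⟨le_rfl, rfl, by simp, by simp, by simp⟩
    rw [stripSum, this]
    simp
  · exact Finset.sum_eq_zero fun T hT => absurd (hz T (mem_tilings.1 hT)).2 h

open Classical in
/-- `stripSum`, restricted to the strips all of whose cells have content less than `M`. -/
noncomputable def stripSumLT (n : ℕ) (q : K) (M : ℤ) (k : ℕ) (lam mu : YoungDiagram) : K :=
  if ContentsLT M lam mu then stripSum n q k lam mu else 0

/-- A strip with contents below `p + n` either avoids the content `p + n - 1` or has a rightmost
ribbon that starts there. Taking off that ribbon is a bijection onto the tilings of `gam / lam` with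
contents below `p + n - 1`, and the ribbon contributes its own spin weight. -/
theorem stripSumLT_succ_of_jump (n : ℕ) (hn : 1 ≤ n) {q : K} (hq : q ≠ 0) (p : ℤ) (k : ℕ)
    {lam mu gam : YoungDiagram} (hj : IsJump n p gam mu) :
    stripSumLT n q (p + n) (k + 1) lam mu = stripSumLT n q (p + n - 1) (k + 1) lam mu +
      (-q) ^ (-(beadsBetween n (bead gam) p : ℤ)) * stripSumLT n q (p + n - 1) k lam gam := by
  classical
  unfold stripSumLT
  -- The two summands are never both nonzero: which one can occur depends on whether `mu / lam` has
  -- a cell of content at least `p + n - 1`.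
  by_cases h2 : ContentsLT (p + n - 1) lam mu
  · have h3 : ContentsLT (p + n) lam mu := fun x hx => (h2 x hx).trans (by omega)
    rw [if_pos h2, if_pos h3, left_eq_add]
    split_ifs with h4
    · rw [stripSum, Finset.sum_eq_zero, mul_zero]
      intro T hT
      exact absurd h2 ((mem_tilings.1 hT).insert_tile hn hj h4).2.2.2
    · rw [mul_zero]
  · rw [if_neg h2, zero_add]
    by_cases h3 : ContentsLT (p + n) lam mu
    · rw [if_pos h3]
      have herase : ∀ T ∈ tilings n (k + 1) lam mu, mu.cells \ gam.cells ∈ T ∧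
          IsStripTiling n k lam gam (T.erase (mu.cells \ gam.cells)) ∧
          ContentsLT (p + n - 1) lam gam := by
        intro T hT
        obtain ⟨gam', hj', h5, h6, h7⟩ := (mem_tilings.1 hT).exists_erase hn h3 h2
        obtain rfl := hj'.left_unique hj
        exact ⟨h5, h6, h7⟩
      split_ifs with h4
      · unfold stripSum
        rw [Finset.mul_sum]
        refine Finset.sum_bij' (fun T _ => T.erase (mu.cells \ gam.cells))
          (fun T _ => insert (mu.cells \ gam.cells) T) ?_ ?_ ?_ ?_ ?_
        · intro T hT
          exact mem_tilings.2 (herase T hT).2.1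
        · intro T hT
          exact mem_tilings.2 ((mem_tilings.1 hT).insert_tile hn hj h4).2.1
        · intro T hT
          exact Finset.insert_erase (herase T hT).1
        · intro T hT
          exact Finset.erase_insert ((mem_tilings.1 hT).insert_tile hn hj h4).1
        · intro T hT
          rw [← zpow_add₀ (neg_ne_zero.2 hq), ← Finset.add_sum_erase T _ (herase T hT).1,
            hj.height_sub_one hn]
          congr 1
          push_cast
          ring
      · rw [mul_zero]
        exact Finset.sum_eq_zero fun T hT => absurd (herase T hT).2.2 h4
    · rw [if_neg h3]
      split_ifs with h4
      · rw [stripSum, Finset.sum_eq_zero, mul_zero]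
        intro T hT
        exact absurd ((mem_tilings.1 hT).insert_tile hn hj h4).2.2.1 h3
      · rw [mul_zero]

theorem stripSumLT_succ_of_not_jump (n : ℕ) (hn : 1 ≤ n) (q : K) (p : ℤ) (k : ℕ)
    {lam mu : YoungDiagram} (hj : ∀ gam, ¬ IsJump n p gam mu) :
    stripSumLT n q (p + n) (k + 1) lam mu = stripSumLT n q (p + n - 1) (k + 1) lam mu := by
  classical
  unfold stripSumLT
  by_cases h2 : ContentsLT (p + n - 1) lam mu
  · have h3 : ContentsLT (p + n) lam mu := fun x hx => (h2 x hx).trans (by omega)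
    rw [if_pos h2, if_pos h3]
  · rw [if_neg h2]
    split_ifs with h3
    · refine Finset.sum_eq_zero fun T hT => ?_
      obtain ⟨gam', hj', -⟩ := (mem_tilings.1 hT).exists_erase hn h3 h2
      exact absurd hj' (hj gam')
    · rfl

theorem stripSumLT_zero (n : ℕ) (q : K) (M : ℤ) (lam mu : YoungDiagram) [Decidable (mu = lam)] :
    stripSumLT n q M 0 lam mu = if mu = lam then 1 else 0 := by
  unfold stripSumLT
  rw [stripSum_zero]
  by_cases h : mu = lam
  · subst h
    rw [if_pos]
    intro x hx
    simp at hx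
  · simp [h]

/-- At contents `d ≤ -|lam|` the profile of `lam` is `-d`. The initial cell of a tile has content `p
+ n - 1` and lies at most in row `-(p + n)`, so it would have a negative column. This is the start
of the recursion. -/
theorem stripSumLT_of_le_neg_card (n : ℕ) (hn : 1 ≤ n) (q : K) {M : ℤ} (k : ℕ)
    {lam mu : YoungDiagram} (hM : M ≤ -(lam.card : ℤ)) : stripSumLT n q M (k + 1) lam mu = 0 := by
  unfold stripSumLT
  split_ifs with h
  · refine Finset.sum_eq_zero fun T hT => ?_
    exfalso
    have hT := mem_tilings.1 hT
    have h1 : T.Nonempty := Finset.card_pos.1 (by rw [hT.card_eq]; omega)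
    obtain ⟨R, hR⟩ := h1
    obtain ⟨p, ρ, ht⟩ := hT.exists_isTile hR
    have h2 := hT.add_le hn h hR ht
    have h3 := ht.diagCell_mem (d := p) le_rfl (by omega)
    have h4 := ht.outside p le_rfl (by omega)
    have h5 := ht.initial
    have h6 := ht.nonneg (p + n - 1) (by omega) (by omega)
    have h7 := prof_of_le_neg_card (lam := lam) (d := p + n) (by omega)
    omega
  · rfl

theorem stripSumLT_of_lt (n : ℕ) (q : K) {M : ℤ} (k : ℕ)
    {lam mu : YoungDiagram} (hM : ((lam.card + n * k : ℕ) : ℤ) ≤ M) :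
    stripSumLT n q M k lam mu = stripSum n q k lam mu := by
  unfold stripSumLT
  split_ifs with h
  · rfl
  · by_contra hc
    have h1 : mu.card = lam.card + n * k := by
      by_contra h2
      exact hc (stripSum_eq_zero q h2).symm
    refine h fun x hx => ?_
    have := content_lt_card (Finset.mem_sdiff.1 hx).1
    rw [h1] at this
    omega

end

end RibbonFock

namespace RibbonFock

/-! ## Operators on all bead configurations -/

/-- The vector space with basis all bead configurations. -/
abbrev BeadSpace (K : Type) [Field K] : Type := (ℤ → Bool) →₀ K

section
variable {K : Type} [Field K]

theorem end_ext {X : Type} {x y : Module.End K (X →₀ K)}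
    (h : ∀ s, x (Finsupp.single s 1) = y (Finsupp.single s 1)) : x = y :=
  Finsupp.lhom_ext' fun s => LinearMap.ext_ring (h s)

/-- The operator that moves a bead from `a` to `b`. -/
noncomputable def opMove (K : Type) [Field K] (a b : ℤ) : Module.End K (BeadSpace K) :=
  Finsupp.linearCombination K fun s =>
    if s a = true ∧ s b = false then Finsupp.single (moveBead s a b) 1 else 0

/-- The diagonal operator with eigenvalues `g s`. -/
noncomputable def opDiag (g : (ℤ → Bool) → K) : Module.End K (BeadSpace K) :=
  Finsupp.linearCombination K fun s => Finsupp.single s (g s)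

theorem opMove_single (a b : ℤ) (s : ℤ → Bool) (c : K) :
    opMove K a b (Finsupp.single s c) =
      if s a = true ∧ s b = false then Finsupp.single (moveBead s a b) c else 0 := by
  rw [opMove, Finsupp.linearCombination_single]
  split_ifs <;> simp

theorem opDiag_single (g : (ℤ → Bool) → K) (s : ℤ → Bool) (c : K) :
    opDiag g (Finsupp.single s c) = Finsupp.single s (g s * c) := by
  rw [opDiag, Finsupp.linearCombination_single, Finsupp.smul_single, smul_eq_mul, mul_comm]

theorem opDiag_mul (g h : (ℤ → Bool) → K) : opDiag g * opDiag h = opDiag fun s => g s * h s := by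
  refine end_ext fun s => ?_
  simp only [Module.End.mul_apply, opDiag_single, mul_one]

theorem opDiag_commute (g h : (ℤ → Bool) → K) : Commute (opDiag g) (opDiag h) := by
  rw [Commute, SemiconjBy, opDiag_mul, opDiag_mul]
  simp only [mul_comm]

theorem moveBead_apply (s : ℤ → Bool) (a b m : ℤ) :
    moveBead s a b m = if m = b then true else if m = a then false else s m := by
  simp only [moveBead, Function.update_apply]

theorem opDiag_mul_opMove {a b : ℤ} {g g' : (ℤ → Bool) → K} {c : K}
    (h : ∀ s, s a = true → s b = false → g (moveBead s a b) = c * g' s) :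
    opDiag g * opMove K a b = c • (opMove K a b * opDiag g') := by
  refine end_ext fun s => ?_
  simp only [Module.End.mul_apply, LinearMap.smul_apply, opDiag_single, opMove_single, mul_one]
  split_ifs with hs
  · rw [opDiag_single, mul_one, Finsupp.smul_single, smul_eq_mul, h s hs.1 hs.2]
  · simp

theorem opMove_commute {a b c d : ℤ} (hac : a ≠ c) (had : a ≠ d) (hbc : b ≠ c) (hbd : b ≠ d) :
    Commute (opMove K a b) (opMove K c d) := by
  refine end_ext fun s => ?_
  have e1 : ∀ s, moveBead s c d a = s a := fun s => by simp [moveBead_apply, hac, had]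
  have e2 : ∀ s, moveBead s c d b = s b := fun s => by simp [moveBead_apply, hbc, hbd]
  have e3 : ∀ s, moveBead s a b c = s c := fun s => by simp [moveBead_apply, hac.symm, hbc.symm]
  have e4 : ∀ s, moveBead s a b d = s d := fun s => by simp [moveBead_apply, had.symm, hbd.symm]
  have e5 : moveBead (moveBead s c d) a b = moveBead (moveBead s a b) c d := by
    funext m
    simp only [moveBead_apply]
    split_ifs <;> simp_all
  simp only [Module.End.mul_apply, opMove_single]
  split_ifs with h1 h2 h2 <;> simp [opMove_single, *]

theorem opMove_mul_same_source (a b c : ℤ) (hac : a ≠ c) :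
    opMove K a b * opMove K a c = 0 := by
  refine end_ext fun s => ?_
  simp only [Module.End.mul_apply, opMove_single]
  split_ifs with h1
  · rw [opMove_single, if_neg]
    · rfl
    · simp [moveBead_apply, hac]
  · simp

theorem opMove_mul_same_target (a b c : ℤ) : opMove K b a * opMove K c a = 0 := by
  refine end_ext fun s => ?_
  simp only [Module.End.mul_apply, opMove_single]
  split_ifs with h1
  · rw [opMove_single, if_neg]
    · rfl
    · simp [moveBead_apply]
  · simp

/-- The first move empties `a` and the middle one does not fill it, so the last one finds no bead.
This lemma and the next give the relations `X B X = 0` in the proof of the Serre relations. -/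
theorem opMove_mul_mul_same_source {a b c d e : ℤ} (hae : a ≠ e) (had : a ≠ d) :
    opMove K a b * opMove K c d * opMove K a e = 0 := by
  refine end_ext fun s => ?_
  simp only [Module.End.mul_apply, opMove_single]
  split_ifs with h1
  · rw [opMove_single]
    split_ifs with h2
    · rw [opMove_single, if_neg]
      · rfl
      · simp [moveBead_apply, hae, had]
    · simp
  · simp

theorem opMove_mul_mul_same_target {a b c d e : ℤ} (hbc : b ≠ c) :
    opMove K a b * opMove K c d * opMove K e b = 0 := by
  refine end_ext fun s => ?_
  simp only [Module.End.mul_apply, opMove_single]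
  split_ifs with h1
  · rw [opMove_single]
    split_ifs with h2
    · rw [opMove_single, if_neg]
      · rfl
      · simp [moveBead_apply, hbc]
    · simp
  · simp

/-- The sum of `stepAt s m` over `m ∈ T`. -/
def stepSum (T : Finset ℤ) (s : ℤ → Bool) : ℤ := ∑ m ∈ T, stepAt s m

theorem ite_moveBead {s : ℤ → Bool} {a b : ℤ} (ha : s a = true) (hb : s b = false) (m : ℤ) :
    (if moveBead s a b m = true then (1 : ℤ) else 0) =
      (if s m = true then 1 else 0) - (if m = a then 1 else 0) + if m = b then 1 else 0 := by
  have hab : a ≠ b := by rintro rfl; simp_all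
  rw [moveBead_apply]
  by_cases h1 : m = b
  · subst h1; simp [hab.symm, hb]
  · by_cases h2 : m = a
    · subst h2; simp [hab, ha]
    · simp [h1, h2]

/-- The sum is linear in the occupation numbers, and each position `x` occurs in the steps at `x`
and at `x - 1`, with opposite signs. -/
theorem stepSum_moveBead (T : Finset ℤ) {s : ℤ → Bool} {a b : ℤ} (ha : s a = true)
    (hb : s b = false) : stepSum T (moveBead s a b) = stepSum T s - (if a ∈ T then 1 else 0)
      + (if a - 1 ∈ T then 1 else 0) + (if b ∈ T then 1 else 0) -
        (if b - 1 ∈ T then 1 else 0) := by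
  have e : ∀ x, (∑ m ∈ T, if m + 1 = x then (1 : ℤ) else 0) = if x - 1 ∈ T then 1 else 0 := by
    intro x
    have : ∀ m : ℤ, m + 1 = x ↔ m = x - 1 := fun m => by omega
    simp only [this, Finset.sum_ite_eq']
  unfold stepSum stepAt
  simp only [ite_moveBead ha hb, Finset.sum_sub_distrib, Finset.sum_add_distrib, e,
    Finset.sum_ite_eq']
  ring

/-- The operator `∏_{m ∈ T} K_m ^ ε`. -/
noncomputable def opK (q : K) (T : Finset ℤ) (ε : ℤ) : Module.End K (BeadSpace K) :=
  opDiag fun s => q ^ (ε * stepSum T s)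

theorem opK_mul_opMove {q : K} (hq : q ≠ 0) (T : Finset ℤ) (ε : ℤ) (a b : ℤ) {c : ℤ}
    (hc : c = -(if a ∈ T then 1 else 0) + (if a - 1 ∈ T then 1 else 0) +
      (if b ∈ T then 1 else 0) - (if b - 1 ∈ T then 1 else 0)) :
    opK q T ε * opMove K a b = q ^ (ε * c) • (opMove K a b * opK q T ε) := by
  refine opDiag_mul_opMove fun s h1 h2 => ?_
  rw [stepSum_moveBead T h1 h2, ← zpow_add₀ hq, hc]
  congr 1
  ring

theorem opK_union {q : K} (hq : q ≠ 0) {T T' : Finset ℤ} (h : Disjoint T T') (ε : ℤ) :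
    opK q (T ∪ T') ε = opK q T ε * opK q T' ε := by
  rw [opK, opK, opK, opDiag_mul]
  congr 1
  funext s
  rw [← zpow_add₀ hq, stepSum, Finset.sum_union h, mul_add]
  rfl

theorem opK_singleton_single (q : K) (m ε : ℤ) (s : ℤ → Bool) (c : K) :
    opK q {m} ε (Finsupp.single s c) = Finsupp.single s (q ^ (ε * stepAt s m) * c) := by
  rw [opK, opDiag_single, stepSum, Finset.sum_singleton]

theorem opK_commute (q : K) (T T' : Finset ℤ) (ε ε' : ℤ) :
    Commute (opK q T ε) (opK q T' ε') := opDiag_commute _ _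

/-! ## Jumps -/

/-- The weight of a bead that is jumped over. -/
noncomputable def beadWeight (q : K) (m : ℤ) (s : ℤ → Bool) : K := if s m then (-q)⁻¹ else 1

/-- The operator that moves a bead from `p` to `p + n`, with weight `-q⁻¹` for each bead
between. -/
noncomputable def opJump (n : ℕ) (q : K) (p : ℤ) : Module.End K (BeadSpace K) :=
  opMove K p (p + n) * opDiag fun s => ∏ m ∈ Finset.Ioo p (p + n), beadWeight q m s

theorem prod_beadWeight (n : ℕ) (q : K) (p : ℤ) (s : ℤ → Bool) :
    ∏ m ∈ Finset.Ioo p (p + n), beadWeight q m s = (-q) ^ (-(beadsBetween n s p : ℤ)) := by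
  unfold beadWeight beadsBetween
  rw [Finset.prod_ite, Finset.prod_const, Finset.prod_const_one, mul_one, zpow_neg, zpow_natCast,
    inv_pow]

/-- A move that stays inside `A` or outside `A` preserves the number of beads in `A`. -/
theorem prod_beadWeight_moveBead (q : K) {A : Finset ℤ} {a b : ℤ} {s : ℤ → Bool}
    (hA : a ∈ A ↔ b ∈ A) (ha : s a = true) (hb : s b = false) :
    ∏ m ∈ A, beadWeight q m (moveBead s a b) = ∏ m ∈ A, beadWeight q m s := by
  have hab : a ≠ b := by rintro rfl; simp_all
  by_cases h : a ∈ A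
  · have h' := hA.1 h
    have hb' : b ∈ A.erase a := Finset.mem_erase.2 ⟨hab.symm, h'⟩
    rw [← Finset.mul_prod_erase A _ h, ← Finset.mul_prod_erase (A.erase a) _ hb',
      ← Finset.mul_prod_erase A _ h, ← Finset.mul_prod_erase (A.erase a) _ hb']
    rw [Finset.prod_congr rfl (g := fun m => beadWeight q m s)]
    · simp [beadWeight, moveBead_apply, hab, ha, hb]
    · intro m hm
      simp only [Finset.mem_erase] at hm
      simp [beadWeight, moveBead_apply, hm.1, hm.2.1]
  · have h' := fun hc => h (hA.2 hc)
    refine Finset.prod_congr rfl fun m hm => ?_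
    have h1 : m ≠ a := by rintro rfl; exact h hm
    have h2 : m ≠ b := by rintro rfl; exact h' hm
    simp [beadWeight, moveBead_apply, h1, h2]

theorem opDiag_prod_commute_opMove (q : K) {A : Finset ℤ} {a b : ℤ} (hA : a ∈ A ↔ b ∈ A) :
    Commute (opDiag fun s => ∏ m ∈ A, beadWeight q m s) (opMove K a b) := by
  have h := opDiag_mul_opMove (K := K) (a := a) (b := b)
    (g := fun s => ∏ m ∈ A, beadWeight q m s) (g' := fun s => ∏ m ∈ A, beadWeight q m s) (c := 1)
    fun s h1 h2 => by rw [one_mul, prod_beadWeight_moveBead q hA h1 h2]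
  rw [one_smul] at h
  exact h

theorem opJump_commute_opMove (n : ℕ) (q : K) {p a b : ℤ} (h1 : a ≠ p) (h2 : a ≠ p + n)
    (h3 : b ≠ p) (h4 : b ≠ p + n) (h5 : (p < a ∧ a < p + n) ↔ (p < b ∧ b < p + n)) :
    Commute (opJump n q p) (opMove K a b) :=
  (opMove_commute h1.symm h3.symm h2.symm h4.symm).mul_left
    (opDiag_prod_commute_opMove q (by simpa using h5))

theorem opJump_commute_opK (n : ℕ) {q : K} (hq : q ≠ 0) {p : ℤ} {T : Finset ℤ} (ε : ℤ)
    (h1 : p ∈ T ↔ p + n ∈ T) (h2 : p - 1 ∈ T ↔ p + n - 1 ∈ T) :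
    Commute (opJump n q p) (opK q T ε) := by
  refine Commute.mul_left ?_ (opDiag_commute _ _)
  have := opK_mul_opMove hq T ε p (p + n) (c := 0) (by
    simp only [h1, h2]; ring)
  rw [mul_zero, zpow_zero, one_smul] at this
  exact this.symm

/-! ## Local commutation on four positions -/

/-- `s` with prescribed values at four positions. -/
def setFour (a b c d : ℤ) (s : ℤ → Bool) (x y z w : Bool) : ℤ → Bool := fun m =>
  if m = a then x else if m = b then y else if m = c then z else if m = d then w else s m

theorem setFour_self (a b c d : ℤ) (s : ℤ → Bool) :
    setFour a b c d s (s a) (s b) (s c) (s d) = s := by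
  funext m
  unfold setFour
  split_ifs <;> simp_all

/-- The bead configuration `s` with prescribed values at `p`, `p + 1`, `p + n`, `p + n + 1`. -/
def localState (n : ℕ) (p : ℤ) (s : ℤ → Bool) (x y z w : Bool) : ℤ → Bool :=
  setFour p (p + 1) (p + n) (p + n + 1) s x y z w

/-- Every configuration is of this form, and in this form the occupation of the four positions can
be split into sixteen cases. -/
theorem local_ext {n : ℕ} {p : ℤ} {x y : Module.End K (BeadSpace K)}
    (h : ∀ s x₀ y₀ z₀ w₀, x (Finsupp.single (localState n p s x₀ y₀ z₀ w₀) 1) =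
      y (Finsupp.single (localState n p s x₀ y₀ z₀ w₀) 1)) : x = y :=
  end_ext fun s => by
    have := h s (s p) (s (p + 1)) (s (p + n)) (s (p + n + 1))
    rwa [localState, setFour_self] at this

theorem localState_apply {n : ℕ} (hn : 2 ≤ n) (p : ℤ) (s : ℤ → Bool) (x y z w : Bool) :
    localState n p s x y z w p = x ∧ localState n p s x y z w (p + 1) = y ∧
      localState n p s x y z w (p + n) = z ∧ localState n p s x y z w (p + n + 1) = w := by
  have h1 : p + n ≠ p := by omega
  have h2 : p + n ≠ p + 1 := by omega
  have h3 : p + n + 1 ≠ p := by omega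
  have h4 : p + n + 1 ≠ p + 1 := by omega
  have h5 : p + 1 ≠ p := by omega
  have h6 : p + n + 1 ≠ p + n := by omega
  unfold localState setFour
  refine ⟨if_pos rfl, ?_, ?_, ?_⟩
  · rw [if_neg h5, if_pos rfl]
  · rw [if_neg h1, if_neg h2, if_pos rfl]
  · rw [if_neg h3, if_neg h4, if_neg h6, if_pos rfl]

theorem moveBead_localState {n : ℕ} (hn : 2 ≤ n) (p : ℤ) (s : ℤ → Bool) (x y z w : Bool) :
    moveBead (localState n p s x y z w) p (p + 1) = localState n p s false true z w ∧
    moveBead (localState n p s x y z w) (p + 1) p = localState n p s true false z w ∧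
    moveBead (localState n p s x y z w) (p + n) (p + n + 1) = localState n p s x y false true ∧
    moveBead (localState n p s x y z w) (p + n + 1) (p + n) = localState n p s x y true false ∧
    moveBead (localState n p s x y z w) p (p + n) = localState n p s false y true w ∧
    moveBead (localState n p s x y z w) (p + 1) (p + n + 1) = localState n p s x false z true := by
  refine ⟨?_, ?_, ?_, ?_, ?_, ?_⟩ <;>
  · funext m
    simp only [moveBead_apply, localState, setFour]
    split_ifs <;> first | rfl | omega

/-- The operators are the two summands of `f_i` at `p` and `p + n` and the jumps `J_p` and
`J_{p+1}`, all without the factors they share. They depend on four positions only. In the critical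
cases two paths lead to the same configuration, one with the weight `-q⁻¹` of a bead jumped over and
the other with an eigenvalue of `K`, and they cancel. -/
theorem local_commute_lower {n : ℕ} (hn : 2 ≤ n) {q : K} (hq : q ≠ 0) (p : ℤ) :
    Commute (opMove K p (p + 1) * opK q {p + n} 1 + opMove K (p + n) (p + n + 1))
      (opMove K p (p + n) * opDiag (beadWeight q (p + 1)) +
        opMove K (p + 1) (p + n + 1) * opDiag (beadWeight q (p + n))) ∧
    Commute (opMove K p (p + 1) * opK q {p + n} 1 + opMove K (p + n) (p + n + 1))
      (opMove K (p + 1) (p + n + 1) * opDiag (beadWeight q (p + n)) *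
        (opMove K p (p + n) * opDiag (beadWeight q (p + 1)))) := by
  have hv := fun s x y z w => localState_apply hn p s x y z w
  have hm := fun s x y z w => moveBead_localState hn p s x y z w
  constructor <;>
  · refine local_ext (n := n) (p := p) fun s x y z w => ?_
    cases x <;> cases y <;> cases z <;> cases w <;>
    simp only [Module.End.mul_apply, LinearMap.add_apply, opMove_single, opDiag_single,
      opK_singleton_single, stepAt, hv, hm, beadWeight, if_true, if_false, and_true,
      and_false, Bool.false_eq_true, Bool.true_eq_false, map_zero, map_add,
      ← Finsupp.single_add, mul_one, one_mul, add_zero, zero_add, sub_zero, zero_sub, sub_self,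
      zpow_zero, zpow_one, zpow_neg_one, mul_zero]
    all_goals simp [inv_neg, inv_mul_cancel₀ hq]

theorem local_commute_raise {n : ℕ} (hn : 2 ≤ n) {q : K} (hq : q ≠ 0) (p : ℤ) :
    Commute (opMove K (p + 1) p + opMove K (p + n + 1) (p + n) * opK q {p} (-1))
      (opMove K p (p + n) * opDiag (beadWeight q (p + 1)) +
        opMove K (p + 1) (p + n + 1) * opDiag (beadWeight q (p + n))) ∧
    Commute (opMove K (p + 1) p + opMove K (p + n + 1) (p + n) * opK q {p} (-1))
      (opMove K (p + 1) (p + n + 1) * opDiag (beadWeight q (p + n)) *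
        (opMove K p (p + n) * opDiag (beadWeight q (p + 1)))) := by
  have hv := fun s x y z w => localState_apply hn p s x y z w
  have hm := fun s x y z w => moveBead_localState hn p s x y z w
  constructor <;>
  · refine local_ext (n := n) (p := p) fun s x y z w => ?_
    cases x <;> cases y <;> cases z <;> cases w <;>
    simp only [Module.End.mul_apply, LinearMap.add_apply, opMove_single, opDiag_single,
      opK_singleton_single, stepAt, hv, hm, beadWeight, if_true, if_false, and_true,
      and_false, Bool.false_eq_true, Bool.true_eq_false, map_zero, map_add,
      ← Finsupp.single_add, mul_one, one_mul, add_zero, zero_add, sub_zero, zero_sub, sub_self,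
      zpow_zero, zpow_one, zpow_neg_one, neg_neg, neg_mul, mul_zero]
    all_goals simp [inv_neg, inv_mul_cancel₀ hq]

/-- Both jumps pass over the positions strictly between `p + 1` and `p + n`; besides these `J_p`
passes over `p + 1` and `J_{p+1}` over `p + n`. The common weight is split off so that the local
computation applies. -/
theorem opJump_factor {n : ℕ} (hn : 2 ≤ n) (q : K) (p : ℤ) :
    opJump n q p = opMove K p (p + n) * opDiag (beadWeight q (p + 1)) *
      opDiag (fun s => ∏ m ∈ Finset.Ioo (p + 1) (p + n), beadWeight q m s) := by
  have e : Finset.Ioo p (p + n) = insert (p + 1) (Finset.Ioo (p + 1) (p + n)) := by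
    ext; simp; omega
  rw [mul_assoc, opDiag_mul, opJump, e]
  congr 2
  funext s
  rw [Finset.prod_insert (by simp)]

theorem opJump_succ_factor {n : ℕ} (hn : 2 ≤ n) (q : K) (p : ℤ) :
    opJump n q (p + 1) = opMove K (p + 1) (p + n + 1) * opDiag (beadWeight q (p + n)) *
      opDiag (fun s => ∏ m ∈ Finset.Ioo (p + 1) (p + n), beadWeight q m s) := by
  have e : Finset.Ioo (p + 1) (p + 1 + n) = insert (p + n) (Finset.Ioo (p + 1) (p + n)) := by
    ext; simp; omega
  have e2 : p + 1 + n = p + n + 1 := by ring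
  rw [mul_assoc, opDiag_mul, opJump, e, e2]
  congr 2
  funext s
  rw [Finset.prod_insert (by simp)]

/-- The common weight factor also commutes with the local part of `J_p`, whose endpoints lie outside
its range, so in the product of the two jumps both weight factors can be collected on the right. -/
theorem commute_jumps_of_local {n : ℕ} (hn : 2 ≤ n) {q : K} {p : ℤ}
    {x : Module.End K (BeadSpace K)}
    (hC : Commute x (opDiag fun s => ∏ m ∈ Finset.Ioo (p + 1) (p + n), beadWeight q m s))
    (h1 : Commute x (opMove K p (p + n) * opDiag (beadWeight q (p + 1)) +
        opMove K (p + 1) (p + n + 1) * opDiag (beadWeight q (p + n))))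
    (h2 : Commute x (opMove K (p + 1) (p + n + 1) * opDiag (beadWeight q (p + n)) *
        (opMove K p (p + n) * opDiag (beadWeight q (p + 1))))) :
    Commute x (opJump n q p + opJump n q (p + 1)) ∧
      Commute x (opJump n q (p + 1) * opJump n q p) := by
  rw [opJump_factor hn, opJump_succ_factor hn, ← add_mul]
  refine ⟨h1.mul_right hC, ?_⟩
  have h3 : Commute (opDiag fun s => ∏ m ∈ Finset.Ioo (p + 1) (p + n), beadWeight q m s)
      (opMove K p (p + n) * opDiag (beadWeight q (p + 1))) :=
    (opDiag_prod_commute_opMove q (by simp)).mul_right (opDiag_commute _ _)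
  rw [mul_assoc, ← mul_assoc (opDiag fun s => ∏ m ∈ _, beadWeight q m s), h3.eq,
    mul_assoc _ _ (opDiag fun s => ∏ m ∈ _, beadWeight q m s), ← mul_assoc]
  exact h2.mul_right (hC.mul_right hC)

theorem lower_pair_commute_jumps {n : ℕ} (hn : 2 ≤ n) {q : K} (hq : q ≠ 0) (p : ℤ) :
    Commute (opMove K p (p + 1) * opK q {p + n} 1 + opMove K (p + n) (p + n + 1))
        (opJump n q p + opJump n q (p + 1)) ∧
      Commute (opMove K p (p + 1) * opK q {p + n} 1 + opMove K (p + n) (p + n + 1))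
        (opJump n q (p + 1) * opJump n q p) := by
  obtain ⟨h1, h2⟩ := local_commute_lower hn hq p
  refine commute_jumps_of_local hn ?_ h1 h2
  refine Commute.add_left (Commute.mul_left ?_ (opDiag_commute _ _)) ?_
  · exact (opDiag_prod_commute_opMove q (by simp)).symm
  · refine (opDiag_prod_commute_opMove q ?_).symm
    simp

theorem raise_pair_commute_jumps {n : ℕ} (hn : 2 ≤ n) {q : K} (hq : q ≠ 0) (p : ℤ) :
    Commute (opMove K (p + 1) p + opMove K (p + n + 1) (p + n) * opK q {p} (-1))
        (opJump n q p + opJump n q (p + 1)) ∧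
      Commute (opMove K (p + 1) p + opMove K (p + n + 1) (p + n) * opK q {p} (-1))
        (opJump n q (p + 1) * opJump n q p) := by
  obtain ⟨h1, h2⟩ := local_commute_raise hn hq p
  refine commute_jumps_of_local hn ?_ h1 h2
  refine Commute.add_left ?_ (Commute.mul_left ?_ (opDiag_commute _ _))
  · exact (opDiag_prod_commute_opMove q (by simp)).symm
  · refine (opDiag_prod_commute_opMove q ?_).symm
    simp

/-! ## Truncated Chevalley operators -/

/-- The summand of `f_i` that moves the bead at `a`, where `T` is the range of positions. -/
noncomputable def opLower (q : K) (T : Finset ℤ) (a : ℤ) : Module.End K (BeadSpace K) :=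
  opMove K a (a + 1) * opK q (T.filter fun m => a < m) 1

/-- The summand of `e_i` that moves the bead at `a + 1`, where `T` is the range of positions. -/
noncomputable def opRaise (q : K) (T : Finset ℤ) (a : ℤ) : Module.End K (BeadSpace K) :=
  opMove K (a + 1) a * opK q (T.filter fun m => m < a) (-1)

/-- The truncation of `f_i` to the positions `a` such that `|a| ≤ N`. -/
noncomputable def truncF (n : ℕ) (q : K) (i : ZMod n) (N : ℕ) : Module.End K (BeadSpace K) :=
  ∑ a ∈ window n i N, opLower q (window n i (N + 1)) a

/-- The truncation of `e_i` to the positions `a` such that `|a| ≤ N`. -/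
noncomputable def truncE (n : ℕ) (q : K) (i : ZMod n) (N : ℕ) : Module.End K (BeadSpace K) :=
  ∑ a ∈ window n i N, opRaise q (window n i (N + 1)) a

theorem add_le_of_residue {n : ℕ} {a b : ℤ} (h : (a : ZMod n) = b) (hab : a < b) : a + n ≤ b := by
  have h1 := (ZMod.intCast_eq_intCast_iff_dvd_sub a b n).1 h
  have := Int.le_of_dvd (by omega) h1
  omega

theorem residue_add (n : ℕ) (a : ℤ) : ((a + n : ℤ) : ZMod n) = a := by simp

end

end RibbonFock

/-! ### Commutation of the truncated Chevalley operators with jumps -/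

namespace RibbonFock
section
variable {K : Type} [Field K]

/-- A jump preserves residues: what it changes in the steps at `p` and `p - 1` is undone at `p + n`
and `p + n - 1`, provided the filter treats a position and its translate by `n` alike. -/
theorem opJump_commute_opK_filter {n : ℕ} {q : K} (hq : q ≠ 0) {i : ZMod n} {N : ℕ}
    {p : ℤ} (hT : -(N : ℤ) ≤ p - 1 ∧ p + n ≤ N) (P : ℤ → Prop) [DecidablePred P] (ε : ℤ)
    (hP : ∀ m, m = p ∨ m = p - 1 → (m : ZMod n) = i → (P m ↔ P (m + n))) :
    Commute (opJump n q p) (opK q ((window n i N).filter P) ε) := by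
  have hmem : ∀ m, m = p ∨ m = p - 1 →
      (m ∈ (window n i N).filter P ↔ m + n ∈ (window n i N).filter P) := by
    intro m hm
    rw [Finset.mem_filter, Finset.mem_filter, mem_window, mem_window, residue_add]
    have h1 : (-(N : ℤ) ≤ m ∧ m ≤ N) ↔ (-(N : ℤ) ≤ m + n ∧ m + n ≤ N) := by omega
    rw [h1]
    by_cases h : (m : ZMod n) = i
    · rw [hP m hm h]
    · simp [h]
  refine opJump_commute_opK n hq ε (hmem p (Or.inl rfl)) ?_
  have e : p + n - 1 = p - 1 + n := by ring
  rw [e]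
  exact hmem (p - 1) (Or.inr rfl)

theorem opLower_commute_opJump {n : ℕ} {q : K} (hq : q ≠ 0) {i : ZMod n} {N : ℕ}
    {a p : ℤ} (ha : (a : ZMod n) = i) (h1 : a ≠ p) (h2 : a ≠ p + n) (h3 : a + 1 ≠ p)
    (h4 : a + 1 ≠ p + n) (hT : -(N : ℤ) ≤ p - 1 ∧ p + n ≤ N) :
    Commute (opLower q (window n i N) a) (opJump n q p) := by
  refine Commute.mul_left (opJump_commute_opMove n q h1 h2 h3 h4 (by omega)).symm
    (opJump_commute_opK_filter hq hT _ _ ?_).symm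
  intro m hm hmi
  constructor
  · intro h; omega
  · intro h
    have := add_le_of_residue (n := n) (a := a) (b := m + n)
      (by rw [residue_add, ha, hmi]) h
    omega

theorem opRaise_commute_opJump {n : ℕ} {q : K} (hq : q ≠ 0) {i : ZMod n} {N : ℕ}
    {a p : ℤ} (ha : (a : ZMod n) = i) (h1 : a ≠ p) (h2 : a ≠ p + n) (h3 : a + 1 ≠ p)
    (h4 : a + 1 ≠ p + n) (hT : -(N : ℤ) ≤ p - 1 ∧ p + n ≤ N) :
    Commute (opRaise q (window n i N) a) (opJump n q p) := by
  refine Commute.mul_left (opJump_commute_opMove n q h3 h4 h1 h2 (by omega)).symm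
    (opJump_commute_opK_filter hq hT _ _ ?_).symm
  intro m hm hmi
  constructor
  · intro h
    have := add_le_of_residue (n := n) (a := m) (b := a) (by rw [ha, hmi]) h
    omega
  · intro h; omega

/-- The truncated Chevalley operators commute with the jumps from other residues. -/
theorem trunc_commute_opJump {n : ℕ} {q : K} (hq : q ≠ 0) {i : ZMod n} {N : ℕ} {p : ℤ}
    (hi : (p : ZMod n) ≠ i) (hi' : (p : ZMod n) ≠ i + 1) (hT : -(N : ℤ) ≤ p ∧ p + n ≤ N) :
    Commute (truncF n q i N) (opJump n q p) ∧ Commute (truncE n q i N) (opJump n q p) := by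
  have key : ∀ a ∈ window n i N, a ≠ p ∧ a ≠ p + n ∧ a + 1 ≠ p ∧ a + 1 ≠ p + n := by
    intro a ha
    have ha := (mem_window.1 ha).2
    refine ⟨?_, ?_, ?_, ?_⟩
    · rintro rfl; exact hi ha
    · rintro rfl; rw [residue_add] at ha; exact hi ha
    · rintro rfl; rw [Int.cast_add, ha] at hi'; simp at hi'
    · intro h
      have : ((a + 1 : ℤ) : ZMod n) = p := by rw [h, residue_add]
      rw [Int.cast_add, ha] at this
      exact hi' (by rw [← this]; simp)
  constructor
  · refine Commute.sum_left _ _ _ fun a ha => ?_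
    obtain ⟨h1, h2, h3, h4⟩ := key a ha
    exact opLower_commute_opJump hq (mem_window.1 ha).2 h1 h2 h3 h4 (by push_cast; omega)
  · refine Commute.sum_left _ _ _ fun a ha => ?_
    obtain ⟨h1, h2, h3, h4⟩ := key a ha
    exact opRaise_commute_opJump hq (mem_window.1 ha).2 h1 h2 h3 h4 (by push_cast; omega)

/-- The truncated Chevalley operators commute with pairs of adjacent jumps. -/
theorem trunc_commute_pair {n : ℕ} (hn : 2 ≤ n) {q : K} (hq : q ≠ 0) {i : ZMod n} {N : ℕ} {p : ℤ}
    (hi : (p : ZMod n) = i) (hT : -(N : ℤ) ≤ p ∧ p + n ≤ N) :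
    (Commute (truncF n q i N) (opJump n q p + opJump n q (p + 1)) ∧
      Commute (truncF n q i N) (opJump n q (p + 1) * opJump n q p)) ∧
    (Commute (truncE n q i N) (opJump n q p + opJump n q (p + 1)) ∧
      Commute (truncE n q i N) (opJump n q (p + 1) * opJump n q p)) := by
  have hp : p ∈ window n i N := mem_window.2 ⟨by omega, hi⟩
  have hpn : p + n ∈ (window n i N).erase p :=
    Finset.mem_erase.2 ⟨by omega, mem_window.2 ⟨by omega, by rw [residue_add, hi]⟩⟩
  -- Every other summand of the Chevalley operator acts at a distance of at least `n` from the pair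
  -- `p, p + n` and commutes with each of the two jumps separately.
  have hgap : ∀ m : ℤ, (m : ZMod n) = i → m ≠ p → m ≠ p + n → m + n ≤ p ∨ p + n + n ≤ m := by
    intro m hm h1 h2
    rcases lt_or_gt_of_ne h1 with h | h
    · exact Or.inl (add_le_of_residue (hm.trans hi.symm) h)
    · right
      have h3 := add_le_of_residue (n := n) (hi.trans hm.symm) h
      exact add_le_of_residue (by rw [residue_add, hi, hm]) (by omega)
  have hne : ∀ m : ℤ, (m : ZMod n) = i → m ≠ p + 1 ∧ m ≠ p - 1 := by
    intro m hm
    refine ⟨ne_add_one_of_residue hn (hi.trans hm.symm), fun h => ?_⟩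
    exact ne_add_one_of_residue hn (hm.trans hi.symm) (by omega)
  constructor
  · have hrest : ∀ a ∈ ((window n i N).erase p).erase (p + n),
        Commute (opLower q (window n i (N + 1)) a) (opJump n q p) ∧
        Commute (opLower q (window n i (N + 1)) a) (opJump n q (p + 1)) := by
      intro a ha
      simp only [Finset.mem_erase] at ha
      have hai := (mem_window.1 ha.2.2).2
      have hg := hgap a hai ha.2.1 ha.1
      constructor <;> refine opLower_commute_opJump hq hai ?_ ?_ ?_ ?_ ?_ <;> omega
    -- Among the positions of residue `i` to the right of `p` the first is `p + n`, so the factor of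
    -- `opLower` at `p` is `K` at `p + n` times that of `opLower` at `p + n`. The latter is a common
    -- factor.
    have hpair : opLower q (window n i (N + 1)) p + opLower q (window n i (N + 1)) (p + n) =
        (opMove K p (p + 1) * opK q {p + (n : ℤ)} 1 + opMove K (p + n) (p + n + 1)) *
          opK q ((window n i (N + 1)).filter fun m => p + n < m) 1 := by
      have e : (window n i (N + 1)).filter (fun m => p < m) =
          {p + (n : ℤ)} ∪ (window n i (N + 1)).filter (fun m => p + n < m) := by
        ext m
        simp only [Finset.mem_filter, Finset.mem_union, Finset.mem_singleton, mem_window]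
        constructor
        · rintro ⟨⟨h1, h2⟩, h3⟩
          have := add_le_of_residue (n := n) (hi.trans h2.symm) h3
          by_cases h4 : m = p + n
          · exact Or.inl h4
          · exact Or.inr ⟨⟨h1, h2⟩, by omega⟩
        · rintro (rfl | ⟨h1, h2⟩)
          · exact ⟨⟨by push_cast; omega, by rw [residue_add, hi]⟩, by omega⟩
          · exact ⟨h1, by omega⟩
      rw [add_mul, mul_assoc, ← opK_union hq (by simp), ← e]
      rfl
    have hK : ∀ p', p' = p ∨ p' = p + 1 → Commute
        (opK q ((window n i (N + 1)).filter fun m => p + n < m) 1) (opJump n q p') := by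
      intro p' hp'
      refine (opJump_commute_opK_filter hq (by push_cast; omega) _ _ ?_).symm
      intro m hm hmi
      have := hne m hmi
      rcases hp' with rfl | rfl <;> omega
    have hsplit : truncF n q i N = (opLower q (window n i (N + 1)) p +
        opLower q (window n i (N + 1)) (p + n)) + ∑ a ∈ ((window n i N).erase p).erase (p + n),
          opLower q (window n i (N + 1)) a := by
      rw [truncF, ← Finset.add_sum_erase _ _ hp, ← Finset.add_sum_erase _ _ hpn, add_assoc]
    have hloc := lower_pair_commute_jumps (K := K) hn hq p
    rw [hsplit, hpair]
    constructor
    · refine Commute.add_left (hloc.1.mul_left ((hK _ (Or.inl rfl)).add_right (hK _ (Or.inr rfl))))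
        (Commute.sum_left _ _ _ fun a ha => (hrest a ha).1.add_right (hrest a ha).2)
    · refine Commute.add_left (hloc.2.mul_left ((hK _ (Or.inr rfl)).mul_right (hK _ (Or.inl rfl))))
        (Commute.sum_left _ _ _ fun a ha => (hrest a ha).2.mul_right (hrest a ha).1)
  · have hrest : ∀ a ∈ ((window n i N).erase p).erase (p + n),
        Commute (opRaise q (window n i (N + 1)) a) (opJump n q p) ∧
        Commute (opRaise q (window n i (N + 1)) a) (opJump n q (p + 1)) := by
      intro a ha
      simp only [Finset.mem_erase] at ha
      have hai := (mem_window.1 ha.2.2).2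
      have hg := hgap a hai ha.2.1 ha.1
      constructor <;> refine opRaise_commute_opJump hq hai ?_ ?_ ?_ ?_ ?_ <;> omega
    -- This is the mirror image: the last position of residue `i` to the left of `p + n` is `p`.
    have hpair : opRaise q (window n i (N + 1)) p + opRaise q (window n i (N + 1)) (p + n) =
        (opMove K (p + 1) p + opMove K (p + n + 1) (p + n) * opK q {p} (-1)) *
          opK q ((window n i (N + 1)).filter fun m => m < p) (-1) := by
      have e : (window n i (N + 1)).filter (fun m => m < p + n) =
          {p} ∪ (window n i (N + 1)).filter (fun m => m < p) := by
        ext m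
        simp only [Finset.mem_filter, Finset.mem_union, Finset.mem_singleton, mem_window]
        constructor
        · rintro ⟨⟨h1, h2⟩, h3⟩
          by_cases h4 : m = p
          · exact Or.inl h4
          · refine Or.inr ⟨⟨h1, h2⟩, ?_⟩
            by_contra h5
            have := add_le_of_residue (n := n) (hi.trans h2.symm) (by omega)
            omega
        · rintro (rfl | ⟨h1, h2⟩)
          · exact ⟨⟨by push_cast; omega, hi⟩, by omega⟩
          · exact ⟨h1, by omega⟩
      rw [add_mul, mul_assoc, ← opK_union hq (by simp), ← e]
      rfl
    have hK : ∀ p', p' = p ∨ p' = p + 1 → Commute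
        (opK q ((window n i (N + 1)).filter fun m => m < p) (-1)) (opJump n q p') := by
      intro p' hp'
      refine (opJump_commute_opK_filter hq (by push_cast; omega) _ _ ?_).symm
      intro m hm hmi
      have := hne m hmi
      rcases hp' with rfl | rfl <;> omega
    have hsplit : truncE n q i N = (opRaise q (window n i (N + 1)) p +
        opRaise q (window n i (N + 1)) (p + n)) + ∑ a ∈ ((window n i N).erase p).erase (p + n),
          opRaise q (window n i (N + 1)) a := by
      rw [truncE, ← Finset.add_sum_erase _ _ hp, ← Finset.add_sum_erase _ _ hpn, add_assoc]
    have hloc := raise_pair_commute_jumps (K := K) hn hq p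
    rw [hsplit, hpair]
    constructor
    · refine Commute.add_left (hloc.1.mul_left ((hK _ (Or.inl rfl)).add_right (hK _ (Or.inr rfl))))
        (Commute.sum_left _ _ _ fun a ha => (hrest a ha).1.add_right (hrest a ha).2)
    · refine Commute.add_left (hloc.2.mul_left ((hK _ (Or.inr rfl)).mul_right (hK _ (Or.inl rfl))))
        (Commute.sum_left _ _ _ fun a ha => (hrest a ha).2.mul_right (hrest a ha).1)

end

end RibbonFock

namespace RibbonFock
open Filter
open scoped Polynomial
section
variable {K : Type} [Field K]

/-! ## Operators on the Fock space as limits -/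

/-- The embedding of the Fock space into the space of bead configurations. -/
noncomputable def toBeads (K : Type) [Field K] : Fock K →ₗ[K] BeadSpace K :=
  Finsupp.lmapDomain K K bead

theorem toBeads_single (lam : YoungDiagram) (c : K) :
    toBeads K (Finsupp.single lam c) = Finsupp.single (bead lam) c :=
  Finsupp.mapDomain_single

theorem toBeads_injective : Function.Injective (toBeads K) :=
  Finsupp.mapDomain_injective bead_injective

/-- `y` is the pointwise eventual limit of the operators `x N`. -/
def IsLimit (x : ℕ → Module.End K (BeadSpace K)) (y : Module.End K (Fock K)) : Prop :=
  ∀ v, ∀ᶠ N in atTop, x N (toBeads K v) = toBeads K (y v)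

theorem IsLimit.of_single {x : ℕ → Module.End K (BeadSpace K)} {y : Module.End K (Fock K)}
    (h : ∀ lam : YoungDiagram, ∀ᶠ N in atTop, x N (Finsupp.single (bead lam) 1) =
      toBeads K (y (Finsupp.single lam 1))) : IsLimit x y := by
  intro v
  induction v using Finsupp.induction_linear with
  | zero => simp
  | add f g hf hg =>
    filter_upwards [hf, hg] with N h1 h2
    rw [map_add, map_add, map_add, map_add, h1, h2]
  | single lam c =>
    filter_upwards [h lam] with N h1
    have e : Finsupp.single lam c = c • Finsupp.single lam (1 : K) := by simp
    rw [e, map_smul, map_smul, map_smul, map_smul, toBeads_single, h1]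

theorem IsLimit.add {x x' : ℕ → Module.End K (BeadSpace K)} {y y' : Module.End K (Fock K)}
    (h : IsLimit x y) (h' : IsLimit x' y') : IsLimit (fun N => x N + x' N) (y + y') := by
  intro v
  filter_upwards [h v, h' v] with N h1 h2
  rw [LinearMap.add_apply, LinearMap.add_apply, map_add, h1, h2]

theorem IsLimit.sub {x x' : ℕ → Module.End K (BeadSpace K)} {y y' : Module.End K (Fock K)}
    (h : IsLimit x y) (h' : IsLimit x' y') : IsLimit (fun N => x N - x' N) (y - y') := by
  intro v
  filter_upwards [h v, h' v] with N h1 h2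
  rw [LinearMap.sub_apply, LinearMap.sub_apply, map_sub, h1, h2]

theorem IsLimit.smul {x : ℕ → Module.End K (BeadSpace K)} {y : Module.End K (Fock K)}
    (c : K) (h : IsLimit x y) : IsLimit (fun N => c • x N) (c • y) := by
  intro v
  filter_upwards [h v] with N h1
  rw [LinearMap.smul_apply, LinearMap.smul_apply, map_smul, h1]

theorem IsLimit.mul {x x' : ℕ → Module.End K (BeadSpace K)} {y y' : Module.End K (Fock K)}
    (h : IsLimit x y) (h' : IsLimit x' y') : IsLimit (fun N => x N * x' N) (y * y') := by
  intro v
  filter_upwards [h (y' v), h' v] with N h1 h2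
  rw [Module.End.mul_apply, Module.End.mul_apply, h2, h1]

theorem IsLimit.one : IsLimit (fun _ => (1 : Module.End K (BeadSpace K))) 1 :=
  fun _ => Eventually.of_forall fun _ => rfl

theorem IsLimit.zero : IsLimit (fun _ => (0 : Module.End K (BeadSpace K))) 0 :=
  fun _ => Eventually.of_forall fun _ => by simp

theorem IsLimit.pow {x : ℕ → Module.End K (BeadSpace K)} {y : Module.End K (Fock K)}
    (h : IsLimit x y) (k : ℕ) : IsLimit (fun N => x N ^ k) (y ^ k) := by
  induction k with
  | zero => simpa using IsLimit.one
  | succ k ih => simpa only [pow_succ] using ih.mul h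

theorem IsLimit.sum {ι : Type} (s : Finset ι) {x : ι → ℕ → Module.End K (BeadSpace K)}
    {y : ι → Module.End K (Fock K)} (h : ∀ j ∈ s, IsLimit (x j) (y j)) :
    IsLimit (fun N => ∑ j ∈ s, x j N) (∑ j ∈ s, y j) := by
  classical
  induction s using Finset.induction_on with
  | empty => simpa using IsLimit.zero
  | insert a s ha ih =>
    simp only [Finset.sum_insert ha]
    exact (h a (Finset.mem_insert_self _ _)).add
      (ih fun j hj => h j (Finset.mem_insert_of_mem hj))

theorem IsLimit.comp {x : ℕ → Module.End K (BeadSpace K)} {y : Module.End K (Fock K)}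
    (h : IsLimit x y) {g : ℕ → ℕ} (hg : Tendsto g atTop atTop) : IsLimit (fun N => x (g N)) y :=
  fun v => hg.eventually (h v)

/-- A partition can be recovered from its beads, so identities between approximants descend to the
Fock space. All relations are transferred in this way. -/
theorem IsLimit.congr {x x' : ℕ → Module.End K (BeadSpace K)} {y y' : Module.End K (Fock K)}
    (h : IsLimit x y) (h' : IsLimit x' y') (he : ∀ᶠ N in atTop, x N = x' N) : y = y' := by
  refine LinearMap.ext fun v => toBeads_injective ?_
  obtain ⟨N, h1, h2, h3⟩ := ((h v).and ((h' v).and he)).exists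
  rw [← h1, ← h2, h3]

theorem IsNode.bead_eq {lam mu : YoungDiagram} {x : ℕ × ℕ} (h : IsNode lam mu x) :
    bead mu = moveBead (bead lam) (content x) (content x + 1) := by
  have := ((isNode_iff _ _ _).1 h).1.bead_eq le_rfl
  simpa using this

theorem fockF_single (n : ℕ) (q : K) (i : ZMod n) (lam : YoungDiagram) :
    fockF n q i (Finsupp.single lam 1) = ∑ x ∈ indentNodes n i lam,
      Finsupp.single (addNode lam x) (q ^ nodeCountRight n i lam x) := by
  rw [fockF, Finsupp.linearCombination_single, one_smul]

theorem fockE_single (n : ℕ) (q : K) (i : ZMod n) (nu : YoungDiagram) :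
    fockE n q i (Finsupp.single nu 1) = ∑ x ∈ removableNodes n i nu,
      Finsupp.single (removeNode nu x) (q ^ (-nodeCountLeft n i (removeNode nu x) x)) := by
  rw [fockE, Finsupp.linearCombination_single, one_smul]

/-- On `s_lam` the truncation is exact as soon as `N ≥ |lam|`, because all nodes of `lam` lie in the
window. -/
theorem isLimit_truncF {n : ℕ} (hn : 2 ≤ n) (q : K) (i : ZMod n) :
    IsLimit (truncF n q i) (fockF n q i) := by
  refine IsLimit.of_single fun lam => ?_
  filter_upwards [eventually_ge_atTop lam.card] with N hN
  rw [fockF_single, map_sum, sum_indentNodes hN, truncF, LinearMap.sum_apply]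
  refine Finset.sum_congr rfl fun d hd => ?_
  rw [opLower, Module.End.mul_apply, opK, opDiag_single, opMove_single]
  split_ifs with h
  · have hc := content_diagCell (d := d) (prof_nonneg lam d) (by have := neg_le_prof lam d; omega)
    have hi : IsIndent lam (diagCell (prof lam d) d) :=
      (isIndent_iff _ _).2 (by rw [hc]; exact ⟨h.1, h.2, rfl⟩)
    obtain ⟨mu, hmu⟩ := (isIndent_iff_exists _ _).1 hi
    rw [toBeads_single, hmu.addNode_eq, hmu.bead_eq, hc,
      nodeCountRight_eq hn i (N := N + 1) (by omega) (mem_window.1 hd).2 h.1 h.2, one_mul, mul_one]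
    rfl
  · simp

theorem isLimit_truncE {n : ℕ} (hn : 2 ≤ n) (q : K) (i : ZMod n) :
    IsLimit (truncE n q i) (fockE n q i) := by
  refine IsLimit.of_single fun nu => ?_
  filter_upwards [eventually_ge_atTop nu.card] with N hN
  rw [fockE_single, map_sum, sum_removableNodes hN, truncE, LinearMap.sum_apply]
  refine Finset.sum_congr rfl fun d hd => ?_
  rw [opRaise, Module.End.mul_apply, opK, opDiag_single, opMove_single]
  simp only [and_comm (a := bead nu (d + 1) = true)]
  split_ifs with h
  · have hb := prof_sub_one_bounds h.1 h.2
    have hc := content_diagCell (d := d) hb.1 hb.2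
    have hi : IsRemovable nu (diagCell (prof nu d - 1) d) :=
      (isRemovable_iff _ _).2 (by rw [hc]; exact ⟨h.1, h.2, rfl⟩)
    obtain ⟨lam, hlam⟩ := (isRemovable_iff_exists _ _).1 hi
    have hj := (isNode_iff _ _ _).1 hlam
    rw [hc] at hj
    have hs : bead lam d = true := hj.1.bead_source le_rfl
    have ht : bead lam (d + 1) = false := by simpa using hj.1.bead_target le_rfl
    have hbe := hlam.bead_eq
    rw [hc] at hbe
    have hx : diagCell (prof nu d - 1) d = diagCell (prof lam d) d := by
      have := hj.1 d
      rw [if_pos (by omega)] at this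
      rw [this, add_sub_cancel_right]
    have hcard : lam.card ≤ N + 1 := by have := hj.1.card_eq; omega
    have hmove : moveBead (bead nu) (d + 1) d = bead lam := by
      rw [hbe]
      funext m
      simp only [moveBead_apply]
      split_ifs with h1 h2 <;> simp_all
    -- Hayashi's formula counts nodes of the smaller partition, whereas `opRaise` evaluates `K`
    -- before the bead is moved. Strictly to the left of `d` the two counts agree, because `d - 1`
    -- has another residue.
    have hstep : stepSum ((window n i (N + 1)).filter fun m => m < d) (bead nu) =
        stepSum ((window n i (N + 1)).filter fun m => m < d) (bead lam) := by
      rw [hbe, stepSum_moveBead _ hs ht]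
      have hd' : ((d - 1 : ℤ) : ZMod n) ≠ i := by
        intro hc
        exact ne_add_one_of_residue hn (hc.trans (mem_window.1 hd).2.symm) (by omega)
      have hd'' : ((d : ℤ) : ZMod n) - 1 ≠ i := by simpa using hd'
      simp [mem_window, hd'']
    rw [toBeads_single, hlam.removeNode_eq, hx, nodeCountLeft_eq hn i hcard (mem_window.1 hd).2 hs ht,
      hmove, hstep, neg_one_mul, mul_one]
    rfl
  · simp

/-! ## The generating function of the jumps -/

/-- The coefficients of the ordered product of the `1 + X J_p` for `L ≤ p < L + m`. -/
noncomputable def jumpPoly (n : ℕ) (q : K) (L : ℤ) : ℕ → (Module.End K (BeadSpace K))[X]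
  | 0 => 1
  | m + 1 => (1 + Polynomial.C (opJump n q (L + m)) * Polynomial.X) * jumpPoly n q L m

/-- The product is cut into blocks of `n` factors, each starting with the two positions of residues
`L` and `L + 1`. Those two factors commute with `x` only jointly, the other `n - 2` one by one. -/
theorem C_commute_jumpPoly {n : ℕ} (hn : 2 ≤ n) {q : K} {L : ℤ} {x : Module.End K (BeadSpace K)}
    (t : ℕ) (h : ∀ p : ℤ, L ≤ p → p < L + n * t → (p : ZMod n) ≠ L → (p : ZMod n) ≠ L + 1 →
      Commute x (opJump n q p))
    (h1 : ∀ p : ℤ, L ≤ p → p < L + n * t → (p : ZMod n) = L →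
      Commute x (opJump n q p + opJump n q (p + 1)))
    (h2 : ∀ p : ℤ, L ≤ p → p < L + n * t → (p : ZMod n) = L →
      Commute x (opJump n q (p + 1) * opJump n q p)) :
    Commute (Polynomial.C x) (jumpPoly n q L (n * t)) := by
  have hC : ∀ {y : Module.End K (BeadSpace K)}, Commute x y →
      Commute (Polynomial.C x) (Polynomial.C y) := fun hy => hy.map Polynomial.C
  have hX : ∀ y : (Module.End K (BeadSpace K))[X], Commute y Polynomial.X :=
    fun y => (Polynomial.commute_X y).symm
  induction t with
  | zero => exact Commute.one_right _
  | succ t ih =>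
    have ih := ih (fun p a b => h p a (by push_cast; nlinarith))
      (fun p a b => h1 p a (by push_cast; nlinarith)) (fun p a b => h2 p a (by push_cast; nlinarith))
    have hpair : Commute (Polynomial.C x) (jumpPoly n q L (n * t + 2)) := by
      have hlt : L + ((n * t : ℕ) : ℤ) < L + n * (t + 1 : ℕ) := by push_cast; nlinarith
      have hres : ((L + ((n * t : ℕ) : ℤ) : ℤ) : ZMod n) = L := by simp
      have e1 := h1 (L + (n * t : ℕ)) (by omega) hlt hres
      have e2 := h2 (L + (n * t : ℕ)) (by omega) hlt hres
      -- The coefficients of the product of the two factors are exactly the sum and the ordered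
      -- product of the adjacent jumps.
      have e3 : jumpPoly n q L (n * t + 2) =
          (1 + Polynomial.C (opJump n q (L + (n * t : ℕ)) + opJump n q (L + (n * t : ℕ) + 1)) *
            Polynomial.X + Polynomial.C (opJump n q (L + (n * t : ℕ) + 1) *
              opJump n q (L + (n * t : ℕ))) * (Polynomial.X * Polynomial.X)) *
            jumpPoly n q L (n * t) := by
        have e4 : L + ((n * t + 1 : ℕ) : ℤ) = L + ((n * t : ℕ) : ℤ) + 1 := by push_cast; ring
        rw [jumpPoly, jumpPoly, e4, ← mul_assoc]
        congr 1
        rw [Polynomial.C_add, Polynomial.C_mul]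
        have e5 := Polynomial.X_mul (R := Module.End K (BeadSpace K))
          (p := Polynomial.C (opJump n q (L + (n * t : ℕ))))
        simp only [add_mul, mul_add, one_mul, mul_one]
        rw [mul_assoc _ Polynomial.X, ← mul_assoc Polynomial.X, e5]
        noncomm_ring
      rw [e3]
      refine Commute.mul_right (Commute.add_right (Commute.add_right (Commute.one_right _) ?_) ?_) ih
      · exact (hC e1).mul_right (hX _)
      · exact (hC e2).mul_right ((hX _).mul_right (hX _))
    have hstep : ∀ s : ℕ, s + 2 ≤ n →
        Commute (Polynomial.C x) (jumpPoly n q L (n * t + 2 + s)) := by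
      intro s
      induction s with
      | zero => intro _; exact hpair
      | succ s ihs =>
        intro hs
        rw [← add_assoc, jumpPoly]
        refine Commute.mul_right (Commute.add_right (Commute.one_right _) ?_) (ihs (by omega))
        refine (hC (h _ (by omega) (by push_cast; nlinarith) ?_ ?_)).mul_right (hX _)
        · intro hc
          have := (ZMod.intCast_eq_intCast_iff_dvd_sub _ _ n).1 hc.symm
          have e : L + ((n * t + 2 + s : ℕ) : ℤ) - L = n * t + (2 + s : ℕ) := by push_cast; ring
          rw [e, dvd_add_right (dvd_mul_right _ _), Int.natCast_dvd_natCast] at this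
          have := Nat.le_of_dvd (by omega) this
          omega
        · intro hc
          have hc' : ((L + 1 : ℤ) : ZMod n) = ((L + ((n * t + 2 + s : ℕ) : ℤ) : ℤ) : ZMod n) := by
            rw [hc]; push_cast; ring
          have := (ZMod.intCast_eq_intCast_iff_dvd_sub _ _ n).1 hc'
          have e : L + ((n * t + 2 + s : ℕ) : ℤ) - (L + 1) = n * t + (1 + s : ℕ) := by
            push_cast; ring
          rw [e, dvd_add_right (dvd_mul_right _ _), Int.natCast_dvd_natCast] at this
          have := Nat.le_of_dvd (by omega) this
          omega
    have := hstep (n - 2) (by omega)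
    have e : n * t + 2 + (n - 2) = n * (t + 1) := by rw [mul_add]; omega
    rwa [e] at this

theorem commute_coeff_of_commute_C {A : Type} [Semiring A] {x : A} {f : A[X]}
    (h : Commute (Polynomial.C x) f) (k : ℕ) : Commute x (f.coeff k) := by
  have := congrArg (fun g => Polynomial.coeff g k) h.eq
  simp only [Polynomial.coeff_C_mul, Polynomial.coeff_mul_C] at this
  exact this

end

end RibbonFock

/-! ### The operators `V_k` as coefficients of the ordered product of jumps -/

namespace RibbonFock
open Filter
open scoped Polynomial
section
variable {K : Type} [Field K]

theorem IsJump.opJump_apply {n : ℕ} (hn : 1 ≤ n) (q : K) {p : ℤ} {lam mu : YoungDiagram}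
    (h : IsJump n p lam mu) : opJump n q p (Finsupp.single (bead lam) 1) =
      Finsupp.single (bead mu) ((-q) ^ (-(beadsBetween n (bead lam) p : ℤ))) := by
  rw [opJump, Module.End.mul_apply, opDiag_single, opMove_single,
    if_pos ⟨h.bead_source hn, h.bead_target hn⟩, prod_beadWeight, mul_one, ← h.bead_eq hn]

theorem opJump_apply_of_not_jump {n : ℕ} (q : K) {p : ℤ} {lam : YoungDiagram}
    (h : ∀ mu, ¬ IsJump n p lam mu) : opJump n q p (Finsupp.single (bead lam) 1) = 0 := by
  rw [opJump, Module.End.mul_apply, opDiag_single, opMove_single, if_neg]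
  rintro ⟨h1, h2⟩
  obtain ⟨mu, hmu⟩ := exists_isJump h1 h2
  exact h mu hmu

/-- The part of `V_k s_lam` given by the strips whose cells have content less than `M`. -/
noncomputable def stripVector (n : ℕ) (q : K) (M : ℤ) (k : ℕ) (lam : YoungDiagram) : Fock K :=
  ∑ mu ∈ diagramsOfSize (lam.card + n * k), Finsupp.single mu (stripSumLT n q M k lam mu)

/-- This is the recursion on the rightmost ribbon, summed over all outer shapes; for each outer
shape at most one inner shape differs from it by a jump at `p`. -/
theorem toBeads_stripVector_succ {n : ℕ} (hn : 1 ≤ n) {q : K} (hq : q ≠ 0) (p : ℤ) (k : ℕ)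
    (lam : YoungDiagram) : toBeads K (stripVector n q (p + n) (k + 1) lam) =
      toBeads K (stripVector n q (p + n - 1) (k + 1) lam) +
        opJump n q p (toBeads K (stripVector n q (p + n - 1) k lam)) := by
  classical
  simp only [stripVector, map_sum, toBeads_single]
  have h1 : ∀ gam ∈ diagramsOfSize (lam.card + n * k),
      opJump n q p (Finsupp.single (bead gam) (stripSumLT n q (p + n - 1) k lam gam)) =
      ∑ mu ∈ diagramsOfSize (lam.card + n * (k + 1)), if IsJump n p gam mu then
        Finsupp.single (bead mu) ((-q) ^ (-(beadsBetween n (bead gam) p : ℤ)) *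
          stripSumLT n q (p + n - 1) k lam gam) else 0 := by
    intro gam hgam
    have e : Finsupp.single (bead gam) (stripSumLT n q (p + n - 1) k lam gam) =
        stripSumLT n q (p + n - 1) k lam gam • Finsupp.single (bead gam) (1 : K) := by simp
    rw [e, map_smul]
    by_cases hj : ∃ mu, IsJump n p gam mu
    · obtain ⟨mu, hmu⟩ := hj
      rw [hmu.opJump_apply hn, Finset.sum_eq_single_of_mem mu]
      · rw [if_pos hmu, Finsupp.smul_single, smul_eq_mul, mul_comm]
      · rw [mem_diagramsOfSize] at hgam ⊢
        rw [hmu.card_eq, hgam]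
        ring
      · intro mu' _ hne
        rw [if_neg fun hc => hne (hc.right_unique hmu)]
    · push Not at hj
      rw [opJump_apply_of_not_jump q hj, smul_zero]
      exact (Finset.sum_eq_zero fun mu _ => if_neg (hj mu)).symm
  rw [Finset.sum_congr rfl h1, Finset.sum_comm, ← Finset.sum_add_distrib]
  refine Finset.sum_congr rfl fun mu hmu => ?_
  by_cases hj : ∃ gam, IsJump n p gam mu
  · obtain ⟨gam, hgam⟩ := hj
    rw [Finset.sum_eq_single_of_mem gam, if_pos hgam, ← Finsupp.single_add,
      stripSumLT_succ_of_jump n hn hq p k hgam]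
    · rw [mem_diagramsOfSize] at hmu ⊢
      have := hgam.card_eq
      rw [hmu, mul_add] at this
      omega
    · intro gam' _ hne
      rw [if_neg fun hc => hne (hc.left_unique hgam)]
  · push Not at hj
    rw [Finset.sum_eq_zero fun gam _ => if_neg (hj gam), add_zero,
      stripSumLT_succ_of_not_jump n hn q p k hj]

theorem stripVector_zero (n : ℕ) (q : K) (M : ℤ) (lam : YoungDiagram) :
    stripVector n q M 0 lam = Finsupp.single lam 1 := by
  classical
  unfold stripVector
  rw [Finset.sum_eq_single_of_mem lam]
  · rw [stripSumLT_zero, if_pos rfl]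
  · rw [mem_diagramsOfSize]; simp
  · intro mu _ hne
    rw [stripSumLT_zero, if_neg hne, Finsupp.single_zero]

/-- One more factor of the product is one more admissible position of the rightmost ribbon. The
bound on `L` makes the base case true: with contents below `L + n - 1` there is no nonempty strip
over `lam`. -/
theorem jumpPoly_coeff_apply {n : ℕ} (hn : 1 ≤ n) {q : K} (hq : q ≠ 0) {L : ℤ}
    {lam : YoungDiagram} (hL : L + n - 1 ≤ -(lam.card : ℤ)) (m k : ℕ) :
    (jumpPoly n q L m).coeff k (Finsupp.single (bead lam) 1) =
      toBeads K (stripVector n q (L + m + n - 1) k lam) := by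
  induction m generalizing k with
  | zero =>
    rw [jumpPoly, Polynomial.coeff_one]
    rcases k with _ | k
    · rw [if_pos rfl, stripVector_zero, toBeads_single]; rfl
    · rw [if_neg (by omega), stripVector, Finset.sum_eq_zero]
      · simp
      · intro mu _
        rw [stripSumLT_of_le_neg_card n hn q k (by push_cast; omega), Finsupp.single_zero]
  | succ m ih =>
    have e : L + ((m + 1 : ℕ) : ℤ) + n - 1 = L + m + n := by push_cast; ring
    rw [jumpPoly, add_mul, one_mul, mul_assoc, Polynomial.coeff_add, Polynomial.coeff_C_mul,
      LinearMap.add_apply, ih, Module.End.mul_apply, e]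
    rcases k with _ | k
    · simp [stripVector_zero]
    · rw [Polynomial.coeff_X_mul, ih, toBeads_stripVector_succ hn hq]

theorem V_single {n : ℕ} {q : K} (hq : q ≠ 0) (k : ℕ) (lam : YoungDiagram) :
    V n q k (Finsupp.single lam 1) = ∑ mu ∈ diagramsOfSize (lam.card + n * k),
      Finsupp.single mu (stripSum n q k lam mu) := by
  rw [V, Finsupp.linearCombination_single, one_smul]
  exact Finset.sum_congr rfl fun mu _ => by rw [spinSum_singleton n hq]

theorem U_single {n : ℕ} {q : K} (hq : q ≠ 0) (k : ℕ) (lam : YoungDiagram) :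
    U n q k (Finsupp.single lam 1) = ∑ nu ∈ subdiagrams lam,
      Finsupp.single nu (stripSum n q k nu lam) := by
  rw [U, Finsupp.linearCombination_single, one_smul]
  exact Finset.sum_congr rfl fun mu _ => by rw [spinSum_singleton n hq]

theorem V_single_eq_jumpPoly {n : ℕ} (hn : 1 ≤ n) {q : K} (hq : q ≠ 0) (k : ℕ) {L : ℤ} {m : ℕ}
    {lam : YoungDiagram} (hL : L + n - 1 ≤ -(lam.card : ℤ))
    (hm : ((lam.card + n * k : ℕ) : ℤ) ≤ L + m + n - 1) :
    (jumpPoly n q L m).coeff k (Finsupp.single (bead lam) 1) =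
      toBeads K (V n q k (Finsupp.single lam 1)) := by
  rw [jumpPoly_coeff_apply hn hq hL, V_single hq, stripVector]
  congr 1
  exact Finset.sum_congr rfl fun mu _ => by rw [stripSumLT_of_lt n q k hm]

/-- The positions run from `a - n N` to `a + n N - 1`. They exhaust `ℤ`, start at the residue of `a`
and form complete blocks of length `n`. -/
theorem isLimit_jumpPoly {n : ℕ} (hn : 1 ≤ n) {q : K} (hq : q ≠ 0) (k : ℕ) (a : ℤ) :
    IsLimit (fun N => (jumpPoly n q (a - n * N) (n * (2 * N))).coeff k) (V n q k) := by
  refine IsLimit.of_single fun lam => ?_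
  filter_upwards [eventually_ge_atTop (lam.card + n * k + a.natAbs + n)] with N hN
  have h1 : (N : ℤ) ≤ n * N := by nlinarith
  refine V_single_eq_jumpPoly hn hq k ?_ ?_
  · generalize (n : ℤ) * N = x at *
    have : (0 : ℤ) ≤ ((n * k : ℕ) : ℤ) := by positivity
    omega
  · have e : a - (n : ℤ) * N + ((n * (2 * N) : ℕ) : ℤ) + n - 1 = a + n * N + n - 1 := by
      push_cast; ring
    rw [e]
    generalize (n : ℤ) * N = x at *
    omega

/-- An operator that is a limit of operators that commute with the jumps, up to pairs of adjacent
jumps, commutes with `V_k`. -/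
theorem V_commute_of_isLimit {n : ℕ} (hn : 2 ≤ n) {q : K} (hq : q ≠ 0) (k : ℕ) (i : ZMod n)
    {x : ℕ → Module.End K (BeadSpace K)} {y : Module.End K (Fock K)} (h : IsLimit x y)
    (h0 : ∀ (N : ℕ) (p : ℤ), -(N : ℤ) ≤ p ∧ p + n ≤ N → (p : ZMod n) ≠ i → (p : ZMod n) ≠ i + 1 →
      Commute (x N) (opJump n q p))
    (h1 : ∀ (N : ℕ) (p : ℤ), -(N : ℤ) ≤ p ∧ p + n ≤ N → (p : ZMod n) = i →
      Commute (x N) (opJump n q p + opJump n q (p + 1)) ∧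
      Commute (x N) (opJump n q (p + 1) * opJump n q p)) :
    Commute (V n q k) y := by
  obtain ⟨a, ha⟩ := ZMod.intCast_surjective i
  have hlim := isLimit_jumpPoly (K := K) (by omega : 1 ≤ n) hq k a
  -- The truncation of the other operator must be wide enough for all sources and targets of the
  -- jumps in the product, so it is taken along a faster sequence of radii.
  have hg : Tendsto (fun N : ℕ => n * N + a.natAbs + n + n) atTop atTop := by
    refine tendsto_atTop_mono (fun N => ?_) tendsto_id
    have := Nat.le_mul_of_pos_left N (show 0 < n by omega)
    simp only [id]
    omega
  have hres : ∀ N : ℕ, ((a - n * N : ℤ) : ZMod n) = i := by intro N; simp [ha]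
  have hwin : ∀ (N : ℕ) (p : ℤ), a - n * N ≤ p → p < a - n * N + n * (2 * N : ℕ) →
      -((n * N + a.natAbs + n + n : ℕ) : ℤ) ≤ p ∧ p + n ≤ (n * N + a.natAbs + n + n : ℕ) := by
    intro N p h1 h2
    have e : a - n * N + n * (2 * N : ℕ) = a + n * N := by push_cast; ring
    rw [e] at h2
    simp only [Nat.cast_add, Nat.cast_mul]
    generalize (n : ℤ) * N = x at *
    omega
  have hf := h.comp hg
  refine IsLimit.congr (hlim.mul hf) (hf.mul hlim) (Eventually.of_forall fun N => ?_)
  have hc : Commute (Polynomial.C (x (n * N + a.natAbs + n + n)))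
      (jumpPoly n q (a - n * N) (n * (2 * N))) := by
    refine C_commute_jumpPoly hn (2 * N) ?_ ?_ ?_
    · intro p hp1 hp2 hp3 hp4
      rw [hres] at hp3 hp4
      exact h0 _ p (hwin N p hp1 hp2) hp3 hp4
    · intro p hp1 hp2 hp3
      rw [hres] at hp3
      exact (h1 _ p (hwin N p hp1 hp2) hp3).1
    · intro p hp1 hp2 hp3
      rw [hres] at hp3
      exact (h1 _ p (hwin N p hp1 hp2) hp3).2
  exact (commute_coeff_of_commute_C hc k).eq.symm

/-- The operators `V_k` commute with the Chevalley generators. -/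
theorem V_commute_fockF_fockE {n : ℕ} (hn : 2 ≤ n) {q : K} (hq : q ≠ 0) (k : ℕ) (i : ZMod n) :
    Commute (V n q k) (fockF n q i) ∧ Commute (V n q k) (fockE n q i) :=
  ⟨V_commute_of_isLimit hn hq k i (isLimit_truncF hn q i)
      (fun _ _ hT h h' => (trunc_commute_opJump hq h h' hT).1)
      fun _ _ hT h => (trunc_commute_pair hn hq h hT).1,
    V_commute_of_isLimit hn hq k i (isLimit_truncE hn q i)
      (fun _ _ hT h h' => (trunc_commute_opJump hq h h' hT).2)
      fun _ _ hT h => (trunc_commute_pair hn hq h hT).2⟩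

end

end RibbonFock

namespace RibbonFock
open Filter
section
variable {K : Type} [Field K]

/-! ## Relations between the truncated Chevalley operators -/

/-- The change of `stepSum T` when a cell of content `a` is added, with the opposite sign. -/
def cartanSum (T : Finset ℤ) (a : ℤ) : ℤ :=
  2 * (if a ∈ T then 1 else 0) - (if a - 1 ∈ T then 1 else 0) - if a + 1 ∈ T then 1 else 0

theorem opK_mul_lower {q : K} (hq : q ≠ 0) (T : Finset ℤ) (ε a : ℤ) :
    opK q T ε * opMove K a (a + 1) = q ^ (-ε * cartanSum T a) • (opMove K a (a + 1) * opK q T ε) := by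
  rw [opK_mul_opMove hq T ε a (a + 1) (c := -cartanSum T a) (by
    rw [cartanSum, add_sub_cancel_right]; ring)]
  congr 2
  ring

theorem opK_mul_raise {q : K} (hq : q ≠ 0) (T : Finset ℤ) (ε a : ℤ) :
    opK q T ε * opMove K (a + 1) a = q ^ (ε * cartanSum T a) • (opMove K (a + 1) a * opK q T ε) := by
  rw [opK_mul_opMove hq T ε (a + 1) a (c := cartanSum T a) (by
    rw [cartanSum, add_sub_cancel_right]; ring)]

/-- With the moves on the left and the diagonal factors on the right, products in the two orders
differ only in the moves and in a power of `q`. The next three lemmas bring the other products to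
this form. -/
theorem opLower_mul_opLower {q : K} (hq : q ≠ 0) (T T' : Finset ℤ) (a b : ℤ) :
    opLower q T a * opLower q T' b = q ^ (-cartanSum (T.filter fun m => a < m) b) •
      (opMove K a (a + 1) * opMove K b (b + 1) *
        (opK q (T.filter fun m => a < m) 1 * opK q (T'.filter fun m => b < m) 1)) := by
  rw [opLower, opLower, mul_assoc, ← mul_assoc (opK q _ 1), opK_mul_lower hq, smul_mul_assoc,
    mul_smul_comm, neg_one_mul]
  simp only [mul_assoc]

theorem opRaise_mul_opRaise {q : K} (hq : q ≠ 0) (T T' : Finset ℤ) (a b : ℤ) :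
    opRaise q T a * opRaise q T' b = q ^ (-cartanSum (T.filter fun m => m < a) b) •
      (opMove K (a + 1) a * opMove K (b + 1) b *
        (opK q (T.filter fun m => m < a) (-1) * opK q (T'.filter fun m => m < b) (-1))) := by
  rw [opRaise, opRaise, mul_assoc, ← mul_assoc (opK q _ (-1)), opK_mul_raise hq, smul_mul_assoc,
    mul_smul_comm, neg_one_mul]
  simp only [mul_assoc]

theorem opRaise_mul_opLower {q : K} (hq : q ≠ 0) (T T' : Finset ℤ) (a b : ℤ) :
    opRaise q T a * opLower q T' b = q ^ (cartanSum (T.filter fun m => m < a) b) •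
      (opMove K (a + 1) a * opMove K b (b + 1) *
        (opK q (T.filter fun m => m < a) (-1) * opK q (T'.filter fun m => b < m) 1)) := by
  rw [opRaise, opLower, mul_assoc, ← mul_assoc (opK q _ (-1)), opK_mul_lower hq, smul_mul_assoc,
    mul_smul_comm, neg_neg, one_mul]
  simp only [mul_assoc]

theorem opLower_mul_opRaise {q : K} (hq : q ≠ 0) (T T' : Finset ℤ) (a b : ℤ) :
    opLower q T' b * opRaise q T a = q ^ (cartanSum (T'.filter fun m => b < m) a) •
      (opMove K b (b + 1) * opMove K (a + 1) a *
        (opK q (T.filter fun m => m < a) (-1) * opK q (T'.filter fun m => b < m) 1)) := by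
  rw [opRaise, opLower, mul_assoc, ← mul_assoc (opK q _ 1), opK_mul_raise hq, smul_mul_assoc,
    mul_smul_comm, one_mul, (opK_commute q (T.filter fun m => m < a) _ _ _).eq]
  simp only [mul_assoc]

/-- At adjacent positions the two moves have a common target or a common source, so both products
vanish; otherwise they touch different positions. -/
theorem lower_raise_commute {a b : ℤ} (h : a ≠ b) :
    Commute (opMove K (a + 1) a) (opMove K b (b + 1)) := by
  by_cases h1 : a = b + 1
  · subst h1
    rw [Commute, SemiconjBy, opMove_mul_same_target]
    rw [opMove_mul_same_target]
  · by_cases h2 : a + 1 = b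
    · subst h2
      rw [Commute, SemiconjBy, opMove_mul_same_source _ _ _ (by omega),
        opMove_mul_same_source _ _ _ (by omega)]
    · exact opMove_commute (by omega) (by omega) (by omega) (by omega)

/-- The diagonal factors of `truncF` and `truncE` use a window larger by one so that the neighbours
of a position are never cut off and only residues matter. -/
theorem mem_window_succ {n : ℕ} {i j : ZMod n} {N : ℕ} {a m : ℤ} (ha : a ∈ window n i N)
    (hm : m = a ∨ m = a - 1 ∨ m = a + 1) :
    m ∈ window n j (N + 1) ↔ (m : ZMod n) = j := by
  have := (mem_window.1 ha).1
  rw [mem_window]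
  refine and_iff_right ?_
  push_cast
  omega

theorem opRaise_commute_opLower {n : ℕ} {q : K} (hq : q ≠ 0) {i j : ZMod n} {N : ℕ}
    {a b : ℤ} (ha : a ∈ window n i N) (hb : b ∈ window n j N) (hab : a ≠ b) :
    Commute (opRaise q (window n i (N + 1)) a) (opLower q (window n j (N + 1)) b) := by
  rw [Commute, SemiconjBy, opRaise_mul_opLower hq, opLower_mul_opRaise hq,
    (lower_raise_commute hab).eq]
  congr 2
  have hai := (mem_window.1 ha).2
  have hbj := (mem_window.1 hb).2
  unfold cartanSum
  simp only [Finset.mem_filter, mem_window_succ ha (Or.inl rfl), mem_window_succ hb (Or.inl rfl),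
    mem_window_succ ha (Or.inr (Or.inl rfl)), mem_window_succ hb (Or.inr (Or.inl rfl)),
    mem_window_succ ha (Or.inr (Or.inr rfl)), mem_window_succ hb (Or.inr (Or.inr rfl))]
  push_cast
  rw [hai, hbj]
  -- The two exponents agree because the pairing of residues is symmetric and `b` is to the left of
  -- `a` exactly when `a` is to the right of `b`.
  have e1 : (j = i ∧ b < a) ↔ (i = j ∧ b < a) := by rw [eq_comm]
  have e2 : (j - 1 = i ∧ b - 1 < a) ↔ (i + 1 = j ∧ b < a + 1) := by
    rw [sub_eq_iff_eq_add, eq_comm]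
    refine and_congr_right fun _ => ?_
    omega
  have e3 : (j + 1 = i ∧ b + 1 < a) ↔ (i - 1 = j ∧ b < a - 1) := by
    rw [sub_eq_iff_eq_add, eq_comm]
    refine and_congr_right fun _ => ?_
    omega
  simp only [e1, e2, e3]
  ring

theorem truncE_commute_truncF {n : ℕ} {q : K} (hq : q ≠ 0) {i j : ZMod n}
    (hij : i ≠ j) (N : ℕ) : Commute (truncE n q i N) (truncF n q j N) := by
  refine Commute.sum_left _ _ _ fun a ha => Commute.sum_right _ _ _ fun b hb => ?_
  refine opRaise_commute_opLower hq ha hb ?_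
  rintro rfl
  exact hij ((mem_window.1 ha).2.symm.trans (mem_window.1 hb).2)

/-- The positions `a` and `a + 1` carry a two-dimensional representation when they hold one bead,
and a trivial one otherwise; there the eigenvalues of `K` are `q`, `q⁻¹` and `1`. -/
theorem raise_lower_commutator {q : K} (hq' : q - q⁻¹ ≠ 0) (a : ℤ) :
    opMove K (a + 1) a * opMove K a (a + 1) - opMove K a (a + 1) * opMove K (a + 1) a =
      (q - q⁻¹)⁻¹ • (opK q {a} 1 - opK q {a} (-1)) := by
  have hne : a + 1 ≠ a := by omega
  have hne' : a ≠ a + 1 := by omega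
  have e1 : ∀ s : ℤ → Bool, s a = true → s (a + 1) = false →
      moveBead (moveBead s a (a + 1)) (a + 1) a = s := by
    intro s h1 h2
    funext m
    simp only [moveBead_apply]
    split_ifs <;> simp_all
  have e2 : ∀ s : ℤ → Bool, s a = false → s (a + 1) = true →
      moveBead (moveBead s (a + 1) a) a (a + 1) = s := by
    intro s h1 h2
    funext m
    simp only [moveBead_apply]
    split_ifs <;> simp_all
  refine end_ext fun s => ?_
  simp only [LinearMap.sub_apply, LinearMap.smul_apply, Module.End.mul_apply, opMove_single,
    opK_singleton_single, mul_one, stepAt]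
  cases h1 : s a <;> cases h2 : s (a + 1)
  · simp
  · simp only [Bool.false_eq_true, false_and, if_false, map_zero, and_self, if_true, opMove_single,
      moveBead_apply, hne, hne', e2 s h1 h2, zero_sub, mul_neg, mul_one, neg_neg, zpow_neg_one,
      zpow_one, ← Finsupp.single_sub, Finsupp.smul_single, smul_eq_mul]
    rw [← neg_sub q, mul_neg, inv_mul_cancel₀ hq', Finsupp.single_neg]
  · simp only [Bool.false_eq_true, false_and, if_false, map_zero, and_self, if_true, opMove_single,
      moveBead_apply, hne, hne', e1 s h1 h2, sub_zero, mul_one, zpow_neg_one, zpow_one,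
      ← Finsupp.single_sub, Finsupp.smul_single, smul_eq_mul]
    rw [inv_mul_cancel₀ hq']
  · simp

theorem raise_lower_commutator_same {n : ℕ} (hn : 2 ≤ n) {q : K} (hq : q ≠ 0) (hq' : q - q⁻¹ ≠ 0)
    {i : ZMod n} {N : ℕ} {a : ℤ} (ha : a ∈ window n i N) :
    opRaise q (window n i (N + 1)) a * opLower q (window n i (N + 1)) a -
      opLower q (window n i (N + 1)) a * opRaise q (window n i (N + 1)) a =
    (q - q⁻¹)⁻¹ • ((opK q {a} 1 - opK q {a} (-1)) *
      (opK q ((window n i (N + 1)).filter fun m => m < a) (-1) *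
        opK q ((window n i (N + 1)).filter fun m => a < m) 1)) := by
  have hai := (mem_window.1 ha).2
  have h1 : ((a - 1 : ℤ) : ZMod n) ≠ i := fun hc =>
    ne_add_one_of_residue hn (hc.trans hai.symm) (by omega)
  have h2 : ((a + 1 : ℤ) : ZMod n) ≠ i := fun hc =>
    ne_add_one_of_residue hn (hai.trans hc.symm) rfl
  have z1 : cartanSum ((window n i (N + 1)).filter fun m => m < a) a = 0 := by
    unfold cartanSum
    simp only [Finset.mem_filter, mem_window, h1, h2, lt_irrefl, and_false, false_and, if_false]
    norm_num
  have z2 : cartanSum ((window n i (N + 1)).filter fun m => a < m) a = 0 := by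
    unfold cartanSum
    simp only [Finset.mem_filter, mem_window, h1, h2, lt_irrefl, and_false, false_and, if_false]
    norm_num
  rw [opRaise_mul_opLower hq, opLower_mul_opRaise hq, z1, z2, zpow_zero, one_smul, one_smul,
    ← smul_mul_assoc, ← raise_lower_commutator hq']
  exact (sub_mul (opMove K (a + 1) a * opMove K a (a + 1)) _ _).symm

/-- The summand at `a` is the difference of two powers of `q`, in whose exponents `h a` is counted
with the positions to the right or, negated, with those to the left. Consecutive summands share a
power. This is how the local commutators add up to `q^{h_i} - q^{-h_i}`. -/
theorem sum_telescope {q : K} (hq : q ≠ 0) (h : ℤ → ℤ) (T : Finset ℤ) :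
    ∑ a ∈ T, (q ^ h a - q ^ (-h a)) * (q ^ (-∑ m ∈ T with m < a, h m) *
      q ^ (∑ m ∈ T with a < m, h m)) = q ^ (∑ m ∈ T, h m) - q ^ (-∑ m ∈ T, h m) := by
  induction T using Finset.induction_on_max with
  | empty => simp
  | insert m T hm ih =>
    have hmT : m ∉ T := fun hc => lt_irrefl m (hm m hc)
    rw [Finset.sum_insert hmT, Finset.sum_insert hmT]
    have e1 : (insert m T).filter (fun b => b < m) = T := by
      rw [Finset.filter_insert, if_neg (lt_irrefl m)]
      exact Finset.filter_true_of_mem hm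
    have e2 : (insert m T).filter (fun b => m < b) = ∅ := by
      rw [Finset.filter_insert, if_neg (lt_irrefl m)]
      exact Finset.filter_false_of_mem fun b hb => (hm b hb).not_gt
    have e3 : ∀ a ∈ T, (q ^ h a - q ^ (-h a)) * (q ^ (-∑ b ∈ insert m T with b < a, h b) *
        q ^ (∑ b ∈ insert m T with a < b, h b)) = q ^ h m * ((q ^ h a - q ^ (-h a)) *
        (q ^ (-∑ b ∈ T with b < a, h b) * q ^ (∑ b ∈ T with a < b, h b))) := by
      intro a ha
      rw [Finset.filter_insert, Finset.filter_insert, if_neg (hm a ha).not_gt, if_pos (hm a ha),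
        Finset.sum_insert (by simp [hmT]), zpow_add₀ hq]
      ring
    rw [e1, e2, Finset.sum_congr rfl e3, ← Finset.mul_sum, ih, Finset.sum_empty, zpow_zero,
      neg_add, zpow_add₀ hq, zpow_add₀ hq]
    ring

theorem commutator_sum {R : Type} [Ring R] {s : Finset ℤ} (x y : ℤ → R)
    (h : ∀ a ∈ s, ∀ b ∈ s, a ≠ b → Commute (x a) (y b)) :
    (∑ a ∈ s, x a) * (∑ b ∈ s, y b) - (∑ b ∈ s, y b) * (∑ a ∈ s, x a) =
      ∑ a ∈ s, (x a * y a - y a * x a) := by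
  rw [Finset.sum_mul_sum, Finset.sum_mul_sum, Finset.sum_comm (f := fun b a => y b * x a),
    ← Finset.sum_sub_distrib]
  refine Finset.sum_congr rfl fun a ha => ?_
  rw [← Finset.sum_sub_distrib]
  refine Finset.sum_eq_single_of_mem a ha fun b hb hab => ?_
  rw [(h a ha b hb hab.symm).eq, sub_self]

theorem opK_single (q : K) (T : Finset ℤ) (ε : ℤ) (s : ℤ → Bool) (c : K) :
    opK q T ε (Finsupp.single s c) = Finsupp.single s (q ^ (ε * stepSum T s) * c) := by
  rw [opK, opDiag_single]

theorem fockH_single (n : ℕ) (q : K) (i : ZMod n) (lam : YoungDiagram) (c : K) :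
    fockH n q i (Finsupp.single lam c) = Finsupp.single lam (q ^ nodeCount n i lam * c) := by
  rw [fockH, Finsupp.linearCombination_single, Finsupp.smul_single, smul_eq_mul, mul_comm]

theorem fockE_fockF_commutator {n : ℕ} (hn : 2 ≤ n) {q : K} (hq : q ≠ 0) (hq' : q - q⁻¹ ≠ 0)
    (i : ZMod n) : fockE n q i * fockF n q i - fockF n q i * fockE n q i =
      (q - q⁻¹)⁻¹ • (fockH n q i - fockH n q⁻¹ i) := by
  have h1 := ((isLimit_truncE (K := K) hn q i).mul (isLimit_truncF hn q i)).sub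
    ((isLimit_truncF (K := K) hn q i).mul (isLimit_truncE hn q i))
  refine h1.congr (IsLimit.of_single fun lam => ?_ : IsLimit (fun N => truncE n q i N *
    truncF n q i N - truncF n q i N * truncE n q i N) _) (Eventually.of_forall fun _ => rfl)
  filter_upwards [eventually_ge_atTop (lam.card + 1)] with N hN
  have h2 : truncE n q i N * truncF n q i N - truncF n q i N * truncE n q i N =
      ∑ a ∈ window n i N, (q - q⁻¹)⁻¹ • ((opK q {a} 1 - opK q {a} (-1)) *
      (opK q ((window n i (N + 1)).filter fun m => m < a) (-1) *
        opK q ((window n i (N + 1)).filter fun m => a < m) 1)) := by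
    refine (commutator_sum (R := Module.End K (BeadSpace K))
      (opRaise q (window n i (N + 1))) (opLower q (window n i (N + 1))) fun a ha b hb hab => opRaise_commute_opLower hq ha hb hab).trans ?_
    exact Finset.sum_congr rfl fun a ha => raise_lower_commutator_same hn hq hq' ha
  have h3 : ∀ a, ((opK q {a} 1 - opK q {a} (-1)) *
      (opK q ((window n i (N + 1)).filter fun m => m < a) (-1) *
        opK q ((window n i (N + 1)).filter fun m => a < m) 1)) (Finsupp.single (bead lam) 1) =
      Finsupp.single (bead lam) ((q ^ stepAt (bead lam) a - q ^ (-stepAt (bead lam) a)) *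
        (q ^ (-∑ m ∈ window n i (N + 1) with m < a, stepAt (bead lam) m) *
      q ^ (∑ m ∈ window n i (N + 1) with a < m, stepAt (bead lam) m))) := by
    intro a
    simp only [Module.End.mul_apply, LinearMap.sub_apply, opK_single, mul_one, one_mul,
      ← Finsupp.single_sub, neg_one_mul, ← sub_mul, stepSum, Finset.sum_singleton]
  rw [h2, LinearMap.sum_apply]
  simp only [LinearMap.smul_apply, h3]
  rw [← Finset.smul_sum, ← Finsupp.single_finsetSum]
  -- The moves range over the smaller window and the diagonal factors over the larger one. The
  -- additional positions lie beyond the partition and contribute nothing.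
  rw [Finset.sum_subset (s₂ := window n i (N + 1)), sum_telescope hq]
  · rw [LinearMap.sub_apply, fockH_single, fockH_single, mul_one, mul_one, ← Finsupp.single_sub,
      map_smul, toBeads_single, nodeCount_eq i (show lam.card ≤ N + 1 by omega), inv_zpow, zpow_neg]
  · intro a ha
    rw [mem_window] at ha ⊢
    refine ⟨?_, ha.2⟩
    push_cast
    omega
  · intro a ha ha'
    have h4 : stepAt (bead lam) a = 0 := by
      unfold stepAt
      rw [mem_window] at ha ha'
      have ha' : ¬(-(N : ℤ) ≤ a ∧ a ≤ N) := fun h => ha' ⟨h, ha.2⟩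
      have := ha.1
      push_cast at this
      rcases le_or_gt a 0 with h0 | h0
      · rw [bead_eq_true_of_le_neg_card (by omega), bead_eq_true_of_le_neg_card (by omega)]
        simp
      · rw [bead_eq_false_of_card_lt (by omega), bead_eq_false_of_card_lt (by omega)]
        simp
    rw [h4]
    simp

end

end RibbonFock

/-! ### The q-Serre relation for families of skew commuting elements -/

namespace RibbonFock
section
variable {K : Type} [Field K]

theorem smul_tail {R : Type} [Ring R] [Algebra K R] {x y z w : R} {c : K} (h : x * y = c • (z * w))
    (v : R) : x * (y * v) = c • (z * (w * v)) := by
  rw [← mul_assoc, h, smul_mul_assoc, mul_assoc]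

theorem zero_tail {R : Type} [Ring R] {x y : R} (h : x * y = 0)
    (v : R) : x * (y * v) = 0 := by
  rw [← mul_assoc, h, zero_mul]

/-- This is the case in which both neighbours of the position of `B` carry summands: they are `X`
and `Y`, while `P` and `Q` collect the summands before and after them. All monomials are brought to
a normal order, the ones with a repeated `X` or `Y` vanish, and the coefficients of the others
cancel. -/
theorem cubic_serre {R : Type} [Ring R] [Algebra K R] {q : K} (hq : q ≠ 0) {P X Y Q B : R}
    (h1 : P * X = (q ^ 2)⁻¹ • (X * P)) (h2 : P * Y = (q ^ 2)⁻¹ • (Y * P))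
    (h3 : X * Y = (q ^ 2)⁻¹ • (Y * X))
    (h4 : Q * P = q ^ 2 • (P * Q)) (h5 : Q * X = q ^ 2 • (X * Q)) (h6 : Q * Y = q ^ 2 • (Y * Q))
    (h7 : P * B = q ^ 2 • (B * P)) (h8 : Q * B = (q ^ 2)⁻¹ • (B * Q))
    (hX : X * X = 0) (hY : Y * Y = 0) (hXB : X * (B * X) = 0) (hYB : Y * (B * Y) = 0) :
    (P + X + Y + Q) ^ 3 * B - (q ^ 2 + 1 + (q ^ 2)⁻¹) • ((P + X + Y + Q) ^ 2 * B * (P + X + Y + Q))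
      + (q ^ 2 + 1 + (q ^ 2)⁻¹) • ((P + X + Y + Q) * B * (P + X + Y + Q) ^ 2)
      - B * (P + X + Y + Q) ^ 3 = 0 := by
  have t1 := smul_tail h1
  have t2 := smul_tail h2
  have t3 := smul_tail h3
  have t4 := smul_tail h4
  have t5 := smul_tail h5
  have t6 := smul_tail h6
  have t7 := smul_tail h7
  have t8 := smul_tail h8
  have tX := zero_tail hX
  have tY := zero_tail hY
  have uX : ∀ v, X * (B * (X * v)) = 0 := fun v => by
    rw [← mul_assoc B, ← mul_assoc, hXB, zero_mul]
  have uY : ∀ v, Y * (B * (Y * v)) = 0 := fun v => by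
    rw [← mul_assoc B, ← mul_assoc, hYB, zero_mul]
  have k1 : X * (B * (Y * X)) = 0 := by
    have : Y * X = q ^ 2 • (X * Y) := by rw [h3, smul_inv_smul₀ (pow_ne_zero 2 hq)]
    rw [this, mul_smul_comm, mul_smul_comm, uX, smul_zero]
  have k2 : Y * (X * (B * Y)) = 0 := by
    have : Y * (X * (B * Y)) = q ^ 2 • (X * (Y * (B * Y))) := by
      rw [t3, smul_inv_smul₀ (pow_ne_zero 2 hq)]
    rw [this, hYB, mul_zero, smul_zero]
  simp only [pow_succ, pow_zero, one_mul] at *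
  simp only [mul_add, add_mul, mul_assoc, smul_mul_assoc, mul_smul_comm, smul_smul, smul_add,
    h1, h2, h3, h4, h5, h6, h7, h8, t1, t2, t3, t4, t5, t6, t7, t8, hX, hY, hXB, tX, tY,
    uX, uY, k1, k2, mul_zero, smul_zero, add_zero]
  match_scalars <;> field_simp <;> ring

theorem quadratic_serre {R : Type} [Ring R] [Algebra K R] {q : K} (hq : q ≠ 0) {P X Q B : R}
    (h1 : P * X = (q ^ 2)⁻¹ • (X * P))
    (h4 : Q * P = q ^ 2 • (P * Q)) (h5 : Q * X = q ^ 2 • (X * Q))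
    (h7 : P * B = q • (B * P)) (h8 : Q * B = q⁻¹ • (B * Q))
    (hX : X * X = 0) (hXB : X * (B * X) = 0) :
    (P + X + Q) ^ 2 * B - (q + q⁻¹) • ((P + X + Q) * B * (P + X + Q))
      + B * (P + X + Q) ^ 2 = 0 := by
  have t7 := smul_tail h7
  have t8 := smul_tail h8
  simp only [pow_succ, pow_zero, one_mul] at *
  simp only [mul_add, add_mul, mul_assoc, smul_mul_assoc, mul_smul_comm, smul_smul, smul_add,
    h1, h4, h5, h7, h8, t7, t8, hX, hXB, add_zero]
  match_scalars <;> field_simp <;> ring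

theorem sum_skew_commute {R : Type} [Ring R] [Algebra K R] {s t : Finset ℤ} {x y : ℤ → R} {c : K}
    (h : ∀ a ∈ s, ∀ b ∈ t, x a * y b = c • (y b * x a)) :
    (∑ a ∈ s, x a) * (∑ b ∈ t, y b) = c • ((∑ b ∈ t, y b) * ∑ a ∈ s, x a) := by
  rw [Finset.sum_mul_sum, Finset.sum_mul_sum, Finset.sum_comm (s := t), Finset.smul_sum]
  refine Finset.sum_congr rfl fun a ha => ?_
  rw [Finset.smul_sum]
  exact Finset.sum_congr rfl fun b hb => h a ha b hb

theorem qInt_one {q : K} (h : q - q⁻¹ ≠ 0) : qInt q 1 = 1 := by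
  rw [qInt, pow_one, pow_one, div_self h]

theorem qInt_two {q : K} (h : q - q⁻¹ ≠ 0) : qInt q 2 = q + q⁻¹ := by
  rw [qInt, div_eq_iff h]
  ring

theorem qInt_three {q : K} (hq : q ≠ 0) (h : q - q⁻¹ ≠ 0) :
    qInt q 3 = q ^ 2 + 1 + (q ^ 2)⁻¹ := by
  rw [qInt, div_eq_iff h]
  field_simp
  ring

theorem sub_inv_ne_zero {q : K} (hq : q ≠ 0) (h : ∀ k : ℕ, 0 < k → q ^ k ≠ 1) :
    q - q⁻¹ ≠ 0 := fun hc => h 2 two_pos (by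
  field_simp at hc
  linear_combination hc)

theorem add_inv_ne_zero {q : K} (hq : q ≠ 0) (h : ∀ k : ℕ, 0 < k → q ^ k ≠ 1) :
    q + q⁻¹ ≠ 0 := fun hc => h 4 (by norm_num) (by
  field_simp at hc
  linear_combination (q ^ 2 - 1) * hc)

theorem qInt_three_ne_zero {q : K} (hq : q ≠ 0) (h : ∀ k : ℕ, 0 < k → q ^ k ≠ 1) :
    q ^ 2 + 1 + (q ^ 2)⁻¹ ≠ 0 := fun hc => h 6 (by norm_num) (by
  field_simp at hc
  linear_combination (q ^ 2 - 1) * hc)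

theorem serre_one {R : Type} [Ring R] [Algebra K R] {q : K} (h : q - q⁻¹ ≠ 0) (x y : R) :
    serre q 1 x y = x * y - y * x := by
  simp [serre, qBinomial, qFactorial, Finset.sum_range_succ, qInt_one h, sub_eq_add_neg]

theorem serre_two {R : Type} [Ring R] [Algebra K R] {q : K} (hq : q ≠ 0)
    (h : ∀ k : ℕ, 0 < k → q ^ k ≠ 1) (x y : R) :
    serre q 2 x y = x ^ 2 * y - (q + q⁻¹) • (x * y * x) + y * x ^ 2 := by
  have h1 := sub_inv_ne_zero hq h
  have h2 := add_inv_ne_zero hq h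
  simp [serre, qBinomial, qFactorial, Finset.sum_range_succ, Finset.prod_range_succ, qInt_one h1,
    qInt_two h1, sub_eq_add_neg, h2]
  rw [← neg_smul]
  congr 1
  ring

theorem serre_three {R : Type} [Ring R] [Algebra K R] {q : K} (hq : q ≠ 0)
    (h : ∀ k : ℕ, 0 < k → q ^ k ≠ 1) (x y : R) :
    serre q 3 x y = x ^ 3 * y - (q ^ 2 + 1 + (q ^ 2)⁻¹) • (x ^ 2 * y * x)
      + (q ^ 2 + 1 + (q ^ 2)⁻¹) • (x * y * x ^ 2) - y * x ^ 3 := by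
  have h1 := sub_inv_ne_zero hq h
  have h2 := add_inv_ne_zero hq h
  have h3 := qInt_three_ne_zero hq h
  have e1 : qBinomial q 3 0 = 1 := by
    simp [qBinomial, qFactorial, Finset.prod_range_succ, qInt_one h1, qInt_two h1,
      qInt_three hq h1, h2, h3]
  have e2 : qBinomial q 3 1 = q ^ 2 + 1 + (q ^ 2)⁻¹ := by
    simp [qBinomial, qFactorial, Finset.prod_range_succ, qInt_one h1, qInt_two h1,
      qInt_three hq h1, h2]
  have e3 : qBinomial q 3 2 = q ^ 2 + 1 + (q ^ 2)⁻¹ := by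
    simp [qBinomial, qFactorial, Finset.prod_range_succ, qInt_one h1, qInt_two h1,
      qInt_three hq h1, h2]
  have e4 : qBinomial q 3 3 = 1 := by
    simp [qBinomial, qFactorial, Finset.prod_range_succ, qInt_one h1, qInt_two h1,
      qInt_three hq h1, h2, h3]
  simp only [serre, Finset.sum_range_succ, Finset.sum_range_zero, e1, e2, e3, e4]
  simp [sub_eq_add_neg, pow_succ, mul_assoc]
  rw [← neg_smul]
  congr 1
  ring

/-- The `q`-Serre relation for a sum of skew commuting elements, linearly ordered along `ℤ` in the
direction `σ`, and an element at position `c`. -/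
theorem serre_of_family {R : Type} [Ring R] [Algebra K R] {q : K} (hq : q ≠ 0)
    (hroot : ∀ k : ℕ, 0 < k → q ^ k ≠ 1) {σ : ℤ} (hσ : σ = 1 ∨ σ = -1) {S : Finset ℤ} {A : ℤ → R}
    {B : R} {c : ℤ} {w : ℕ}
    (hAA : ∀ a ∈ S, ∀ b ∈ S, σ * a < σ * b → A a * A b = (q ^ 2)⁻¹ • (A b * A a))
    (hA : ∀ a ∈ S, A a * A a = 0)
    (hL : ∀ a ∈ S, σ * a < σ * c - 1 → A a * B = q ^ w • (B * A a))
    (hR : ∀ a ∈ S, σ * c + 1 < σ * a → A a * B = (q ^ w)⁻¹ • (B * A a))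
    (hN : ∀ a ∈ S, a = c - 1 ∨ a = c + 1 → A a * (B * A a) = 0) (hc : c ∉ S)
    (hw : w = 2 ∨ (w = 1 ∧ (c - 1 ∉ S ∨ c + 1 ∉ S)) ∨ (w = 0 ∧ c - 1 ∉ S ∧ c + 1 ∉ S)) :
    serre q (w + 1) (∑ a ∈ S, A a) B = 0 := by
  have hq2 : q ^ 2 ≠ 0 := pow_ne_zero 2 hq
  -- Only the two neighbours of `c` fail to skew commute with `B`; the summands before and after
  -- them are grouped. The direction `σ` serves both the lowering and the raising operators, whose
  -- `q`-powers look to opposite sides.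
  have hsplit : ∑ a ∈ S, A a = ∑ a ∈ S with σ * a < σ * c - 1, A a + ∑ a ∈ S with a = c - σ, A a +
      ∑ a ∈ S with a = c + σ, A a + ∑ a ∈ S with σ * c + 1 < σ * a, A a := by
    simp only [Finset.sum_filter, ← Finset.sum_add_distrib]
    refine Finset.sum_congr rfl fun a ha => ?_
    have hac : a ≠ c := by rintro rfl; exact hc ha
    rcases hσ with rfl | rfl
    · rcases lt_trichotomy a (c - 1) with h | h | h
      · rw [if_pos (by omega), if_neg (by omega), if_neg (by omega), if_neg (by omega)]; simp
      · rw [if_neg (by omega), if_pos (by omega), if_neg (by omega), if_neg (by omega)]; simp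
      · by_cases h' : a = c + 1
        · rw [if_neg (by omega), if_neg (by omega), if_pos (by omega), if_neg (by omega)]; simp
        · rw [if_neg (by omega), if_neg (by omega), if_neg (by omega), if_pos (by omega)]; simp
    · rcases lt_trichotomy a (c - 1) with h | h | h
      · rw [if_neg (by omega), if_neg (by omega), if_neg (by omega), if_pos (by omega)]; simp
      · rw [if_neg (by omega), if_neg (by omega), if_pos (by omega), if_neg (by omega)]; simp
      · by_cases h' : a = c + 1
        · rw [if_neg (by omega), if_pos (by omega), if_neg (by omega), if_neg (by omega)]; simp
        · rw [if_pos (by omega), if_neg (by omega), if_neg (by omega), if_neg (by omega)]; simp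
  have hlt : ∀ (p r : ℤ → Prop) [DecidablePred p] [DecidablePred r],
      (∀ a b, p a → r b → σ * a < σ * b) → (∑ a ∈ S with p a, A a) * (∑ a ∈ S with r a, A a) =
        (q ^ 2)⁻¹ • ((∑ a ∈ S with r a, A a) * ∑ a ∈ S with p a, A a) := by
    intro p r _ _ h
    refine sum_skew_commute fun a ha b hb => ?_
    rw [Finset.mem_filter] at ha hb
    exact hAA a ha.1 b hb.1 (h a b ha.2 hb.2)
  have hgt : ∀ {x y : R}, x * y = (q ^ 2)⁻¹ • (y * x) → y * x = q ^ 2 • (x * y) := by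
    intro x y h
    rw [h, smul_inv_smul₀ hq2]
  have hP : (∑ a ∈ S with σ * a < σ * c - 1, A a) * B =
      q ^ w • (B * ∑ a ∈ S with σ * a < σ * c - 1, A a) := by
    rw [Finset.sum_mul, Finset.mul_sum, Finset.smul_sum]
    refine Finset.sum_congr rfl fun a ha => ?_
    rw [Finset.mem_filter] at ha
    exact hL a ha.1 ha.2
  have hQ : (∑ a ∈ S with σ * c + 1 < σ * a, A a) * B =
      (q ^ w)⁻¹ • (B * ∑ a ∈ S with σ * c + 1 < σ * a, A a) := by
    rw [Finset.sum_mul, Finset.mul_sum, Finset.smul_sum]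
    refine Finset.sum_congr rfl fun a ha => ?_
    rw [Finset.mem_filter] at ha
    exact hR a ha.1 ha.2
  have hone : ∀ d, (∑ a ∈ S with a = d, A a) = if d ∈ S then A d else 0 := by
    intro d
    rw [Finset.sum_filter, Finset.sum_ite_eq']
  have hsq : ∀ d, (∑ a ∈ S with a = d, A a) * (∑ a ∈ S with a = d, A a) = 0 := by
    intro d
    rw [hone]
    split_ifs with h
    · exact hA d h
    · simp
  have hadj : ∀ d, d = c - 1 ∨ d = c + 1 →
      (∑ a ∈ S with a = d, A a) * (B * (∑ a ∈ S with a = d, A a)) = 0 := by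
    intro d hd
    rw [hone]
    split_ifs with h
    · exact hN d h hd
    · simp
  have hσ2 : σ * σ = 1 := by rcases hσ with rfl | rfl <;> rfl
  have hd1 : c - σ = c - 1 ∨ c - σ = c + 1 := by rcases hσ with rfl | rfl <;> simp
  have hd2 : c + σ = c - 1 ∨ c + σ = c + 1 := by rcases hσ with rfl | rfl <;> simp; omega
  have l1 := hlt (fun a => σ * a < σ * c - 1) (fun a => a = c - σ) fun a b h h' => by
    rw [h', mul_sub, hσ2]; exact h
  have l2 := hlt (fun a => σ * a < σ * c - 1) (fun a => a = c + σ) fun a b h h' => by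
    rw [h', mul_add, hσ2]; omega
  have l3 := hlt (fun a => a = c - σ) (fun a => a = c + σ) fun a b h h' => by
    rw [h, h', mul_add, mul_sub, hσ2]; omega
  have l4 := hlt (fun a => σ * a < σ * c - 1) (fun a => σ * c + 1 < σ * a) fun a b h h' => by
    omega
  have l5 := hlt (fun a => a = c - σ) (fun a => σ * c + 1 < σ * a) fun a b h h' => by
    rw [h, mul_sub, hσ2]; omega
  have l6 := hlt (fun a => a = c + σ) (fun a => σ * c + 1 < σ * a) fun a b h h' => by
    rw [h, mul_add, hσ2]; exact h'
  have hzero : ∀ d, d ∉ S → ∑ a ∈ S with a = d, A a = 0 := fun d hd => by rw [hone, if_neg hd]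
  rw [hsplit]
  rcases hw with rfl | ⟨rfl, hw⟩ | ⟨rfl, hw1, hw2⟩
  · rw [serre_three hq hroot]
    exact cubic_serre hq l1 l2 l3 (hgt l4) (hgt l5) (hgt l6) hP hQ (hsq _) (hsq _) (hadj _ hd1)
      (hadj _ hd2)
  · rw [serre_two hq hroot]
    rw [pow_one] at hP hQ
    have hw' : c - σ ∉ S ∨ c + σ ∉ S := by
      rcases hσ with rfl | rfl
      · exact hw
      · rw [sub_neg_eq_add, ← sub_eq_add_neg]; exact hw.symm
    rcases hw' with h | h
    · rw [hzero _ h, add_zero]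
      exact quadratic_serre hq l2 (hgt l4) (hgt l6) hP hQ (hsq _) (hadj _ hd2)
    · rw [hzero _ h, add_zero]
      exact quadratic_serre hq l1 (hgt l4) (hgt l5) hP hQ (hsq _) (hadj _ hd1)
  · rw [serre_one (sub_inv_ne_zero hq hroot)]
    have h1 : c - σ ∉ S := by rcases hd1 with h | h <;> rwa [h]
    have h2 : c + σ ∉ S := by rcases hd2 with h | h <;> rwa [h]
    rw [pow_zero, one_smul] at hP
    rw [pow_zero, inv_one, one_smul] at hQ
    rw [hzero _ h1, hzero _ h2, add_zero, add_zero, add_mul, mul_add, hP, hQ, sub_self]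

end
end RibbonFock

/-! ### Serre relations and mixed commutators of the Chevalley operators -/

namespace RibbonFock
open Filter
section
variable {K : Type} [Field K]

/-- The order minus one is the number of neighbours of a position of residue `j` that have residue
`i`. It is `2` only for `n = 2`, where `j - 1 = j + 1`. -/
theorem serreOrder_eq {n : ℕ} {i j : ZMod n} (hij : i ≠ j) : serreOrder n i j =
    (if j - 1 = i then 1 else 0) + (if j + 1 = i then 1 else 0) + 1 := by
  have h1 : i - 1 = j ↔ j + 1 = i := by rw [sub_eq_iff_eq_add, eq_comm]
  have h2 : i + 1 = j ↔ j - 1 = i := by rw [sub_eq_iff_eq_add, eq_comm]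
  simp only [serreOrder, rootPairing, coroot, Pi.single_apply, hij, h1, h2, if_false]
  split_ifs <;> rfl

/-- The conditions on the position `a ≡ i` and its neighbours, relative to a position `c ≡ j`. -/
theorem cartanSum_filter_lt {n : ℕ} {i j : ZMod n} {N : ℕ} {a c : ℤ} (hij : i ≠ j)
    (hc : c ∈ window n j N) (h : a < c - 1) :
    cartanSum ((window n i (N + 1)).filter fun m => a < m) c =
      -((if j - 1 = i then 1 else 0) + (if j + 1 = i then 1 else 0)) := by
  have hcj := (mem_window.1 hc).2
  unfold cartanSum
  simp only [Finset.mem_filter, mem_window_succ hc (Or.inl rfl),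
    mem_window_succ hc (Or.inr (Or.inl rfl)), mem_window_succ hc (Or.inr (Or.inr rfl))]
  push_cast
  rw [hcj]
  have e1 : a < c := by omega
  have e2 : a < c + 1 := by omega
  simp only [hij.symm, h, e1, e2, and_true, if_false]
  ring

theorem cartanSum_filter_gt {n : ℕ} {i j : ZMod n} {N : ℕ} {a c : ℤ} (hij : i ≠ j)
    (hc : c ∈ window n j N) (h : c + 1 < a) :
    cartanSum ((window n i (N + 1)).filter fun m => m < a) c =
      -((if j - 1 = i then 1 else 0) + (if j + 1 = i then 1 else 0)) := by
  have hcj := (mem_window.1 hc).2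
  unfold cartanSum
  simp only [Finset.mem_filter, mem_window_succ hc (Or.inl rfl),
    mem_window_succ hc (Or.inr (Or.inl rfl)), mem_window_succ hc (Or.inr (Or.inr rfl))]
  push_cast
  rw [hcj]
  have e1 : c < a := by omega
  have e2 : c - 1 < a := by omega
  simp only [hij.symm, h, e1, e2, and_true, if_false]
  ring

theorem cartanSum_eq_zero {T : Finset ℤ} {c : ℤ} (h : c ∉ T) (h1 : c - 1 ∉ T) (h2 : c + 1 ∉ T) :
    cartanSum T c = 0 := by
  simp [cartanSum, h, h1, h2]

theorem cartanSum_same {n : ℕ} (hn : 2 ≤ n) {i : ZMod n} {N : ℕ} {b : ℤ}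
    (hb : b ∈ window n i N) (P : ℤ → Prop) [DecidablePred P] (h : P b) :
    cartanSum ((window n i (N + 1)).filter P) b = 2 := by
  have hbi := (mem_window.1 hb).2
  have h1 : ((b - 1 : ℤ) : ZMod n) ≠ i := fun hc =>
    ne_add_one_of_residue hn (hc.trans hbi.symm) (by omega)
  have h2 : ((b + 1 : ℤ) : ZMod n) ≠ i := fun hc =>
    ne_add_one_of_residue hn (hbi.trans hc.symm) rfl
  unfold cartanSum
  simp only [Finset.mem_filter, mem_window_succ hb (Or.inl rfl), hbi, h,
    mem_window_succ hb (Or.inr (Or.inl rfl)), mem_window_succ hb (Or.inr (Or.inr rfl)), h1, h2]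
  norm_num

theorem end_eq_zpow_smul {q : K} (hq : q ≠ 0) {x y z : Module.End K (BeadSpace K)}
    {a b c : ℤ} (h : x = q ^ a • z) (h' : y = q ^ b • z) (hc : a = c + b) : x = q ^ c • y := by
  rw [h, h', smul_smul, ← zpow_add₀ hq, hc]

theorem move_commute_lower {a b : ℤ} (h : a ≠ b) (h1 : a ≠ b + 1) (h2 : b ≠ a + 1) :
    Commute (opMove K a (a + 1)) (opMove K b (b + 1)) :=
  opMove_commute h h1 (by omega) (by omega)

theorem move_commute_raise {a b : ℤ} (h : a ≠ b) (h1 : a ≠ b + 1) (h2 : b ≠ a + 1) :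
    Commute (opMove K (a + 1) a) (opMove K (b + 1) b) :=
  opMove_commute (by omega) (by omega) (by omega) h

/-- Skew commutation of two summands of Chevalley operators at distant positions. -/
theorem opLower_skew {q : K} (hq : q ≠ 0) {T T' : Finset ℤ} {a b : ℤ} (h : a ≠ b) (h1 : a ≠ b + 1)
    (h2 : b ≠ a + 1) {c : ℤ} (hc : -cartanSum (T.filter fun m => a < m) b =
      c + -cartanSum (T'.filter fun m => b < m) a) :
    opLower q T a * opLower q T' b = q ^ c • (opLower q T' b * opLower q T a) := by
  refine end_eq_zpow_smul hq (opLower_mul_opLower hq T T' a b) ?_ hc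
  rw [opLower_mul_opLower hq, (move_commute_lower h h1 h2).eq, (opK_commute q _ _ _ _).eq]

theorem opRaise_skew {q : K} (hq : q ≠ 0) {T T' : Finset ℤ} {a b : ℤ} (h : a ≠ b) (h1 : a ≠ b + 1)
    (h2 : b ≠ a + 1) {c : ℤ} (hc : -cartanSum (T.filter fun m => m < a) b =
      c + -cartanSum (T'.filter fun m => m < b) a) :
    opRaise q T a * opRaise q T' b = q ^ c • (opRaise q T' b * opRaise q T a) := by
  refine end_eq_zpow_smul hq (opRaise_mul_opRaise hq T T' a b) ?_ hc
  rw [opRaise_mul_opRaise hq, (move_commute_raise h h1 h2).eq, (opK_commute q _ _ _ _).eq]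

theorem mul_opLower_eq_zero {q : K} (hq : q ≠ 0) {T : Finset ℤ} {b : ℤ}
    {x : Module.End K (BeadSpace K)} {y : Module.End K (BeadSpace K)} {S : Finset ℤ} {ε : ℤ}
    (hy : y = x * opK q S ε) (h : x * opMove K b (b + 1) = 0) : y * opLower q T b = 0 := by
  rw [hy, opLower, mul_assoc, ← mul_assoc (opK q S ε), opK_mul_lower hq, smul_mul_assoc,
    mul_smul_comm, mul_assoc, ← mul_assoc x, h, zero_mul, smul_zero]

theorem mul_opRaise_eq_zero {q : K} (hq : q ≠ 0) {T : Finset ℤ} {b : ℤ}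
    {x : Module.End K (BeadSpace K)} {y : Module.End K (BeadSpace K)} {S : Finset ℤ} {ε : ℤ}
    (hy : y = x * opK q S ε) (h : x * opMove K (b + 1) b = 0) : y * opRaise q T b = 0 := by
  rw [hy, opRaise, mul_assoc, ← mul_assoc (opK q S ε), opK_mul_raise hq, smul_mul_assoc,
    mul_smul_comm, mul_assoc, ← mul_assoc x, h, zero_mul, smul_zero]

theorem opLower_mul_self {q : K} (hq : q ≠ 0) (T : Finset ℤ) (a : ℤ) :
    opLower q T a * opLower q T a = 0 :=
  mul_opLower_eq_zero hq rfl (opMove_mul_same_source _ _ _ (by omega))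

theorem opRaise_mul_self {q : K} (hq : q ≠ 0) (T : Finset ℤ) (a : ℤ) :
    opRaise q T a * opRaise q T a = 0 :=
  mul_opRaise_eq_zero hq rfl (opMove_mul_same_source _ _ _ (by omega))

/-- For `a = c - 1` the position `a` stays empty after the first move. For `a = c + 1` it may be
filled again, but then the target `a + 1` is still occupied. -/
theorem lower_lower_lower {a c : ℤ} (h : a = c - 1 ∨ a = c + 1) :
    opMove K a (a + 1) * opMove K c (c + 1) * opMove K a (a + 1) = 0 := by
  rcases h with rfl | rfl
  · exact opMove_mul_mul_same_source (by omega) (by omega)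
  · exact opMove_mul_mul_same_target (by omega)

theorem raise_raise_raise {a c : ℤ} (h : a = c - 1 ∨ a = c + 1) :
    opMove K (a + 1) a * opMove K (c + 1) c * opMove K (a + 1) a = 0 := by
  rcases h with rfl | rfl
  · exact opMove_mul_mul_same_target (by omega)
  · exact opMove_mul_mul_same_source (by omega) (by omega)

theorem opLower_mul_mul {q : K} (hq : q ≠ 0) (T T' : Finset ℤ) {a c : ℤ}
    (h : a = c - 1 ∨ a = c + 1) : opLower q T a * (opLower q T' c * opLower q T a) = 0 := by
  rw [opLower_mul_opLower hq, mul_smul_comm, opLower]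
  have h1 : opK q (T.filter fun m => a < m) 1 * opMove K c (c + 1) = _ := opK_mul_lower hq _ _ _
  have h2 : opK q (T.filter fun m => a < m) 1 * opMove K a (a + 1) = _ := opK_mul_lower hq _ _ _
  rw [mul_assoc (opMove K a _), mul_assoc (opMove K c _), ← mul_assoc _ (opMove K c _), h1,
    smul_mul_assoc, mul_smul_comm, mul_assoc (opMove K c _), ← mul_assoc _ (opMove K a _), h2,
    smul_mul_assoc, mul_smul_comm, mul_smul_comm, mul_assoc (opMove K a _), ← mul_assoc,
    ← mul_assoc, lower_lower_lower h, zero_mul, smul_zero, smul_zero, smul_zero]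

theorem opRaise_mul_mul {q : K} (hq : q ≠ 0) (T T' : Finset ℤ) {a c : ℤ}
    (h : a = c - 1 ∨ a = c + 1) : opRaise q T a * (opRaise q T' c * opRaise q T a) = 0 := by
  rw [opRaise_mul_opRaise hq, mul_smul_comm, opRaise]
  have h1 : opK q (T.filter fun m => m < a) (-1) * opMove K (c + 1) c = _ :=
    opK_mul_raise hq _ _ _
  have h2 : opK q (T.filter fun m => m < a) (-1) * opMove K (a + 1) a = _ :=
    opK_mul_raise hq _ _ _
  rw [mul_assoc (opMove K _ a), mul_assoc (opMove K _ c), ← mul_assoc _ (opMove K _ c), h1,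
    smul_mul_assoc, mul_smul_comm, mul_assoc (opMove K _ c), ← mul_assoc _ (opMove K _ a), h2,
    smul_mul_assoc, mul_smul_comm, mul_smul_comm, mul_assoc (opMove K _ a), ← mul_assoc,
    ← mul_assoc, raise_raise_raise h, zero_mul, smul_zero, smul_zero, smul_zero]

theorem serre_weight {n : ℕ} {i j : ZMod n} (S : Finset ℤ) {c : ℤ} (hc : (c : ZMod n) = j)
    (hS : ∀ a ∈ S, (a : ZMod n) = i) {w : ℕ}
    (hw : w = (if j - 1 = i then 1 else 0) + (if j + 1 = i then 1 else 0)) :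
    w = 2 ∨ (w = 1 ∧ (c - 1 ∉ S ∨ c + 1 ∉ S)) ∨ (w = 0 ∧ c - 1 ∉ S ∧ c + 1 ∉ S) := by
  have h1 : j - 1 ≠ i → c - 1 ∉ S := fun h hm => h (by
    have := hS _ hm
    push_cast at this
    rwa [hc] at this)
  have h2 : j + 1 ≠ i → c + 1 ∉ S := fun h hm => h (by
    have := hS _ hm
    push_cast at this
    rwa [hc] at this)
  by_cases e1 : j - 1 = i <;> by_cases e2 : j + 1 = i <;> simp only [e1, e2, if_true, if_false] at hw
  · exact Or.inl hw
  · exact Or.inr (Or.inl ⟨hw, Or.inr (h2 e2)⟩)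
  · exact Or.inr (Or.inl ⟨hw, Or.inl (h1 e1)⟩)
  · exact Or.inr (Or.inr ⟨hw, h1 e1, h2 e2⟩)

theorem pairing_symm {n : ℕ} (i j : ZMod n) :
    ((if i - 1 = j then 1 else 0) + (if i + 1 = j then 1 else 0) : ℤ) =
      (if j - 1 = i then 1 else 0) + (if j + 1 = i then 1 else 0) := by
  have h1 : i - 1 = j ↔ j + 1 = i := by rw [sub_eq_iff_eq_add, eq_comm]
  have h2 : i + 1 = j ↔ j - 1 = i := by rw [sub_eq_iff_eq_add, eq_comm]
  simp only [h1, h2]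
  ring

theorem serre_truncF_opLower {n : ℕ} (hn : 2 ≤ n) {q : K} (hq : q ≠ 0)
    (hroot : ∀ k : ℕ, 0 < k → q ^ k ≠ 1) {i j : ZMod n} (hij : i ≠ j) (N : ℕ) {c : ℤ}
    (hc : c ∈ window n j N) :
    serre q (serreOrder n i j) (truncF n q i N) (opLower q (window n j (N + 1)) c) = 0 := by
  have hcj := (mem_window.1 hc).2
  rw [serreOrder_eq hij]
  set w : ℕ := (if j - 1 = i then 1 else 0) + (if j + 1 = i then 1 else 0) with hw
  have hwz : (w : ℤ) = (if j - 1 = i then 1 else 0) + (if j + 1 = i then 1 else 0) := by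
    rw [hw]; push_cast; rfl
  have hne : ∀ a ∈ window n i N, a ≠ c := by
    rintro a ha rfl
    exact hij ((mem_window.1 ha).2.symm.trans hcj)
  refine serre_of_family (R := Module.End K (BeadSpace K)) hq hroot (Or.inl rfl) (S := window n i N)
    (A := opLower q (window n i (N + 1))) (c := c) ?_ ?_ ?_ ?_ ?_ (fun h => hne c h rfl)
    (serre_weight _ hcj (fun a ha => (mem_window.1 ha).2) hw)
  · intro a ha b hb hab
    have hab : a < b := by omega
    have hn' := add_le_of_residue ((mem_window.1 ha).2.trans (mem_window.1 hb).2.symm) hab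
    rw [← zpow_natCast, ← zpow_neg]
    refine opLower_skew hq (by omega) (by omega) (by omega) ?_
    rw [cartanSum_same hn hb _ hab, cartanSum_eq_zero]
    -- The exponent `-2`: `a` sees the position `b` to its right, whereas neither `a` nor its
    -- neighbours lie to the right of `b`.
    · rfl
    all_goals simp only [Finset.mem_filter]; omega
  · intro a _
    exact opLower_mul_self hq _ _
  · intro a ha hac
    rw [← zpow_natCast]
    refine opLower_skew hq (hne a ha) (by omega) (by omega) ?_
    rw [cartanSum_filter_lt hij hc (by omega), cartanSum_eq_zero]
    · rw [hwz]; ring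
    all_goals simp only [Finset.mem_filter]; omega
  · intro a ha hac
    rw [← zpow_natCast, ← zpow_neg]
    refine opLower_skew hq (hne a ha) (by omega) (by omega) ?_
    rw [cartanSum_filter_lt hij.symm ha (by omega), cartanSum_eq_zero]
    · rw [hwz, pairing_symm]; ring
    all_goals simp only [Finset.mem_filter]; omega
  · intro a _ hac
    exact opLower_mul_mul hq _ _ hac

theorem serre_truncE_opRaise {n : ℕ} (hn : 2 ≤ n) {q : K} (hq : q ≠ 0)
    (hroot : ∀ k : ℕ, 0 < k → q ^ k ≠ 1) {i j : ZMod n} (hij : i ≠ j) (N : ℕ) {c : ℤ}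
    (hc : c ∈ window n j N) :
    serre q (serreOrder n i j) (truncE n q i N) (opRaise q (window n j (N + 1)) c) = 0 := by
  have hcj := (mem_window.1 hc).2
  rw [serreOrder_eq hij]
  set w : ℕ := (if j - 1 = i then 1 else 0) + (if j + 1 = i then 1 else 0) with hw
  have hwz : (w : ℤ) = (if j - 1 = i then 1 else 0) + (if j + 1 = i then 1 else 0) := by
    rw [hw]; push_cast; rfl
  have hne : ∀ a ∈ window n i N, a ≠ c := by
    rintro a ha rfl
    exact hij ((mem_window.1 ha).2.symm.trans hcj)
  refine serre_of_family (R := Module.End K (BeadSpace K)) hq hroot (Or.inr rfl) (S := window n i N)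
    (A := opRaise q (window n i (N + 1))) (c := c) ?_ ?_ ?_ ?_ ?_ (fun h => hne c h rfl)
    (serre_weight _ hcj (fun a ha => (mem_window.1 ha).2) hw)
  · intro a ha b hb hab
    have hab : b < a := by omega
    have hn' := add_le_of_residue ((mem_window.1 hb).2.trans (mem_window.1 ha).2.symm) hab
    rw [← zpow_natCast, ← zpow_neg]
    refine opRaise_skew hq (by omega) (by omega) (by omega) ?_
    rw [cartanSum_same hn hb _ hab, cartanSum_eq_zero]
    · rfl
    all_goals simp only [Finset.mem_filter]; omega
  · intro a _
    exact opRaise_mul_self hq _ _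
  · intro a ha hac
    rw [← zpow_natCast]
    refine opRaise_skew hq (hne a ha) (by omega) (by omega) ?_
    rw [cartanSum_filter_gt hij hc (by omega), cartanSum_eq_zero]
    · rw [hwz]; ring
    all_goals simp only [Finset.mem_filter]; omega
  · intro a ha hac
    rw [← zpow_natCast, ← zpow_neg]
    refine opRaise_skew hq (hne a ha) (by omega) (by omega) ?_
    rw [cartanSum_filter_gt hij.symm ha (by omega), cartanSum_eq_zero]
    · rw [hwz, pairing_symm]; ring
    all_goals simp only [Finset.mem_filter]; omega
  · intro a _ hac
    exact opRaise_mul_mul hq _ _ hac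

theorem serre_sum {R : Type} [Ring R] [Algebra K R] {q : K} {m : ℕ} {x : R} {s : Finset ℤ}
    {y : ℤ → R} (h : ∀ c ∈ s, serre q m x (y c) = 0) : serre q m x (∑ c ∈ s, y c) = 0 := by
  have e : serre q m x (∑ c ∈ s, y c) = ∑ c ∈ s, serre q m x (y c) := by
    simp only [serre]
    rw [Finset.sum_comm]
    refine Finset.sum_congr rfl fun k _ => ?_
    rw [Finset.mul_sum, Finset.sum_mul, Finset.smul_sum]
  rw [e]
  exact Finset.sum_eq_zero h

theorem IsLimit.serre {x x' : ℕ → Module.End K (BeadSpace K)} {y y' : Module.End K (Fock K)}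
    (h : IsLimit x y) (h' : IsLimit x' y') (q : K) (m : ℕ) :
    IsLimit (fun N => serre q m (x N) (x' N)) (serre q m y y') :=
  IsLimit.sum _ fun k _ => (((h.pow (m - k)).mul h').mul (h.pow k)).smul _

theorem serre_fockF {n : ℕ} (hn : 2 ≤ n) {q : K} (hq : q ≠ 0)
    (hroot : ∀ k : ℕ, 0 < k → q ^ k ≠ 1) {i j : ZMod n} (hij : i ≠ j) :
    serre q (serreOrder n i j) (fockF n q i) (fockF n q j) = 0 :=
  ((isLimit_truncF hn q i).serre (isLimit_truncF hn q j) q _).congr IsLimit.zero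
    (Eventually.of_forall fun N => serre_sum (R := Module.End K (BeadSpace K)) fun _ hc =>
      serre_truncF_opLower hn hq hroot hij N hc)

theorem serre_fockE {n : ℕ} (hn : 2 ≤ n) {q : K} (hq : q ≠ 0)
    (hroot : ∀ k : ℕ, 0 < k → q ^ k ≠ 1) {i j : ZMod n} (hij : i ≠ j) :
    serre q (serreOrder n i j) (fockE n q i) (fockE n q j) = 0 :=
  ((isLimit_truncE hn q i).serre (isLimit_truncE hn q j) q _).congr IsLimit.zero
    (Eventually.of_forall fun N => serre_sum (R := Module.End K (BeadSpace K)) fun _ hc =>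
      serre_truncE_opRaise hn hq hroot hij N hc)

theorem fockE_commute_fockF {n : ℕ} (hn : 2 ≤ n) {q : K} (hq : q ≠ 0) {i j : ZMod n}
    (hij : i ≠ j) : Commute (fockE n q i) (fockF n q j) :=
  ((isLimit_truncE hn q i).mul (isLimit_truncF hn q j)).congr
    ((isLimit_truncF hn q j).mul (isLimit_truncE hn q i))
    (Eventually.of_forall fun N => truncE_commute_truncF hq hij N)

end
end RibbonFock

namespace RibbonFock
open Filter
section
variable {K : Type} [Field K]

theorem isLimit_opK {n : ℕ} (q : K) (i : ZMod n) (ε : ℤ) :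
    IsLimit (fun N => opK q (window n i (N + 1)) ε) (fockH n (q ^ ε) i) := by
  refine IsLimit.of_single fun lam => ?_
  filter_upwards [eventually_ge_atTop lam.card] with N hN
  rw [opK_single, fockH_single, toBeads_single, nodeCount_eq i (show lam.card ≤ N + 1 by omega),
    zpow_mul]
  rfl

/-- Jumps move beads within a residue class and so preserve the signed count of `i`-nodes. -/
theorem V_commute_fockH {n : ℕ} (hn : 2 ≤ n) {q : K} (hq : q ≠ 0) (k : ℕ) (i : ZMod n) (ε : ℤ) :
    Commute (V n q k) (fockH n (q ^ ε) i) := by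
  have key : ∀ (N : ℕ) (p : ℤ), -(N : ℤ) ≤ p ∧ p + n ≤ N + 1 →
      Commute (opK q (window n i (N + 1)) ε) (opJump n q p) := by
    intro N p hp
    refine (opJump_commute_opK n hq ε ?_ ?_).symm
    · rw [mem_window, mem_window, residue_add]
      refine and_congr_left fun _ => ?_
      push_cast
      omega
    · rw [add_sub_right_comm, mem_window, mem_window, residue_add]
      refine and_congr_left fun _ => ?_
      push_cast
      omega
  refine V_commute_of_isLimit hn hq k i (isLimit_opK q i ε)
    (fun N p hT _ _ => key N p (by omega)) fun N p hT _ => ?_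
  have h1 := key N p (by omega)
  have h2 := key N (p + 1) (by omega)
  exact ⟨h1.add_right h2, h2.mul_right h1⟩

/-! ## Diagonal operators on the Fock space -/

/-- The change of `N_i` when a `j`-node is added, with the opposite sign. -/
theorem IsNode.nodeCount_eq {n : ℕ} {j : ZMod n} {lam mu : YoungDiagram} {x : ℕ × ℕ}
    (h : IsNode lam mu x) (hx : ((content x : ℤ) : ZMod n) = j) (i : ZMod n) :
    nodeCount n i mu = nodeCount n i lam -
      (2 * (if j = i then 1 else 0) - (if j - 1 = i then 1 else 0) - if j + 1 = i then 1 else 0) := by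
  have hb := (isIndent_iff lam x).1 ((isIndent_iff_exists _ _).2 ⟨mu, h⟩)
  have hmem : content x ∈ window n j (lam.card + mu.card + (content x).natAbs) :=
    mem_window.2 ⟨by omega, hx⟩
  have hs := stepSum_moveBead (window n i (lam.card + mu.card + (content x).natAbs + 1)) hb.1 hb.2.1
  rw [← h.bead_eq, stepSum, stepSum, ← RibbonFock.nodeCount_eq i (by omega),
    ← RibbonFock.nodeCount_eq i (by omega), add_sub_cancel_right] at hs
  simp only [mem_window_succ hmem (Or.inl rfl), mem_window_succ hmem (Or.inr (Or.inl rfl)),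
    mem_window_succ hmem (Or.inr (Or.inr rfl))] at hs
  push_cast at hs
  rw [hx] at hs
  rw [hs]
  ring

theorem IsNode.zeroCount_eq {n : ℕ} {j : ZMod n} {lam mu : YoungDiagram} {x : ℕ × ℕ}
    (h : IsNode lam mu x) (hx : ((content x : ℤ) : ZMod n) = j) :
    zeroCount n mu = zeroCount n lam + if j = 0 then 1 else 0 := by
  unfold zeroCount
  rw [h.2, Finset.filter_insert, residue_eq, hx]
  split_ifs with h0
  · rw [Finset.card_insert_of_notMem]
    intro hc
    exact h.1 (Finset.mem_filter.1 hc).1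
  · rfl

/-- The eigenvalue exponent of `q^h` on `|lam⟩`. -/
noncomputable def weight (n : ℕ) [NeZero n] (h : Coweight n) (lam : YoungDiagram) : ℤ :=
  ∑ i, h.1 i * nodeCount n i lam - h.2 * zeroCount n lam

theorem IsNode.weight_eq {n : ℕ} [NeZero n] {j : ZMod n} {lam mu : YoungDiagram} {x : ℕ × ℕ}
    (h : IsNode lam mu x) (hx : ((content x : ℤ) : ZMod n) = j) (t : Coweight n) :
    weight n t mu = weight n t lam - rootPairing n j t := by
  unfold weight rootPairing
  simp only [h.nodeCount_eq hx, h.zeroCount_eq hx, mul_sub, Finset.sum_sub_distrib, mul_ite,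
    mul_one, mul_zero, Finset.sum_ite_eq, Finset.mem_univ, if_true]
  split_ifs with h0 <;> push_cast <;> ring

/-- The diagonal operator with eigenvalues `g lam`. -/
noncomputable def fockDiag (g : YoungDiagram → K) : Module.End K (Fock K) :=
  Finsupp.linearCombination K fun lam => Finsupp.single lam (g lam)

theorem fockDiag_single (g : YoungDiagram → K) (lam : YoungDiagram) (c : K) :
    fockDiag g (Finsupp.single lam c) = Finsupp.single lam (g lam * c) := by
  rw [fockDiag, Finsupp.linearCombination_single, Finsupp.smul_single, smul_eq_mul, mul_comm]

theorem fockDiag_mul (g g' : YoungDiagram → K) :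
    fockDiag g * fockDiag g' = fockDiag fun lam => g lam * g' lam := by
  refine end_ext fun s => ?_
  simp only [Module.End.mul_apply, fockDiag_single, mul_one]

theorem fockDiag_mul_fockF {n : ℕ} (q : K) {j : ZMod n} {g g' : YoungDiagram → K} {c : K}
    (h : ∀ lam mu x, IsNode lam mu x → ((content x : ℤ) : ZMod n) = j → g mu = c * g' lam) :
    fockDiag g * fockF n q j = c • (fockF n q j * fockDiag g') := by
  refine end_ext fun lam => ?_
  have e : Finsupp.single lam (g' lam) = g' lam • (Finsupp.single lam 1 : Fock K) := by simp
  rw [Module.End.mul_apply, LinearMap.smul_apply, Module.End.mul_apply, fockDiag_single, mul_one, e,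
    map_smul, fockF_single, map_sum, smul_smul, Finset.smul_sum]
  refine Finset.sum_congr rfl fun x hx => ?_
  rw [mem_indentNodes] at hx
  obtain ⟨mu, hmu⟩ := (isIndent_iff_exists _ _).1 hx.1
  rw [fockDiag_single, hmu.addNode_eq, h lam mu x hmu hx.2, Finsupp.smul_single, smul_eq_mul]

theorem fockDiag_mul_fockE {n : ℕ} (q : K) {j : ZMod n} {g g' : YoungDiagram → K} {c : K}
    (h : ∀ lam mu x, IsNode lam mu x → ((content x : ℤ) : ZMod n) = j → g lam = c * g' mu) :
    fockDiag g * fockE n q j = c • (fockE n q j * fockDiag g') := by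
  refine end_ext fun mu => ?_
  have e : Finsupp.single mu (g' mu) = g' mu • (Finsupp.single mu 1 : Fock K) := by simp
  rw [Module.End.mul_apply, LinearMap.smul_apply, Module.End.mul_apply, fockDiag_single, mul_one, e,
    map_smul, fockE_single, map_sum, smul_smul, Finset.smul_sum]
  refine Finset.sum_congr rfl fun x hx => ?_
  rw [mem_removableNodes] at hx
  obtain ⟨lam, hlam⟩ := (isRemovable_iff_exists _ _).1 hx.1
  rw [fockDiag_single, hlam.removeNode_eq, h lam mu x hlam hx.2, Finsupp.smul_single, smul_eq_mul]

/-- The action of `q^h`. -/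
noncomputable def fockT (n : ℕ) [NeZero n] (q : K) (h : Coweight n) : Module.End K (Fock K) :=
  fockDiag fun lam => q ^ weight n h lam

theorem fockT_add {n : ℕ} [NeZero n] {q : K} (hq : q ≠ 0) (h h' : Coweight n) :
    fockT n q h * fockT n q h' = fockT n q (h + h') := by
  rw [fockT, fockT, fockT, fockDiag_mul]
  congr 1
  funext lam
  rw [← zpow_add₀ hq]
  congr 1
  simp only [weight, Prod.fst_add, Prod.snd_add, Pi.add_apply, add_mul, Finset.sum_add_distrib]
  ring

theorem fockT_zero (n : ℕ) [NeZero n] (q : K) : fockT n q 0 = 1 := by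
  refine end_ext fun s => ?_
  rw [fockT, fockDiag_single]
  simp [weight]

theorem fockT_coroot (n : ℕ) [NeZero n] (q : K) (i : ZMod n) :
    fockT n q (coroot n i) = fockH n q i := by
  refine end_ext fun s => ?_
  rw [fockT, fockDiag_single, fockH_single]
  simp [weight, coroot, Pi.single_apply]

theorem fockT_neg_coroot (n : ℕ) [NeZero n] (q : K) (i : ZMod n) :
    fockT n q (-coroot n i) = fockH n q⁻¹ i := by
  refine end_ext fun s => ?_
  rw [fockT, fockDiag_single, fockH_single]
  simp [weight, coroot, Pi.single_apply]

theorem fockT_scaling (n : ℕ) [NeZero n] (q : K) : fockT n q (scaling n) = fockD n q := by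
  refine end_ext fun s => ?_
  rw [fockT, fockDiag_single, fockD, Finsupp.linearCombination_single]
  simp [weight, scaling]

theorem fockT_mul_fockE {n : ℕ} [NeZero n] {q : K} (hq : q ≠ 0) (h : Coweight n) (j : ZMod n) :
    fockT n q h * fockE n q j = q ^ rootPairing n j h • (fockE n q j * fockT n q h) := by
  refine fockDiag_mul_fockE q fun lam mu x hx hj => ?_
  rw [← zpow_add₀ hq, hx.weight_eq hj, add_sub_cancel]

theorem fockT_mul_fockF {n : ℕ} [NeZero n] {q : K} (hq : q ≠ 0) (h : Coweight n) (j : ZMod n) :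
    fockT n q h * fockF n q j = q ^ (-rootPairing n j h) • (fockF n q j * fockT n q h) := by
  refine fockDiag_mul_fockF q fun lam mu x hx hj => ?_
  rw [← zpow_add₀ hq, hx.weight_eq hj]
  congr 1
  ring

/-! ## The Hayashi action -/

/-- The operators by which the generators act. -/
noncomputable def genAction (n : ℕ) [NeZero n] (q : K) : Gen n → Module.End K (Fock K)
  | .e i => fockE n q i
  | .f i => fockF n q i
  | .t h => fockT n q h

theorem map_serre {A B : Type} [Ring A] [Algebra K A] [Ring B] [Algebra K B] (φ : A →ₐ[K] B)
    (q : K) (m : ℕ) (x y : A) : φ (serre q m x y) = serre q m (φ x) (φ y) := by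
  simp [serre]

theorem genAction_rel {n : ℕ} [NeZero n] (hn : 2 ≤ n) {q : K} (hq : q ≠ 0)
    (hroot : ∀ k : ℕ, 0 < k → q ^ k ≠ 1) ⦃x y : FreeAlgebra K (Gen n)⦄ (h : UqRel n q x y) :
    FreeAlgebra.lift K (genAction n q) x = FreeAlgebra.lift K (genAction n q) y := by
  -- The defining relations are conjugations by `q^h`, whereas the weight computation gives an
  -- exchange rule; the inverse of `q^h` is `q^{-h}`.
  have hconj : ∀ (h : Coweight n) (c : K) (x : Module.End K (Fock K)),
      fockT n q h * x = c • (x * fockT n q h) → fockT n q h * x * fockT n q (-h) = c • x := by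
    intro h c x hx
    rw [hx, smul_mul_assoc, mul_assoc, fockT_add hq, add_neg_cancel, fockT_zero, mul_one]
  cases h with
  | t_add h h' =>
    simp only [map_mul, FreeAlgebra.lift_ι_apply, genAction]
    exact fockT_add hq h h'
  | t_zero =>
    simp only [map_one, FreeAlgebra.lift_ι_apply, genAction]
    exact fockT_zero n q
  | t_e h j =>
    simp only [map_mul, map_smul, FreeAlgebra.lift_ι_apply, genAction]
    exact hconj _ _ _ (fockT_mul_fockE hq h j)
  | t_f h j =>
    simp only [map_mul, map_smul, FreeAlgebra.lift_ι_apply, genAction]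
    exact hconj _ _ _ (fockT_mul_fockF hq h j)
  | e_f_same i =>
    simp only [map_mul, map_sub, map_smul, FreeAlgebra.lift_ι_apply, genAction, fockT_coroot,
      fockT_neg_coroot]
    exact fockE_fockF_commutator hn hq (sub_inv_ne_zero hq hroot) i
  | e_f_ne i j hij =>
    simp only [map_mul, map_sub, map_zero, FreeAlgebra.lift_ι_apply, genAction]
    exact sub_eq_zero.2 (fockE_commute_fockF hn hq hij).eq
  | serre_e i j hij =>
    refine (map_serre (FreeAlgebra.lift K (genAction n q)) q _ _ _).trans ?_
    rw [map_zero, FreeAlgebra.lift_ι_apply, FreeAlgebra.lift_ι_apply]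
    exact serre_fockE hn hq hroot hij
  | serre_f i j hij =>
    refine (map_serre (FreeAlgebra.lift K (genAction n q)) q _ _ _).trans ?_
    rw [map_zero, FreeAlgebra.lift_ι_apply, FreeAlgebra.lift_ι_apply]
    exact serre_fockF hn hq hroot hij

theorem exists_hayashiAction {n : ℕ} (hn : 2 ≤ n) {q : K} (hq : q ≠ 0)
    (hroot : ∀ k : ℕ, 0 < k → q ^ k ≠ 1) :
    ∃ rho : Uq n q →ₐ[K] Module.End K (Fock K), IsHayashiAction n q rho := by
  have : NeZero n := ⟨by omega⟩
  have key : ∀ g, RingQuot.liftAlgHom K ⟨FreeAlgebra.lift K (genAction n q),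
      genAction_rel hn hq hroot⟩ (gen n q g) = genAction n q g := by
    intro g
    rw [gen, RingQuot.liftAlgHom_mkAlgHom_apply, FreeAlgebra.lift_ι_apply]
  exact ⟨_, fun i => key (.e i), fun i => key (.f i),
    fun i => (key (.t (coroot n i))).trans (fockT_coroot n q i),
    (key (.t (scaling n))).trans (fockT_scaling n q)⟩

end
end RibbonFock

namespace RibbonFock
open Filter
section
variable {K : Type} [Field K]

/-! ## Adjoint operators -/

theorem scalarProduct_add_left (f f' g : Fock K) :
    scalarProduct (f + f') g = scalarProduct f g + scalarProduct f' g := by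
  unfold scalarProduct
  exact Finsupp.sum_add_index' (fun _ => zero_mul _) fun _ _ _ => add_mul _ _ _

theorem scalarProduct_single (lam : YoungDiagram) (c : K) (g : Fock K) :
    scalarProduct (Finsupp.single lam c) g = c * g lam := by
  unfold scalarProduct
  exact Finsupp.sum_single_index (zero_mul _)

theorem scalarProduct_zero_left (g : Fock K) : scalarProduct 0 g = 0 := by
  simp [scalarProduct]

theorem scalarProduct_comm (f g : Fock K) : scalarProduct f g = scalarProduct g f := by
  classical
  unfold scalarProduct Finsupp.sum
  have h : ∀ f g : Fock K, ∑ a ∈ f.support, f a * g a =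
      ∑ a ∈ f.support ∪ g.support, f a * g a := fun f g =>
    Finset.sum_subset Finset.subset_union_left fun a _ ha => by
      rw [Finsupp.notMem_support_iff.1 ha, zero_mul]
  rw [h, h g f, Finset.union_comm]
  exact Finset.sum_congr rfl fun a _ => mul_comm _ _

theorem scalarProduct_add_right (f g g' : Fock K) :
    scalarProduct f (g + g') = scalarProduct f g + scalarProduct f g' := by
  rw [scalarProduct_comm, scalarProduct_add_left, scalarProduct_comm g, scalarProduct_comm g']

theorem scalarProduct_smul_left (c : K) (f g : Fock K) :
    scalarProduct (c • f) g = c * scalarProduct f g := by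
  induction f using Finsupp.induction_linear with
  | zero => simp [scalarProduct_zero_left]
  | add f f' h h' => rw [smul_add, scalarProduct_add_left, h, h', scalarProduct_add_left, mul_add]
  | single lam a => rw [Finsupp.smul_single, scalarProduct_single, scalarProduct_single,
      smul_eq_mul, mul_assoc]

theorem scalarProduct_smul_right (c : K) (f g : Fock K) :
    scalarProduct f (c • g) = c * scalarProduct f g := by
  rw [scalarProduct_comm, scalarProduct_smul_left, scalarProduct_comm]

theorem scalarProduct_ext {f g : Fock K} (h : ∀ v, scalarProduct v f = scalarProduct v g) :
    f = g := by
  ext lam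
  have := h (Finsupp.single lam 1)
  rwa [scalarProduct_single, scalarProduct_single, one_mul, one_mul] at this

/-- `y` is the adjoint of `x`. -/
def IsAdjoint (x y : Module.End K (Fock K)) : Prop :=
  ∀ f g, scalarProduct (x f) g = scalarProduct f (y g)

theorem IsAdjoint.of_single {x y : Module.End K (Fock K)}
    (h : ∀ lam mu, x (Finsupp.single lam 1) mu = y (Finsupp.single mu 1) lam) :
    IsAdjoint x y := by
  intro f g
  induction f using Finsupp.induction_linear with
  | zero => simp [scalarProduct_zero_left]
  | add f f' h h' => rw [map_add, scalarProduct_add_left, h, h', scalarProduct_add_left]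
  | single lam a =>
    induction g using Finsupp.induction_linear with
    | zero => rw [map_zero, scalarProduct_comm, scalarProduct_comm _ 0]; simp [scalarProduct_zero_left]
    | add g g' h h' => rw [map_add, scalarProduct_add_right, h, h', scalarProduct_add_right]
    | single mu b =>
      have e : ∀ (k : YoungDiagram) (c : K), Finsupp.single k c = c • Finsupp.single k 1 := by simp
      rw [e lam, e mu, map_smul, map_smul, scalarProduct_smul_left, scalarProduct_smul_left,
        scalarProduct_smul_right, scalarProduct_smul_right, scalarProduct_comm,
        scalarProduct_single, scalarProduct_single, h]

theorem IsAdjoint.symm {x y : Module.End K (Fock K)} (h : IsAdjoint x y) : IsAdjoint y x :=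
  fun f g => by rw [scalarProduct_comm, ← h, scalarProduct_comm]

theorem IsAdjoint.mul {x y x' y' : Module.End K (Fock K)} (h : IsAdjoint x y)
    (h' : IsAdjoint x' y') : IsAdjoint (x * x') (y' * y) :=
  fun f g => by rw [Module.End.mul_apply, Module.End.mul_apply, h, h']

theorem IsAdjoint.smul {x y : Module.End K (Fock K)} (c : K) (h : IsAdjoint x y) :
    IsAdjoint (c • x) (c • y) :=
  fun f g => by rw [LinearMap.smul_apply, LinearMap.smul_apply, scalarProduct_smul_left,
    scalarProduct_smul_right, h]

theorem IsAdjoint.unique {x y y' : Module.End K (Fock K)} (h : IsAdjoint x y)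
    (h' : IsAdjoint x y') : y = y' :=
  LinearMap.ext fun g => scalarProduct_ext fun v => by rw [← h, h']

theorem IsAdjoint.commute {x y x' y' : Module.End K (Fock K)} (h : IsAdjoint x y)
    (h' : IsAdjoint x' y') (hc : Commute x x') : Commute y y' :=
  (h'.mul h).unique (hc.eq ▸ h.mul h')

/-- Both matrix coefficients are the same sum over tilings. The index sets differ, by size for `V_k`
and by inclusion for `U_k`, but a strip satisfies both conditions, so the additional terms vanish.
-/
theorem isAdjoint_V_U {n : ℕ} {q : K} (hq : q ≠ 0) (k : ℕ) : IsAdjoint (V n q k) (U n q k) := by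
  refine IsAdjoint.of_single fun lam mu => ?_
  rw [V_single hq, U_single hq, Finsupp.finsetSum_apply, Finsupp.finsetSum_apply]
  classical
  simp only [Finsupp.single_apply, Finset.sum_ite_eq']
  split_ifs with h1 h2 h2
  · rfl
  · refine Finset.sum_eq_zero fun T hT => absurd (mem_subdiagrams.2 (mem_tilings.1 hT).le) h2
  · exact (stripSum_eq_zero q fun h => h1 (mem_diagramsOfSize.2 h)).symm
  · rfl

theorem isAdjoint_fockDiag (g : YoungDiagram → K) : IsAdjoint (fockDiag g) (fockDiag g) := by
  refine IsAdjoint.of_single fun lam mu => ?_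
  rw [fockDiag_single, fockDiag_single]
  classical
  rw [Finsupp.single_apply, Finsupp.single_apply]
  by_cases h : lam = mu
  · subst h; rfl
  · rw [if_neg h, if_neg (Ne.symm h)]

theorem fockH_eq_fockDiag (n : ℕ) (q : K) (i : ZMod n) :
    fockH n q i = fockDiag fun lam => q ^ nodeCount n i lam := rfl

theorem fockD_eq_fockDiag (n : ℕ) (q : K) :
    fockD n q = fockDiag fun lam => q ^ (-(zeroCount n lam : ℤ)) := rfl

/-- The nodes on both sides of an indent node and the node itself are all nodes. -/
theorem nodeCountLeft_add_nodeCountRight {n : ℕ} (hn : 2 ≤ n) {i : ZMod n} {lam : YoungDiagram}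
    {x : ℕ × ℕ} (hx : x ∈ indentNodes n i lam) :
    nodeCountLeft n i lam x + nodeCountRight n i lam x + 1 = nodeCount n i lam := by
  obtain ⟨hx1, hx2⟩ := mem_indentNodes.1 hx
  obtain ⟨h1, h2, h3⟩ := (isIndent_iff _ _).1 hx1
  have e : ∀ m : ℤ, (stepAt (bead lam) m) = (if m < content x then stepAt (bead lam) m else 0) +
      (if content x < m then stepAt (bead lam) m else 0) +
      if m = content x then stepAt (bead lam) m else 0 := by
    intro m
    rcases lt_trichotomy m (content x) with h | h | h
    · rw [if_pos h, if_neg (by omega), if_neg (by omega)]; simp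
    · rw [if_neg (by omega), if_neg (by omega), if_pos h]; simp
    · rw [if_neg (by omega), if_pos h, if_neg (by omega)]; simp
  have hw : content x ∈ window n i (lam.card + (content x).natAbs) :=
    mem_window.2 ⟨by omega, hx2⟩
  have hs : stepAt (bead lam) (content x) = 1 := by simp [stepAt, h1, h2]
  rw [h3, nodeCountLeft_eq hn i (N := lam.card + (content x).natAbs) (by omega) hx2 h1 h2,
    nodeCountRight_eq hn i (N := lam.card + (content x).natAbs) (by omega) hx2 h1 h2,
    nodeCount_eq i (N := lam.card + (content x).natAbs) (by omega),
    Finset.sum_filter, Finset.sum_filter, Finset.sum_congr (s₁ := window n i _) rfl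
      fun m _ => e m, Finset.sum_add_distrib, Finset.sum_add_distrib, Finset.sum_ite_eq', if_pos hw,
    hs]

/-- Matrix coefficients of `f_i`. -/
theorem fockF_coeff {n : ℕ} (q : K) (i : ZMod n) {lam mu : YoungDiagram} {x : ℕ × ℕ}
    (h : IsNode lam mu x) (hx : ((content x : ℤ) : ZMod n) = i) :
    fockF n q i (Finsupp.single lam 1) mu = q ^ nodeCountRight n i lam x := by
  rw [fockF_single, Finsupp.finsetSum_apply, Finset.sum_eq_single x]
  · rw [h.addNode_eq, Finsupp.single_eq_same]
  · intro y hy hyx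
    obtain ⟨nu, hnu⟩ := (isIndent_iff_exists _ _).1 (mem_indentNodes.1 hy).1
    rw [hnu.addNode_eq]
    refine Finsupp.single_eq_of_ne ?_
    rintro rfl
    have h1 : y ∈ insert x lam.cells := by rw [← h.2, hnu.2]; exact Finset.mem_insert_self _ _
    rcases Finset.mem_insert.1 h1 with h1 | h1
    · exact hyx h1
    · exact hnu.1 h1
  · intro hc
    exact absurd (mem_indentNodes.2 ⟨(isIndent_iff_exists _ _).2 ⟨mu, h⟩, hx⟩) hc

theorem fockE_coeff {n : ℕ} (q : K) (i : ZMod n) {lam mu : YoungDiagram} {x : ℕ × ℕ}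
    (h : IsNode lam mu x) (hx : ((content x : ℤ) : ZMod n) = i) :
    fockE n q i (Finsupp.single mu 1) lam = q ^ (-nodeCountLeft n i lam x) := by
  rw [fockE_single, Finsupp.finsetSum_apply, Finset.sum_eq_single x]
  · rw [h.removeNode_eq, Finsupp.single_eq_same]
  · intro y hy hyx
    obtain ⟨nu, hnu⟩ := (isRemovable_iff_exists _ _).1 (mem_removableNodes.1 hy).1
    rw [hnu.removeNode_eq]
    refine Finsupp.single_eq_of_ne ?_
    rintro rfl
    have h1 : y ∈ insert x lam.cells := by rw [← h.2, hnu.2]; exact Finset.mem_insert_self _ _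
    rcases Finset.mem_insert.1 h1 with h1 | h1
    · exact hyx h1
    · exact hnu.1 h1
  · intro hc
    exact absurd (mem_removableNodes.2 ⟨(isRemovable_iff_exists _ _).2 ⟨lam, h⟩, hx⟩) hc

theorem fockF_coeff_eq_zero {n : ℕ} (q : K) (i : ZMod n) {lam mu : YoungDiagram}
    (h : ¬ ∃ x, IsNode lam mu x ∧ ((content x : ℤ) : ZMod n) = i) :
    fockF n q i (Finsupp.single lam 1) mu = 0 := by
  rw [fockF_single, Finsupp.finsetSum_apply]
  refine Finset.sum_eq_zero fun y hy => ?_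
  obtain ⟨nu, hnu⟩ := (isIndent_iff_exists _ _).1 (mem_indentNodes.1 hy).1
  rw [hnu.addNode_eq]
  refine Finsupp.single_eq_of_ne ?_
  rintro rfl
  exact h ⟨y, hnu, (mem_indentNodes.1 hy).2⟩

theorem fockE_coeff_eq_zero {n : ℕ} (q : K) (i : ZMod n) {lam mu : YoungDiagram}
    (h : ¬ ∃ x, IsNode lam mu x ∧ ((content x : ℤ) : ZMod n) = i) :
    fockE n q i (Finsupp.single mu 1) lam = 0 := by
  rw [fockE_single, Finsupp.finsetSum_apply]
  refine Finset.sum_eq_zero fun y hy => ?_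
  obtain ⟨nu, hnu⟩ := (isRemovable_iff_exists _ _).1 (mem_removableNodes.1 hy).1
  rw [hnu.removeNode_eq]
  refine Finsupp.single_eq_of_ne ?_
  rintro rfl
  exact h ⟨y, hnu, (mem_removableNodes.1 hy).2⟩

theorem fockDiag_apply (g : YoungDiagram → K) (v : Fock K) (lam : YoungDiagram) :
    fockDiag g v lam = g lam * v lam := by
  have := isAdjoint_fockDiag g (Finsupp.single lam 1) v
  rwa [fockDiag_single, mul_one, scalarProduct_single, scalarProduct_single, one_mul, eq_comm] at this

/-- The node that is added accounts for one in `N_i(lam)`, so `N_i^r = -1 + N_i(lam) - N_i^l`, which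
is the exponent of the composite on the right. -/
theorem isAdjoint_fockF {n : ℕ} (hn : 2 ≤ n) {q : K} (hq : q ≠ 0) (i : ZMod n) :
    IsAdjoint (fockF n q i) (q⁻¹ • (fockH n q i * fockE n q i)) := by
  refine IsAdjoint.of_single fun lam mu => ?_
  rw [LinearMap.smul_apply, Module.End.mul_apply, fockH_eq_fockDiag, Finsupp.smul_apply,
    fockDiag_apply, smul_eq_mul]
  by_cases h : ∃ x, IsNode lam mu x ∧ ((content x : ℤ) : ZMod n) = i
  · obtain ⟨x, h, hx⟩ := h
    rw [fockF_coeff q i h hx, fockE_coeff q i h hx, ← nodeCountLeft_add_nodeCountRight hn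
      (mem_indentNodes.2 ⟨(isIndent_iff_exists _ _).2 ⟨mu, h⟩, hx⟩), ← zpow_neg_one,
      ← zpow_add₀ hq, ← zpow_add₀ hq]
    congr 1
    ring
  · rw [fockF_coeff_eq_zero q i h, fockE_coeff_eq_zero q i h, mul_zero, mul_zero]

theorem isAdjoint_fockE {n : ℕ} (hn : 2 ≤ n) {q : K} (hq : q ≠ 0) (i : ZMod n) :
    IsAdjoint (fockE n q i) (q • (fockF n q i * fockH n q⁻¹ i)) := by
  have h1 := ((isAdjoint_fockDiag fun lam => q⁻¹ ^ nodeCount n i lam).mul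
    (isAdjoint_fockF hn hq i).symm).smul q
  have h2 : q • (fockDiag (fun lam => q⁻¹ ^ nodeCount n i lam) *
      (q⁻¹ • (fockH n q i * fockE n q i))) = fockE n q i := by
    rw [mul_smul_comm, smul_smul, mul_inv_cancel₀ hq, one_smul, ← mul_assoc, fockH_eq_fockDiag,
      fockDiag_mul]
    have : (fockDiag fun lam => q⁻¹ ^ nodeCount n i lam * q ^ nodeCount n i lam) =
        (1 : Module.End K (Fock K)) := by
      refine end_ext fun lam => ?_
      rw [fockDiag_single, inv_zpow, inv_mul_cancel₀ (zpow_ne_zero _ hq), mul_one]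
      rfl
    rw [this, one_mul]
  rw [h2] at h1
  exact h1

theorem V_commute_fockH_inv {n : ℕ} (hn : 2 ≤ n) {q : K} (hq : q ≠ 0) (k : ℕ) (i : ZMod n) :
    Commute (V n q k) (fockH n q i) ∧ Commute (V n q k) (fockH n q⁻¹ i) := by
  have h1 := V_commute_fockH hn hq k i 1
  have h2 := V_commute_fockH hn hq k i (-1)
  rw [zpow_one] at h1
  rw [zpow_neg_one] at h2
  exact ⟨h1, h2⟩

/-- Each Chevalley generator is the adjoint of a product of operators that commute with `V_k`. -/
theorem U_commute {n : ℕ} (hn : 2 ≤ n) {q : K} (hq : q ≠ 0) (k : ℕ) (i : ZMod n) :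
    Commute (U n q k) (fockF n q i) ∧ Commute (U n q k) (fockE n q i) ∧
      Commute (U n q k) (fockH n q i) := by
  obtain ⟨hF, hE⟩ := V_commute_fockF_fockE (K := K) hn hq k i
  obtain ⟨hH, hH'⟩ := V_commute_fockH_inv (K := K) hn hq k i
  have hU := isAdjoint_V_U (n := n) hq k
  exact ⟨hU.commute (isAdjoint_fockF hn hq i).symm ((hH.mul_right hE).smul_right _),
    hU.commute (isAdjoint_fockE hn hq i).symm ((hF.mul_right hH').smul_right _),
    hU.commute (isAdjoint_fockDiag _) hH⟩

/-! ## The degree operator -/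

theorem IsRibbonRows.card_residue {n : ℕ} (hn : 1 ≤ n) {p : ℤ} {ρ : ℤ → ℤ} {R : Finset (ℕ × ℕ)}
    (h : IsRibbonRows n p ρ R) : (R.filter fun x => residue n x = 0).card = 1 := by
  have hpos : (0 : ℤ) < n := by omega
  have hr1 := Int.emod_nonneg (-p) hpos.ne'
  have hr2 := Int.emod_lt_of_pos (-p) hpos
  rw [Finset.card_eq_one]
  -- The contents of the ribbon are `n` consecutive integers, and `p + (-p) % n` is the only
  -- multiple of `n` among them.
  refine ⟨diagCell (ρ (p + (-p) % n)) (p + (-p) % n), ?_⟩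
  have hd : (n : ℤ) ∣ p + (-p) % n := by
    have := Int.emod_add_mul_ediv (-p) n
    exact ⟨-((-p) / n), by linear_combination this⟩
  have hnn := h.nonneg (p + (-p) % n) (by omega) (by omega)
  ext x
  rw [Finset.mem_filter, Finset.mem_singleton, residue_eq, ZMod.intCast_zmod_eq_zero_iff_dvd]
  constructor
  · rintro ⟨hx, hx0⟩
    obtain ⟨h1, h2, h3⟩ := (h.mem_iff x).1 hx
    have e : content x = p + (-p) % n := by
      have h4 := Int.eq_zero_of_abs_lt_dvd (dvd_sub hx0 hd) (by rw [abs_lt]; omega)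
      omega
    rw [← e, ← h3, diagCell_content]
  · rintro rfl
    refine ⟨h.diagCell_mem (by omega) (by omega), ?_⟩
    rwa [content_diagCell hnn.1 hnn.2]

theorem IsStripTiling.zeroCount_eq {n k : ℕ} (hn : 1 ≤ n) {lam mu : YoungDiagram}
    {T : Finset (Finset (ℕ × ℕ))} (h : IsStripTiling n k lam mu T) :
    zeroCount n mu = zeroCount n lam + k := by
  have h1 : mu.cells = lam.cells ∪ T.biUnion id := by
    rw [h.cover, Finset.union_sdiff_of_subset (YoungDiagram.cells_subset_iff.2 h.le)]
  have h2 : Disjoint lam.cells (T.biUnion id) := by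
    rw [h.cover]; exact Finset.disjoint_sdiff
  unfold zeroCount
  rw [h1, Finset.filter_union, Finset.card_union_of_disjoint (Finset.disjoint_filter_filter h2),
    Finset.filter_biUnion, Finset.card_biUnion (t := fun R => (id R).filter fun x => residue n x = 0) fun R hR S hS hne =>
      Finset.disjoint_filter_filter (h.disjoint R hR S hS hne)]
  rw [Finset.sum_const_nat (m := 1), h.card_eq, mul_one]
  intro R hR
  obtain ⟨p, ρ, ht⟩ := h.exists_isTile hR
  exact ht.card_residue hn

theorem fockD_mul_V {n : ℕ} (hn : 1 ≤ n) {q : K} (hq : q ≠ 0) (k : ℕ) :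
    fockD n q * V n q k = q ^ (-(k : ℤ)) • (V n q k * fockD n q) := by
  refine end_ext fun lam => ?_
  have e : ∀ c : K, Finsupp.single lam c = c • (Finsupp.single lam 1 : Fock K) := by simp
  rw [fockD_eq_fockDiag, Module.End.mul_apply, LinearMap.smul_apply, Module.End.mul_apply,
    fockDiag_single, mul_one, e (q ^ _), map_smul, V_single hq, map_sum, smul_smul,
    Finset.smul_sum]
  refine Finset.sum_congr rfl fun mu _ => ?_
  rw [fockDiag_single, Finsupp.smul_single, smul_eq_mul]
  congr 1
  unfold stripSum
  rw [Finset.mul_sum, Finset.mul_sum]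
  refine Finset.sum_congr rfl fun T hT => ?_
  rw [(mem_tilings.1 hT).zeroCount_eq hn, ← zpow_add₀ hq]
  congr 2
  push_cast
  ring

theorem fockD_mul_U {n : ℕ} (hn : 1 ≤ n) {q : K} (hq : q ≠ 0) (k : ℕ) :
    fockD n q * U n q k = q ^ (k : ℤ) • (U n q k * fockD n q) := by
  have hD : IsAdjoint (fockD n q) (fockD n q) := isAdjoint_fockDiag _
  have hU := isAdjoint_V_U (n := n) hq k
  have h1 := hD.mul hU
  rw [fockD_mul_V hn hq] at h1
  have h2 := h1.unique ((hU.mul hD).smul (q ^ (-(k : ℤ))))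
  rw [h2, smul_smul, ← zpow_add₀ hq, add_neg_cancel, zpow_zero, one_smul]

/-! ## Consequences for the Hayashi action -/

section
variable {n : ℕ} {q : K} {rho : Uq n q →ₐ[K] Module.End K (Fock K)}

theorem gen_t_mul_neg (h : Coweight n) : gen n q (.t h) * gen n q (.t (-h)) = 1 := by
  have h1 := RingQuot.mkAlgHom_rel K (UqRel.t_add (q := q) h (-h))
  have h2 := RingQuot.mkAlgHom_rel K (UqRel.t_zero (n := n) (q := q))
  rw [map_mul, add_neg_cancel] at h1
  rw [map_one] at h2
  exact h1.trans h2

theorem commute_of_mem_UqDerived (hrho : IsHayashiAction n q rho) {y : Module.End K (Fock K)}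
    (hE : ∀ i, Commute y (fockE n q i)) (hF : ∀ i, Commute y (fockF n q i))
    (hH : ∀ i, Commute y (fockH n q i)) {x : Uq n q} (hx : x ∈ UqDerived n q) :
    Commute y (rho x) := by
  induction hx using Algebra.adjoin_induction with
  | mem x hx =>
    obtain ⟨g, hg, rfl⟩ := hx
    rcases hg with ⟨i, rfl⟩ | ⟨i, rfl⟩ | ⟨i, rfl | rfl⟩
    · rw [hrho.e]; exact hE i
    · rw [hrho.f]; exact hF i
    · rw [hrho.h]; exact hH i
    -- The action of `q^{-h_i}` is not prescribed, but it is inverse to that of `q^{h_i}`, and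
    -- commuting with a unit implies commuting with its inverse.
    · have h1 := congrArg rho (gen_t_mul_neg (q := q) (coroot n i))
      have h2 := congrArg rho (gen_t_mul_neg (q := q) (-coroot n i))
      rw [neg_neg] at h2
      rw [map_mul, map_one, hrho.h] at h1 h2
      exact (show Commute y ((Units.mk _ _ h1 h2 : (Module.End K (Fock K))ˣ) : _) from
        hH i).units_inv_right
  | algebraMap r =>
    rw [AlgHom.commutes]
    exact (Algebra.commutes r y).symm
  | add x x' _ _ h h' => rw [map_add]; exact h.add_right h'
  | mul x x' _ _ h h' => rw [map_mul]; exact h.mul_right h'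

end

/-! ## The vectors `ψ^n_q(h_μ)` -/

theorem foldl_V_add (n : ℕ) (q : K) (mu : List ℕ) (v w : Fock K) :
    mu.foldl (fun v k => V n q k v) (v + w) =
      mu.foldl (fun v k => V n q k v) v + mu.foldl (fun v k => V n q k v) w := by
  induction mu generalizing v w with
  | nil => rfl
  | cons k mu ih => rw [List.foldl_cons, map_add, ih]; rfl

theorem foldl_V_smul (n : ℕ) (q : K) (mu : List ℕ) (c : K) (v : Fock K) :
    mu.foldl (fun v k => V n q k v) (c • v) = c • mu.foldl (fun v k => V n q k v) v := by
  induction mu generalizing v with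
  | nil => rfl
  | cons k mu ih => rw [List.foldl_cons, map_smul, ih]; rfl

theorem foldl_V_zero (n : ℕ) (q : K) (mu : List ℕ) :
    mu.foldl (fun v k => V n q k v) (0 : Fock K) = 0 := by
  induction mu with
  | nil => rfl
  | cons k mu ih => rw [List.foldl_cons, map_zero, ih]

theorem foldl_V_sum (n : ℕ) (q : K) (mu : List ℕ) (s : Finset YoungDiagram)
    (v : YoungDiagram → Fock K) : mu.foldl (fun v k => V n q k v) (∑ j ∈ s, v j) =
      ∑ j ∈ s, mu.foldl (fun v k => V n q k v) (v j) := by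
  classical
  induction s using Finset.induction_on with
  | empty => rw [Finset.sum_empty, Finset.sum_empty, foldl_V_zero]
  | insert a s ha ih => rw [Finset.sum_insert ha, Finset.sum_insert ha, foldl_V_add, ih]

theorem foldl_V_single {n : ℕ} {q : K} (hq : q ≠ 0) (mu : List ℕ) (nu : YoungDiagram) :
    mu.foldl (fun v k => V n q k v) (Finsupp.single nu 1) =
      ∑ lam ∈ diagramsOfSize (nu.card + n * mu.sum),
        Finsupp.single lam (spinSum n q lam nu mu) := by
  classical
  induction mu generalizing nu with
  | nil =>
    simp only [spinSum_nil]
    rw [Finset.sum_eq_single nu]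
    · simp
    · intro b _ hb
      rw [if_neg hb, Finsupp.single_zero]
    · intro h
      exact absurd (mem_diagramsOfSize.2 (by simp)) h
  | cons k mu ih =>
    rw [List.foldl_cons, V_single hq, foldl_V_sum]
    have e : ∀ (kap : YoungDiagram) (c : K),
        Finsupp.single kap c = c • (Finsupp.single kap 1 : Fock K) := by simp
    have h1 : ∀ kap ∈ diagramsOfSize (nu.card + n * k), mu.foldl (fun v k => V n q k v)
        (Finsupp.single kap (stripSum n q k nu kap)) =
        ∑ lam ∈ diagramsOfSize (nu.card + n * (k :: mu).sum),
          Finsupp.single lam (stripSum n q k nu kap * spinSum n q lam kap mu) := by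
      intro kap hkap
      rw [mem_diagramsOfSize] at hkap
      rw [e, foldl_V_smul, ih, Finset.smul_sum, hkap, List.sum_cons, mul_add, add_assoc]
      simp only [Finsupp.smul_single, smul_eq_mul]
    rw [Finset.sum_congr rfl h1, Finset.sum_comm]
    refine Finset.sum_congr rfl fun lam _ => ?_
    rw [spinSum_cons n hq, Finsupp.single_finsetSum]

theorem psiH_eq_foldl {n : ℕ} {q : K} (hq : q ≠ 0) (mu : List ℕ) :
    psiH n q mu = mu.foldl (fun v k => V n q k v) (Finsupp.single ⊥ 1) := by
  rw [foldl_V_single hq, psiH, show (⊥ : YoungDiagram).card = 0 from rfl, zero_add]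

theorem fockE_single_bot (n : ℕ) (q : K) (i : ZMod n) :
    fockE n q i (Finsupp.single ⊥ 1) = 0 := by
  rw [fockE_single]
  refine Finset.sum_eq_zero fun x hx => ?_
  exact absurd (mem_removableNodes.1 hx).1.1 (YoungDiagram.notMem_bot x)

theorem fockE_psiH {n : ℕ} (hn : 2 ≤ n) {q : K} (hq : q ≠ 0) (i : ZMod n) (mu : List ℕ) :
    fockE n q i (psiH n q mu) = 0 := by
  have h : ∀ (mu : List ℕ) (v : Fock K), fockE n q i (mu.foldl (fun v k => V n q k v) v) =
      mu.foldl (fun v k => V n q k v) (fockE n q i v) := by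
    intro mu
    induction mu with
    | nil => intro v; rfl
    | cons k mu ih =>
      intro v
      rw [List.foldl_cons, ih, List.foldl_cons, ← Module.End.mul_apply,
        ← (V_commute_fockF_fockE hn hq k i).2.eq, Module.End.mul_apply]
  rw [psiH_eq_foldl hq, h, fockE_single_bot, foldl_V_zero]

end
end RibbonFock

namespace RibbonFock

/-! ## Complete homogeneous symmetric polynomials and alternants -/

section
variable {σ : Type} [Fintype σ] [DecidableEq σ]

theorem hsymm_eq_sum (d : ℕ) : MvPolynomial.hsymm σ ℚ d =
    ∑ l ∈ Finset.finsuppAntidiag Finset.univ d, ∏ i, MvPolynomial.X i ^ l i := by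
  unfold MvPolynomial.hsymm
  symm
  refine Finset.sum_bij' (fun l hl => ⟨Finsupp.toMultiset l, ?_⟩)
    (fun s _ => Multiset.toFinsupp s.1) ?_ ?_ ?_ ?_ ?_
  · have := (Finset.mem_finsuppAntidiag.1 hl).1
    rw [Finsupp.card_toMultiset, ← this, Finsupp.sum_fintype _ _ fun _ => rfl]
    rfl
  · intro l _
    exact Finset.mem_univ _
  · intro s _
    rw [Finset.mem_finsuppAntidiag]
    refine ⟨?_, Finset.subset_univ _⟩
    change ∑ a, s.1.count a = d
    rw [Multiset.sum_count_eq_card fun a _ => Finset.mem_univ a]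
    exact s.2
  · intro l _
    exact Finsupp.toMultiset_toFinsupp l
  · intro s _
    exact Subtype.ext (Multiset.toFinsupp_toMultiset s.1)
  · intro l _
    rw [Finsupp.toMultiset_map, Finsupp.prod_toMultiset, Finsupp.prod_mapDomain_index
      (fun _ => pow_zero _) (fun _ _ _ => pow_add _ _ _), Finsupp.prod_fintype _ _ fun _ => pow_zero _]

theorem mk_pow_mul {R : Type} [CommRing R] (x : R) :
    PowerSeries.mk (fun d => x ^ d) * (1 - PowerSeries.C x * PowerSeries.X) = 1 := by
  ext d
  rw [mul_sub, mul_one, ← mul_assoc, map_sub, mul_comm (PowerSeries.mk _)]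
  cases d with
  | zero => simp
  | succ d =>
    rw [PowerSeries.coeff_succ_mul_X, PowerSeries.coeff_C_mul, PowerSeries.coeff_mk,
      PowerSeries.coeff_mk, pow_succ', sub_self, PowerSeries.coeff_one, if_neg (Nat.succ_ne_zero d)]

/-- The generating function of the complete homogeneous symmetric polynomials. -/
theorem mk_hsymm_mul : PowerSeries.mk (MvPolynomial.hsymm σ ℚ) *
    ∏ i, (1 - PowerSeries.C (MvPolynomial.X i) * PowerSeries.X) = 1 := by
  have h : PowerSeries.mk (MvPolynomial.hsymm σ ℚ) =
      ∏ i : σ, PowerSeries.mk (fun d => (MvPolynomial.X i : MvPolynomial σ ℚ) ^ d) := by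
    ext1 d
    rw [PowerSeries.coeff_mk, PowerSeries.coeff_prod, hsymm_eq_sum]
    simp only [PowerSeries.coeff_mk]
  rw [h, ← Finset.prod_mul_distrib]
  exact Finset.prod_eq_one fun i _ => mk_pow_mul _

/-- The images of the complete homogeneous symmetric polynomials under an algebra homomorphism
are determined by the images of the variables. -/
theorem mk_map_hsymm_mul {R : Type} [CommRing R] (f : MvPolynomial σ ℚ →+* R) :
    PowerSeries.mk (fun d => f (MvPolynomial.hsymm σ ℚ d)) *
    ∏ i, (1 - PowerSeries.C (f (MvPolynomial.X i)) * PowerSeries.X) = 1 := by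
  have h := congrArg (PowerSeries.map f) (mk_hsymm_mul (σ := σ))
  rw [map_mul, map_prod, map_one] at h
  simp only [map_sub, map_mul, map_one, PowerSeries.map_C, PowerSeries.map_X] at h
  exact h

end

/-- The polynomial `∏_{l ≠ k} (1 - x_l t)`. -/
noncomputable def elemPoly (M : ℕ) (k : Fin M) : Polynomial (MvPolynomial (Fin M) ℚ) :=
  ∏ l ∈ Finset.univ.erase k, (1 - Polynomial.C (MvPolynomial.X l) * Polynomial.X)

/-- The coefficients `(-1)^c e_c` of the polynomial `∏_{l ≠ k} (1 - x_l t)`. -/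
noncomputable def elemCoeff (M : ℕ) (c : ℕ) (k : Fin M) : MvPolynomial (Fin M) ℚ :=
  (elemPoly M k).coeff c

theorem elemCoeff_eq_zero {M c : ℕ} (k : Fin M) (h : M ≤ c) : elemCoeff M c k = 0 := by
  refine Polynomial.coeff_eq_zero_of_natDegree_lt ?_
  refine (Polynomial.natDegree_prod_le _ _).trans_lt ?_
  have h1 : ∀ l ∈ Finset.univ.erase k, ((1 : Polynomial (MvPolynomial (Fin M) ℚ)) -
      Polynomial.C (MvPolynomial.X l) * Polynomial.X).natDegree ≤ 1 := by
    intro l _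
    compute_degree
  refine (Finset.sum_le_card_nsmul _ _ 1 h1).trans_lt ?_
  rw [Finset.card_erase_of_mem (Finset.mem_univ k), Finset.card_univ, Fintype.card_fin, smul_eq_mul]
  have := k.isLt
  omega

/-- `h_d` for integers `d = b - c`, with `h_d = 0` for negative `d`. -/
noncomputable def hsub (M b c : ℕ) : MvPolynomial (Fin M) ℚ :=
  if c ≤ b then MvPolynomial.hsymm (Fin M) ℚ (b - c) else 0

/-- Multiplying the generating function `∏ 1 / (1 - x_l t)` of the `h_d` by all factors with `l ≠ k`
leaves `1 / (1 - x_k t)`. As `∏_{l ≠ k} (1 - x_l t)` has degree below `M`, the sum has only `M`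
terms. -/
theorem X_pow_eq_sum {M : ℕ} (b : ℕ) (k : Fin M) : (MvPolynomial.X k : MvPolynomial (Fin M) ℚ) ^ b =
    ∑ c : Fin M, hsub M b c * elemCoeff M c k := by
  have h1 : PowerSeries.mk (fun d => (MvPolynomial.X k : MvPolynomial (Fin M) ℚ) ^ d) =
      PowerSeries.mk (MvPolynomial.hsymm (Fin M) ℚ) *
        (elemPoly M k : PowerSeries (MvPolynomial (Fin M) ℚ)) := by
    have h2 : (elemPoly M k : PowerSeries (MvPolynomial (Fin M) ℚ)) =
        ∏ l ∈ Finset.univ.erase k, (1 - PowerSeries.C (MvPolynomial.X l) * PowerSeries.X) := by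
      rw [← Polynomial.coeToPowerSeries.ringHom_apply, elemPoly, map_prod]
      simp
    have h3 := mk_hsymm_mul (σ := Fin M)
    rw [← Finset.mul_prod_erase _ _ (Finset.mem_univ k), ← h2] at h3
    have h4 := mk_pow_mul (MvPolynomial.X k : MvPolynomial (Fin M) ℚ)
    linear_combination (-PowerSeries.mk fun d => (MvPolynomial.X k : MvPolynomial (Fin M) ℚ) ^ d) * h3
      + (PowerSeries.mk (MvPolynomial.hsymm (Fin M) ℚ) *
        (elemPoly M k : PowerSeries (MvPolynomial (Fin M) ℚ))) * h4
  have h5 := congrArg (PowerSeries.coeff b) h1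
  rw [PowerSeries.coeff_mk, mul_comm, PowerSeries.coeff_mul,
    Finset.Nat.sum_antidiagonal_eq_sum_range_succ_mk] at h5
  rw [h5]
  simp only [Polynomial.coeff_coe, PowerSeries.coeff_mk]
  have h6 : ∑ c : Fin M, hsub M b c * elemCoeff M c k =
      ∑ c ∈ Finset.range M, hsub M b c * elemCoeff M c k :=
    (Finset.sum_range fun c => hsub M b c * elemCoeff M c k).symm
  have h7 : ∀ c, (elemPoly M k).coeff c = elemCoeff M c k := fun _ => rfl
  rw [h6]
  simp only [h7]
  have h8 : ∀ c ∈ Finset.range (b + 1), elemCoeff M c k * MvPolynomial.hsymm (Fin M) ℚ (b - c) =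
      hsub M b c * elemCoeff M c k := by
    intro c hc
    rw [hsub, if_pos (Nat.lt_succ_iff.1 (Finset.mem_range.1 hc)), mul_comm]
  rw [Finset.sum_congr rfl h8]
  have h9 : ∀ s : ℕ, s ≤ max (b + 1) M → (∀ c, s ≤ c → hsub M b c * elemCoeff M c k = 0) →
      ∑ c ∈ Finset.range s, hsub M b c * elemCoeff M c k =
        ∑ c ∈ Finset.range (max (b + 1) M), hsub M b c * elemCoeff M c k := by
    intro s hs h
    refine Finset.sum_subset (Finset.range_mono hs) fun c _ hc => h c ?_
    simpa using hc
  rw [h9 _ (le_max_left _ _), h9 _ (le_max_right _ _)]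
  · intro c hc
    rw [elemCoeff_eq_zero k hc, mul_zero]
  · intro c hc
    rw [hsub, if_neg (by omega), zero_mul]

/-- The alternant `det (x_k^(lam_i + M - 1 - i))`. -/
noncomputable def alternant (M : ℕ) (lam : YoungDiagram) : MvPolynomial (Fin M) ℚ :=
  Matrix.det (Matrix.of fun i k : Fin M =>
    (MvPolynomial.X k : MvPolynomial (Fin M) ℚ) ^ (lam.rowLen i + (M - 1 - i)))

/-- The Jacobi-Trudi matrix of size `M`. -/
noncomputable def jacobiTrudi (N : ℕ) (lam : YoungDiagram) (M : ℕ) :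
    Matrix (Fin M) (Fin M) (MvPolynomial (Fin N) ℚ) :=
  Matrix.of fun i j => if (i : ℕ) ≤ lam.rowLen i + j then
    MvPolynomial.hsymm (Fin N) ℚ (lam.rowLen i + j - i) else 0

theorem rowLen_eq_zero {lam : YoungDiagram} {i : ℕ} (h : lam.colLen 0 ≤ i) : lam.rowLen i = 0 := by
  by_contra hc
  have : (i, 0) ∈ lam := YoungDiagram.mem_iff_lt_rowLen.2 (Nat.pos_of_ne_zero hc)
  have := YoungDiagram.mem_iff_lt_colLen.1 this
  omega

/-- An empty row of the partition gives the last row `(0, …, 0, 1)`, so the size of the matrix may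
be adapted to the number of variables. -/
theorem det_jacobiTrudi (N : ℕ) (lam : YoungDiagram) {M : ℕ} (h : lam.colLen 0 ≤ M) :
    (jacobiTrudi N lam M).det = schur N lam := by
  induction M, h using Nat.le_induction with
  | base => rfl
  | succ M hM ih =>
    rw [← ih, Matrix.det_succ_row _ (Fin.last M), Finset.sum_eq_single (Fin.last M)]
    · have h1 : jacobiTrudi N lam (M + 1) (Fin.last M) (Fin.last M) = 1 := by
        simp [jacobiTrudi, rowLen_eq_zero hM]
      have h2 : (jacobiTrudi N lam (M + 1)).submatrix (Fin.last M).succAbove (Fin.last M).succAbove =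
          jacobiTrudi N lam M := by
        ext1 i j
        simp [jacobiTrudi, Fin.succAbove_last]
      rw [h1, h2, ← two_mul, pow_mul]
      simp
    · intro j _ hj
      have h1 : jacobiTrudi N lam (M + 1) (Fin.last M) j = 0 := by
        have : (j : ℕ) < M := Fin.val_lt_last hj
        simp [jacobiTrudi, rowLen_eq_zero hM, this]
      rw [h1]
      simp
    · intro h
      exact absurd (Finset.mem_univ _) h

/-- The matrix that relates alternants and Jacobi-Trudi determinants. -/
noncomputable def elemMatrix (M : ℕ) : Matrix (Fin M) (Fin M) (MvPolynomial (Fin M) ℚ) :=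
  Matrix.of fun j k => elemCoeff M (M - 1 - j) k

/-- By the expansion of powers in `X_pow_eq_sum` the matrix of the alternant is the product of the
Jacobi-Trudi matrix and a matrix independent of `lam`. -/
theorem alternant_eq {M : ℕ} {lam : YoungDiagram} (h : lam.colLen 0 ≤ M) :
    alternant M lam = schur M lam * (elemMatrix M).det := by
  rw [← det_jacobiTrudi M lam h, ← Matrix.det_mul, alternant]
  congr 1
  ext1 i k
  rw [Matrix.of_apply, X_pow_eq_sum, Matrix.mul_apply, ← Equiv.sum_comp Fin.revPerm]
  refine Finset.sum_congr rfl fun j _ => ?_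
  have e : ((Fin.revPerm j : Fin M) : ℕ) = M - 1 - j := by
    rw [Fin.revPerm_apply, Fin.val_rev]; omega
  rw [e, elemMatrix, Matrix.of_apply, jacobiTrudi, Matrix.of_apply, hsub]
  congr 1
  have hi := i.isLt
  have hj := j.isLt
  by_cases h1 : (i : ℕ) ≤ lam.rowLen i + j
  · rw [if_pos h1, if_pos (by omega)]
    congr 1
    omega
  · rw [if_neg h1, if_neg (by omega)]

theorem alternant_bot_ne_zero (M : ℕ) : alternant M ⊥ ≠ 0 := by
  have h : alternant M ⊥ = (Matrix.projVandermonde (fun _ => 1)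
      (fun k : Fin M => (MvPolynomial.X k : MvPolynomial (Fin M) ℚ))).det := by
    rw [alternant, ← Matrix.det_transpose]
    congr 1
    ext1 k i
    have h0 : (⊥ : YoungDiagram).rowLen i = 0 := rowLen_eq_zero (by
      by_contra hc
      have : (0, 0) ∈ (⊥ : YoungDiagram) := YoungDiagram.mem_iff_lt_colLen.2 (by omega)
      exact YoungDiagram.notMem_bot _ this)
    rw [Matrix.transpose_apply, Matrix.of_apply, Matrix.projVandermonde_apply, h0, one_pow, one_mul,
      zero_add, Fin.val_rev]
    congr 1
    omega
  rw [h, Matrix.det_projVandermonde, Finset.prod_ne_zero_iff]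
  intro i _
  rw [Finset.prod_ne_zero_iff]
  intro j hj
  rw [one_mul, one_mul, sub_ne_zero]
  intro hc
  exact (Finset.mem_Ioi.1 hj).ne (MvPolynomial.X_injective hc)

/-- It divides the alternant of the empty partition, which is a nonzero Vandermonde determinant.
Hence it can be cancelled. -/
theorem det_elemMatrix_ne_zero (M : ℕ) : (elemMatrix M).det ≠ 0 := by
  intro h
  have h1 := alternant_eq (M := M) (lam := ⊥) (by
    by_contra hc
    have : (0, 0) ∈ (⊥ : YoungDiagram) := YoungDiagram.mem_iff_lt_colLen.2 (by omega)
    exact YoungDiagram.notMem_bot _ this)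
  rw [h, mul_zero] at h1
  exact alternant_bot_ne_zero M h1

end RibbonFock

namespace RibbonFock
open scoped Polynomial

/-! ## Bead configurations as wedge products -/

section
variable {S W : Type} [CommRing S] [AddCommGroup W] [Module S W]

/-- The wedge product of the vectors `φ b` at the beads `b` with `a ≤ b < a + k`, in decreasing
order. -/
noncomputable def wedge (S : Type) [CommRing S] {W : Type} [AddCommGroup W] [Module S W]
    (φ : ℤ → W) (s : ℤ → Bool) (a : ℤ) : ℕ → ExteriorAlgebra S W
  | 0 => 1
  | k + 1 => (if s (a + k) then ExteriorAlgebra.ι S (φ (a + k)) else 1) * wedge S φ s a k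

theorem wedge_congr {φ φ' : ℤ → W} {s s' : ℤ → Bool} {a : ℤ} {k : ℕ}
    (h : ∀ b, a ≤ b → b < a + k → s b = s' b ∧ φ b = φ' b) :
    wedge S φ s a k = wedge S φ' s' a k := by
  induction k with
  | zero => rfl
  | succ k ih =>
    have h1 := h (a + k) (by omega) (by push_cast; omega)
    rw [wedge, wedge, h1.1, h1.2, ih fun b hb hb' => h b hb (by push_cast; omega)]

theorem wedge_add (φ : ℤ → W) (s : ℤ → Bool) (a : ℤ) (k l : ℕ) :
    wedge S φ s a (k + l) = wedge S φ s (a + k) l * wedge S φ s a k := by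
  induction l with
  | zero => rw [add_zero, wedge, one_mul]
  | succ l ih =>
    rw [← add_assoc, wedge, ih, wedge, mul_assoc]
    push_cast
    rw [add_assoc]

/-- Passing a vector across each bead costs a sign; for the beads between `p` and `p + n` this is
the weight of a jump at `q = 1`. -/
theorem wedge_mul_ι (φ : ℤ → W) (s : ℤ → Bool) (a : ℤ) (k : ℕ) (v : W) :
    wedge S φ s a k * ExteriorAlgebra.ι S v = (∏ m ∈ Finset.Ico a (a + k), if s m then (-1 : ℤ) else 1) •
      (ExteriorAlgebra.ι S v * wedge S φ s a k) := by
  induction k with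
  | zero => simp [wedge]
  | succ k ih =>
    have e : Finset.Ico a (a + ((k + 1 : ℕ) : ℤ)) = insert (a + k) (Finset.Ico a (a + k)) := by
      ext; simp; omega
    rw [e, Finset.prod_insert (by simp), wedge, mul_assoc, ih, mul_smul_comm]
    cases s (a + k)
    · simp
    · have h := ExteriorAlgebra.ι_add_mul_swap (R := S) (φ (a + k)) v
      rw [if_pos rfl, if_pos rfl, ← mul_assoc, eq_neg_of_add_eq_zero_left h, neg_mul, smul_neg,
        mul_smul, neg_one_smul, mul_assoc]

theorem prod_beadWeight_one (n : ℕ) (p : ℤ) (s : ℤ → Bool) :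
    ∏ m ∈ Finset.Ioo p (p + n), beadWeight (1 : ℚ) m s =
      ((∏ m ∈ Finset.Ioo p (p + n), if s m then (-1 : ℤ) else 1 : ℤ) : ℚ) := by
  rw [Int.cast_prod]
  refine Finset.prod_congr rfl fun m _ => ?_
  unfold beadWeight
  split_ifs <;> norm_num

theorem wedge_split {n k₁ k₂ : ℕ} (hn : 1 ≤ n) (φ : ℤ → W) (s : ℤ → Bool) (L : ℤ) :
    wedge S φ s L (k₁ + n + 1 + k₂) = wedge S φ s (L + k₁ + n + 1) k₂ *
      ((if s (L + k₁ + n) then ExteriorAlgebra.ι S (φ (L + k₁ + n)) else 1) *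
        (wedge S φ s (L + k₁ + 1) (n - 1) *
          ((if s (L + k₁) then ExteriorAlgebra.ι S (φ (L + k₁)) else 1) * wedge S φ s L k₁))) := by
  have e : k₁ + n = k₁ + 1 + (n - 1) := by omega
  rw [wedge_add, wedge, e, wedge_add, wedge, ← e]
  push_cast
  simp only [add_assoc]

variable [Algebra ℚ S]

/-- The linear map on bead configurations induced by a linear map on the exterior algebra. -/
noncomputable def wedgeMap (F : ExteriorAlgebra S W →ₗ[S] S) (φ : ℤ → W) (L : ℤ) (w : ℕ) :
    BeadSpace ℚ →ₗ[ℚ] S :=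
  Finsupp.linearCombination ℚ fun s => F (wedge S φ s L w)

theorem wedgeMap_single (F : ExteriorAlgebra S W →ₗ[S] S) (φ : ℤ → W) (L : ℤ) (w : ℕ)
    (s : ℤ → Bool) (c : ℚ) :
    wedgeMap F φ L w (Finsupp.single s c) = c • F (wedge S φ s L w) := by
  rw [wedgeMap, Finsupp.linearCombination_single]

/-- The effect of a jump on wedge products. -/
theorem wedgeMap_jump {n : ℕ} (hn : 1 ≤ n) (F : ExteriorAlgebra S W →ₗ[S] S) (φ : ℤ → W) {L p : ℤ}
    {w : ℕ} (hp : L ≤ p) (hpw : p + n < L + w) (z : S) (v : BeadSpace ℚ) :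
    wedgeMap F φ L w v + z * wedgeMap F φ L w (opJump n (1 : ℚ) p v) =
      wedgeMap F (Function.update φ p (φ p + z • φ (p + n))) L w v := by
  obtain ⟨k₁, rfl⟩ := Int.le.dest hp
  obtain ⟨k₂, rfl⟩ : ∃ k₂, w = k₁ + n + 1 + k₂ := ⟨w - (k₁ + n + 1), by omega⟩
  induction v using Finsupp.induction_linear with
  | zero => simp
  | add f g hf hg =>
    rw [map_add, map_add, map_add, map_add, ← hf, ← hg]
    ring
  | single s c =>
    set φ' := Function.update φ (L + k₁) (φ (L + k₁) + z • φ (L + k₁ + n)) with hφ'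
    have hne : ∀ b, b ≠ L + k₁ → φ' b = φ b := fun b hb => Function.update_of_ne hb _ _
    have hA : wedge S φ' s (L + k₁ + n + 1) k₂ = wedge S φ s (L + k₁ + n + 1) k₂ :=
      wedge_congr fun b hb _ => ⟨rfl, hne b (by omega)⟩
    have hB : wedge S φ' s (L + k₁ + 1) (n - 1) = wedge S φ s (L + k₁ + 1) (n - 1) :=
      wedge_congr fun b hb _ => ⟨rfl, hne b (by omega)⟩
    have hC : wedge S φ' s L k₁ = wedge S φ s L k₁ :=
      wedge_congr fun b _ hb => ⟨rfl, hne b (by omega)⟩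
    have hn1 : φ' (L + k₁ + n) = φ (L + k₁ + n) := hne _ (by omega)
    have hp1 : φ' (L + k₁) = φ (L + k₁) + z • φ (L + k₁ + n) := Function.update_self _ _ _
    have hswap := wedge_mul_ι (S := S) φ s (L + k₁ + 1) (n - 1) (φ (L + k₁ + n))
    have hI : Finset.Ico (L + k₁ + 1) (L + k₁ + 1 + ((n - 1 : ℕ) : ℤ)) =
        Finset.Ioo (L + k₁) (L + k₁ + n) := by
      ext; simp; omega
    rw [hI] at hswap
    have hJ : opJump n (1 : ℚ) (L + k₁) (Finsupp.single s c) =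
        if s (L + k₁) = true ∧ s (L + k₁ + n) = false then
          Finsupp.single (moveBead s (L + k₁) (L + k₁ + n)) (((∏ m ∈ Finset.Ioo (L + k₁) (L + k₁ + n),
            if s m then (-1 : ℤ) else 1 : ℤ) : ℚ) * c) else 0 := by
      rw [opJump, Module.End.mul_apply, opDiag_single, opMove_single, prod_beadWeight_one]
    rw [wedgeMap_single, wedgeMap_single, wedge_split hn, wedge_split hn φ', hA, hB, hC, hn1, hp1]
    -- Without a bead at `p` neither side changes. With beads at `p` and `p + n` the additional term
    -- contains `φ (p + n)` twice and vanishes. With a bead at `p` only, it is the wedge product of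
    -- the moved configuration after reordering.
    rcases Bool.eq_false_or_eq_true (s (L + k₁)) with h1 | h1
    · rcases Bool.eq_false_or_eq_true (s (L + k₁ + n)) with h2 | h2
      · rw [hJ.trans (if_neg (by simp [h2])), map_zero, mul_zero, add_zero]
        simp only [h1, h2, if_true]
        congr 2
        have hzero : ExteriorAlgebra.ι S (φ (L + k₁ + n)) * (wedge S φ s (L + k₁ + 1) (n - 1) *
            (ExteriorAlgebra.ι S (φ (L + k₁ + n)) * wedge S φ s L k₁)) = 0 := by
          rw [← mul_assoc (wedge S φ s (L + k₁ + 1) (n - 1)), hswap, smul_mul_assoc, mul_smul_comm,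
            ← mul_assoc, ← mul_assoc, ExteriorAlgebra.ι_sq_zero, zero_mul, zero_mul, smul_zero]
        rw [map_add, map_smul, add_mul, mul_add, mul_add, mul_add, smul_mul_assoc]
        simp only [mul_smul_comm, hzero, smul_zero, mul_zero, add_zero]
      · have m1 : moveBead s (L + k₁) (L + k₁ + n) (L + k₁) = false := by
          rw [moveBead_apply, if_neg (by omega), if_pos rfl]
        have m2 : moveBead s (L + k₁) (L + k₁ + n) (L + k₁ + n) = true := by
          rw [moveBead_apply, if_pos rfl]
        have m3 : ∀ b, b ≠ L + k₁ → b ≠ L + k₁ + n →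
            moveBead s (L + k₁) (L + k₁ + n) b = s b := by
          intro b hb hb'
          rw [moveBead_apply, if_neg hb', if_neg hb]
        rw [hJ.trans (if_pos ⟨h1, h2⟩), wedgeMap_single, wedge_split hn, m1, m2,
          wedge_congr (S := S) (a := L + k₁ + n + 1) (fun b hb _ => ⟨m3 b (by omega) (by omega), rfl⟩),
          wedge_congr (S := S) (a := L + k₁ + 1) (fun b hb _ => ⟨m3 b (by omega) (by omega), rfl⟩),
          wedge_congr (S := S) (a := L) (fun b _ hb => ⟨m3 b (by omega) (by omega), rfl⟩)]
        simp only [h1, h2, if_true, Bool.false_eq_true, if_false, one_mul]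
        rw [map_add, map_smul, add_mul, mul_add, mul_add, map_add, smul_add]
        congr 1
        have hBC : wedge S φ s (L + k₁ + 1) (n - 1) *
            (ExteriorAlgebra.ι S (φ (L + k₁ + n)) * wedge S φ s L k₁) =
            (∏ m ∈ Finset.Ioo (L + k₁) (L + k₁ + n), if s m then (-1 : ℤ) else 1) •
              (ExteriorAlgebra.ι S (φ (L + k₁ + n)) * (wedge S φ s (L + k₁ + 1) (n - 1) *
                wedge S φ s L k₁)) := by
          rw [← mul_assoc, hswap, smul_mul_assoc, mul_assoc]
        rw [smul_mul_assoc, mul_smul_comm, mul_smul_comm, hBC, mul_smul_comm, map_smul, mul_smul_comm,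
          map_zsmul, mul_smul, Int.cast_smul_eq_zsmul, smul_eq_mul, mul_smul_comm, smul_comm]
    · rw [hJ.trans (if_neg (by simp [h1])), map_zero, mul_zero, add_zero]
      simp only [h1, Bool.false_eq_true, if_false]

/-- The value of `wedgeMap F φ L w` on a polynomial in operators, applied to `v`, at `z`. -/
noncomputable def wedgeSum (F : ExteriorAlgebra S W →ₗ[S] S) (φ : ℤ → W) (L : ℤ) (w : ℕ) (z : S)
    (v : BeadSpace ℚ) (P : (Module.End ℚ (BeadSpace ℚ))[X]) : S :=
  P.sum fun j a => z ^ j * wedgeMap F φ L w (a v)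

theorem wedgeSum_add (F : ExteriorAlgebra S W →ₗ[S] S) (φ : ℤ → W) (L : ℤ) (w : ℕ) (z : S)
    (v : BeadSpace ℚ) (P Q : (Module.End ℚ (BeadSpace ℚ))[X]) :
    wedgeSum F φ L w z v (P + Q) = wedgeSum F φ L w z v P + wedgeSum F φ L w z v Q :=
  Polynomial.sum_add_index _ _ _ (fun _ => by simp) fun _ _ _ => by
    rw [LinearMap.add_apply, map_add, mul_add]

theorem wedgeSum_monomial (F : ExteriorAlgebra S W →ₗ[S] S) (φ : ℤ → W) (L : ℤ) (w : ℕ) (z : S)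
    (v : BeadSpace ℚ) (j : ℕ) (a : Module.End ℚ (BeadSpace ℚ)) :
    wedgeSum F φ L w z v (Polynomial.monomial j a) = z ^ j * wedgeMap F φ L w (a v) :=
  Polynomial.sum_monomial_index _ _ (by simp)

theorem wedgeSum_jump {n : ℕ} (hn : 1 ≤ n) (F : ExteriorAlgebra S W →ₗ[S] S) (φ : ℤ → W) {L p : ℤ}
    {w : ℕ} (hp : L ≤ p) (hpw : p + n < L + w) (z : S) (v : BeadSpace ℚ)
    (P : (Module.End ℚ (BeadSpace ℚ))[X]) :
    wedgeSum F φ L w z v ((1 + Polynomial.C (opJump n (1 : ℚ) p) * Polynomial.X) * P) =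
      wedgeSum F (Function.update φ p (φ p + z • φ (p + n))) L w z v P := by
  induction P using Polynomial.induction_on' with
  | add P Q hP hQ => rw [mul_add, wedgeSum_add, hP, hQ, wedgeSum_add]
  | monomial j a =>
    rw [add_mul, one_mul, mul_assoc, Polynomial.X_mul_monomial, Polynomial.C_mul_monomial,
      wedgeSum_add, wedgeSum_monomial, wedgeSum_monomial, wedgeSum_monomial,
      ← wedgeMap_jump hn F φ hp hpw, Module.End.mul_apply, pow_succ]
    ring

/-- The leftmost factor has the largest position `p`, where `φ (p + n)` is already `ψ (p + n)`. Its
effect is therefore to turn `ψ p - z ψ (p + n)` into `ψ p`, after which the next factor is in the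
same situation. -/
theorem wedgeSum_jumpPoly {n : ℕ} (hn : 1 ≤ n) (F : ExteriorAlgebra S W →ₗ[S] S) (ψ : ℤ → W) (L : ℤ)
    {m w : ℕ} (hw : m + n ≤ w) (z : S) (v : BeadSpace ℚ) :
    wedgeSum F (fun b => if b < L + m then ψ b - z • ψ (b + n) else ψ b) L w z v
      (jumpPoly n (1 : ℚ) L m) = wedgeMap F (fun b => if b < L then ψ b - z • ψ (b + n) else ψ b) L w v := by
  induction m with
  | zero =>
    have : (jumpPoly n (1 : ℚ) L 0) = Polynomial.monomial 0 (1 : Module.End ℚ (BeadSpace ℚ)) := rfl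
    rw [this, wedgeSum_monomial]
    simp
  | succ m ih =>
    rw [jumpPoly, wedgeSum_jump hn F _ (by omega) (by omega), ← ih (by omega)]
    congr 1
    funext b
    by_cases h : b = L + m
    · subst h
      rw [Function.update_self, if_pos (by push_cast; omega), if_neg (by push_cast; omega),
        if_neg (by omega), sub_add_cancel]
    · rw [Function.update_of_ne h]
      have : b < L + ((m + 1 : ℕ) : ℤ) ↔ b < L + m := by push_cast; omega
      simp only [this]

end

/-! ## The wedge product of a partition -/

/-- The vertical step of the boundary at a bead is the end of a row, the one with index `prof lam
d`. This links beads to the exponents in alternants. -/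
theorem rowLen_prof {lam : YoungDiagram} {d : ℤ} (h : bead lam d = true) :
    (lam.rowLen (prof lam d).toNat : ℤ) - prof lam d = d := by
  have h1 := prof_pred lam d
  rw [if_pos h] at h1
  have h2 := prof_nonneg lam d
  have h3 := neg_le_prof lam d
  have h4 : ¬ (prof lam d).toNat < 0 := by omega
  have h5 : ((prof lam d).toNat, (prof lam d + d).toNat) ∉ lam := by
    rw [mem_iff_lt_prof' lam h2 (by omega), add_sub_cancel_left]
    omega
  rw [YoungDiagram.mem_iff_lt_rowLen] at h5
  by_cases h6 : prof lam d + d = 0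
  · have h8 := neg_le_prof lam (d - 1)
    by_contra hc
    have h9 : ((prof lam d).toNat, (prof lam d + d).toNat) ∈ lam → False := fun hm =>
      h5 (YoungDiagram.mem_iff_lt_rowLen.1 hm)
    omega
  · have h7 : ((prof lam d).toNat, (prof lam d + d - 1).toNat) ∈ lam := by
      rw [mem_iff_lt_prof' lam h2 (by omega)]
      have e : prof lam d + d - 1 - prof lam d = d - 1 := by ring
      rw [e]
      omega
    rw [YoungDiagram.mem_iff_lt_rowLen] at h7
    omega

end RibbonFock

/-! ### Evaluation at `q = 1` by alternants -/

namespace RibbonFock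
open scoped Polynomial

/-- The linear form on the exterior algebra of `S^M` given by the determinant in degree `M`. -/
noncomputable def detForm (M : ℕ) (S : Type) [CommRing S] :
    ExteriorAlgebra S (Fin M → S) →ₗ[S] S :=
  ExteriorAlgebra.liftAlternating (Pi.single M Matrix.detRowAlternating)

/-- The wedge product of a partition is that of its rows. -/
theorem wedge_bead {S W : Type} [CommRing S] [AddCommGroup W] [Module S W] {M : ℕ}
    {mu : YoungDiagram} (hM : mu.card ≤ M) (φ : ℤ → W) (t : ℕ) :
    wedge S φ (bead mu) (1 - M) t = ((List.ofFn fun i : Fin M =>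
      ExteriorAlgebra.ι S (φ ((mu.rowLen i : ℤ) - i))).drop (prof mu (t - M)).toNat).prod := by
  induction t with
  | zero =>
    rw [wedge, prof_of_le_neg_card (by push_cast; omega), List.drop_eq_nil_of_le, List.prod_nil]
    rw [List.length_ofFn]
    omega
  | succ t ih =>
    have e : (1 - M + t : ℤ) = ((t + 1 : ℕ) : ℤ) - M := by push_cast; ring
    have h := prof_pred mu (((t + 1 : ℕ) : ℤ) - M)
    have e2 : ((t + 1 : ℕ) : ℤ) - M - 1 = t - M := by push_cast; ring
    have h0 := prof_nonneg mu (((t + 1 : ℕ) : ℤ) - M)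
    rw [wedge, ih, e]
    rw [e2] at h
    by_cases hb : bead mu (((t + 1 : ℕ) : ℤ) - M) = true
    · have h1 := prof_anti mu (show (-M : ℤ) ≤ t - M by omega)
      rw [prof_of_le_neg_card (show (-M : ℤ) ≤ -(mu.card : ℤ) by omega), neg_neg] at h1
      have h2 := rowLen_prof hb
      rw [if_pos hb] at h
      have hlt : (prof mu (((t + 1 : ℕ) : ℤ) - M)).toNat < M := by omega
      have e3 : (prof mu (t - M)).toNat = (prof mu (((t + 1 : ℕ) : ℤ) - M)).toNat + 1 := by omega
      rw [if_pos hb, e3, List.drop_eq_getElem_cons (i := (prof mu (((t + 1 : ℕ) : ℤ) - M)).toNat) (by rw [List.length_ofFn]; exact hlt),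
        List.prod_cons, List.getElem_ofFn]
      congr 3
      dsimp only
      rw [Int.toNat_of_nonneg h0, h2]
    · rw [if_neg hb] at h ⊢
      rw [one_mul, h, add_zero]

theorem detForm_wedge {M : ℕ} {S : Type} [CommRing S] {mu : YoungDiagram} (hM : mu.card ≤ M)
    (φ : ℤ → Fin M → S) {t : ℕ} (ht : mu.card + M ≤ t) :
    detForm M S (wedge S φ (bead mu) (1 - M) t) =
      Matrix.det (Matrix.of fun i : Fin M => φ ((mu.rowLen i : ℤ) - i)) := by
  rw [wedge_bead hM, prof_of_card_le (by omega), Int.toNat_zero, List.drop_zero,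
    ← ExteriorAlgebra.ιMulti_apply, detForm, ExteriorAlgebra.liftAlternating_apply_ιMulti,
    Pi.single_eq_same]
  rfl

/-- The vectors of powers of the variables. -/
noncomputable def powerVector (M : ℕ) (b : ℤ) (k : Fin M) : (MvPolynomial (Fin M) ℚ)[X] :=
  Polynomial.C (MvPolynomial.X k ^ (b + M - 1).toNat)

theorem det_powerVector (M : ℕ) (mu : YoungDiagram) :
    Matrix.det (Matrix.of fun i : Fin M => powerVector M ((mu.rowLen i : ℤ) - i)) =
      Polynomial.C (alternant M mu) := by
  rw [alternant, RingHom.map_det]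
  congr 1
  ext1 i k
  have := i.isLt
  have e : ((mu.rowLen i : ℤ) - i + M - 1).toNat = mu.rowLen i + (M - 1 - i) := by omega
  simp [powerVector, e]

/-- Raising the position by `n` multiplies the entry of column `k` by `x_k^n`, so a factor `1 -
x_k^n X` can be taken out of each column. -/
theorem det_powerVector_sub (M n : ℕ) (mu : YoungDiagram) :
    Matrix.det (Matrix.of fun i : Fin M => powerVector M ((mu.rowLen i : ℤ) - i) -
        (Polynomial.X : (MvPolynomial (Fin M) ℚ)[X]) • powerVector M ((mu.rowLen i : ℤ) - i + n)) =
      (∏ k, (1 - Polynomial.C (MvPolynomial.X k ^ n) * Polynomial.X)) *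
        Polynomial.C (alternant M mu) := by
  rw [← det_powerVector, ← Matrix.det_mul_row]
  congr 1
  ext1 i k
  have := i.isLt
  have e : ((mu.rowLen i : ℤ) - i + n + M - 1).toNat =
      n + ((mu.rowLen i : ℤ) - i + M - 1).toNat := by omega
  simp only [Matrix.of_apply, Pi.sub_apply, Pi.smul_apply, smul_eq_mul, powerVector, e, pow_add,
    map_mul]
  ring

theorem rowLen_le_card (mu : YoungDiagram) (i : ℕ) : mu.rowLen i ≤ mu.card := by
  by_contra h
  have h1 : (i, mu.card) ∈ mu := YoungDiagram.mem_iff_lt_rowLen.2 (by omega)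
  exact (lt_card_of_mem h1).2.false

theorem colLen_le_card (mu : YoungDiagram) (j : ℕ) : mu.colLen j ≤ mu.card := by
  by_contra h
  have h1 : (mu.card, j) ∈ mu := YoungDiagram.mem_iff_lt_colLen.2 (by omega)
  exact (lt_card_of_mem h1).1.false

/-- Multiplying by `H` recovers `A` from `E A`, and its `k`-th coefficient involves only
coefficients up to `k`. The truncated form is needed because, for a fixed number of variables, only
the first `V_j` are under control. -/
theorem eq_coeff_mul_of_mul_eq_one {R : Type} [CommRing R] {H E : PowerSeries R} (hHE : H * E = 1)
    {A : ℕ → R} {c : R} {k : ℕ}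
    (h : ∀ i ≤ k, PowerSeries.coeff i (E * PowerSeries.mk A) = if i = 0 then c else 0) :
    A k = PowerSeries.coeff k H * c := by
  have h1 : PowerSeries.mk A = (E * PowerSeries.mk A) * H := by
    linear_combination (-PowerSeries.mk A) * hHE
  have h2 := congrArg (PowerSeries.coeff k) h1
  rw [PowerSeries.coeff_mk, PowerSeries.coeff_mul,
    Finset.Nat.sum_antidiagonal_eq_sum_range_succ_mk, Finset.sum_eq_single 0] at h2
  · rw [h2, h 0 (Nat.zero_le k), if_pos rfl, Nat.sub_zero, mul_comm]
  · intro i hi h0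
    rw [h i (Nat.lt_succ_iff.1 (Finset.mem_range.1 hi)), if_neg h0, zero_mul]
  · simp

theorem mk_expand_hsymm_mul (M n : ℕ) :
    PowerSeries.mk (fun d => MvPolynomial.expand n (MvPolynomial.hsymm (Fin M) ℚ d)) *
      ((∏ k, (1 - Polynomial.C (MvPolynomial.X k ^ n) * Polynomial.X) :
        (MvPolynomial (Fin M) ℚ)[X]) : PowerSeries (MvPolynomial (Fin M) ℚ)) = 1 := by
  have h := mk_map_hsymm_mul (σ := Fin M)
    ((MvPolynomial.expand n : MvPolynomial (Fin M) ℚ →ₐ[ℚ] MvPolynomial (Fin M) ℚ) :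
      MvPolynomial (Fin M) ℚ →+* MvPolynomial (Fin M) ℚ)
  simp only [RingHom.coe_coe, MvPolynomial.expand_X] at h
  rw [← Polynomial.coeToPowerSeries.ringHom_apply, map_prod]
  simp only [map_sub, map_one, map_mul, Polynomial.coeToPowerSeries.ringHom_apply,
    Polynomial.coe_C, Polynomial.coe_X]
  exact h

/-- The alternants of the terms of `V_k s_lam` at `q = 1`. -/
theorem sum_stripSum_smul_alternant {n : ℕ} (hn : 1 ≤ n) (k : ℕ) {lam : YoungDiagram} {M : ℕ}
    (hM : lam.card + n * k + n ≤ M) :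
    ∑ mu ∈ diagramsOfSize (lam.card + n * k), stripSum n (1 : ℚ) k lam mu • alternant M mu =
      MvPolynomial.expand n (MvPolynomial.hsymm (Fin M) ℚ k) * alternant M lam := by
  set S := (MvPolynomial (Fin M) ℚ)[X]
  set E : S := ∏ k, (1 - Polynomial.C (MvPolynomial.X k ^ n) * Polynomial.X) with hE
  set A : ℕ → MvPolynomial (Fin M) ℚ := fun j =>
    ∑ mu ∈ diagramsOfSize (lam.card + n * j), stripSum n (1 : ℚ) j lam mu • alternant M mu with hA
  have hHE := mk_expand_hsymm_mul M n
  rw [← hE] at hHE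
  have key := eq_coeff_mul_of_mul_eq_one hHE (A := A) (c := alternant M lam) (k := k) ?_
  · rwa [PowerSeries.coeff_mk] at key
  intro i hi
  -- The jumps start at `1 - M`, and `m` is large enough that `1 - M + m` exceeds all beads of
  -- partitions of size at most `|lam| + n k`; so all their vectors are of the modified form.
  set m := M + lam.card + n * k + 1 with hm
  set φ : ℤ → Fin M → S := fun b => if b < (1 - M : ℤ) + m then
    powerVector M b - (Polynomial.X : S) • powerVector M (b + n) else powerVector M b with hφ
  have hjump := wedgeSum_jumpPoly (m := m) (w := m + n) hn (detForm M S) (powerVector M) (1 - M)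
    le_rfl (Polynomial.X : S) (Finsupp.single (bead lam) 1)
  have hR : wedgeMap (detForm M S) (fun b => if b < (1 - M : ℤ) then
      powerVector M b - (Polynomial.X : S) • powerVector M (b + n) else powerVector M b) (1 - M)
      (m + n) (Finsupp.single (bead lam) 1) = Polynomial.C (alternant M lam) := by
    rw [wedgeMap_single, one_smul, wedge_congr (φ' := powerVector M) (s' := bead lam)
      (fun b hb _ => ⟨rfl, if_neg (by omega)⟩), detForm_wedge (by omega) _ (by omega),
      det_powerVector]
  -- For `j ≤ k` the partitions have at most `M` cells, hence exactly `M` beads in the range, and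
  -- the determinant form gives their alternants.
  have hterm : ∀ j ≤ k, wedgeMap (detForm M S) φ (1 - M) (m + n)
      ((jumpPoly n (1 : ℚ) (1 - M) m).coeff j (Finsupp.single (bead lam) 1)) =
        E * Polynomial.C (A j) := by
    intro j hj
    have hnj : n * j ≤ n * k := Nat.mul_le_mul_left n hj
    rw [V_single_eq_jumpPoly hn one_ne_zero j (by omega) (by push_cast at *; omega),
      V_single one_ne_zero, map_sum, map_sum, hA, map_sum, Finset.mul_sum]
    refine Finset.sum_congr rfl fun mu hmu => ?_
    rw [mem_diagramsOfSize] at hmu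
    rw [toBeads_single, wedgeMap_single, detForm_wedge (by omega) _ (by omega)]
    have h1 : (Matrix.of fun i : Fin M => φ ((mu.rowLen i : ℤ) - i)) =
        Matrix.of fun i : Fin M => powerVector M ((mu.rowLen i : ℤ) - i) -
          (Polynomial.X : S) • powerVector M ((mu.rowLen i : ℤ) - i + n) := by
      refine congrArg _ (funext fun i => if_pos ?_)
      have := rowLen_le_card mu i
      omega
    rw [h1, det_powerVector_sub, ← hE, ← Polynomial.smul_C, mul_smul_comm]
  rw [hR, wedgeSum, Polynomial.sum_over_range' _ (by simp)
    (max ((jumpPoly n (1 : ℚ) (1 - M) m).natDegree + 1) (k + 1)) (by omega)] at hjump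
  have hc := congrArg (fun p : S => p.coeff i) hjump
  rw [Polynomial.finsetSum_coeff, Polynomial.coeff_C] at hc
  rw [← hc, mul_comm, PowerSeries.coeff_mul, Finset.Nat.sum_antidiagonal_eq_sum_range_succ_mk]
  -- In the coefficient of `X^i` the factor `X^j` removes all terms with `j > i`, so the
  -- uncontrolled large `j` do not matter.
  refine (Finset.sum_congr rfl fun j hj => ?_).trans
    (Finset.sum_subset (Finset.range_mono (show i + 1 ≤ _ by omega)) ?_)
  · have hji := Nat.lt_succ_iff.1 (Finset.mem_range.1 hj)
    rw [Polynomial.coeff_X_pow_mul', if_pos hji, hterm j (hji.trans hi), Polynomial.coeff_mul_C,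
      PowerSeries.coeff_mk, Polynomial.coeff_coe, mul_comm]
  · intro j _ hj
    rw [Polynomial.coeff_X_pow_mul', if_neg (by simpa [Nat.lt_succ_iff] using hj)]

theorem toSym_V_single_of_le {n : ℕ} (hn : 1 ≤ n) (k : ℕ) {lam : YoungDiagram} {M : ℕ}
    (hM : lam.card + n * k + n ≤ M) :
    toSym M (V n (1 : ℚ) k (Finsupp.single lam 1)) =
      MvPolynomial.expand n (MvPolynomial.hsymm (Fin M) ℚ k) * toSym M (Finsupp.single lam 1) := by
  have h := sum_stripSum_smul_alternant hn k hM
  have hc := colLen_le_card lam 0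
  rw [alternant_eq (by omega), ← mul_assoc] at h
  refine mul_right_cancel₀ (det_elemMatrix_ne_zero M) ?_
  rw [V_single one_ne_zero, map_sum, Finset.sum_mul, toSym, Finsupp.linearCombination_single,
    one_smul, ← h]
  refine Finset.sum_congr rfl fun mu hmu => ?_
  rw [mem_diagramsOfSize] at hmu
  have := colLen_le_card mu 0
  rw [Finsupp.linearCombination_single, alternant_eq (by omega), smul_mul_assoc]

/-- The specialization of the last `c` variables to zero. -/
noncomputable def restrictVars (N c : ℕ) : MvPolynomial (Fin (N + c)) ℚ →ₐ[ℚ] MvPolynomial (Fin N) ℚ :=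
  MvPolynomial.aeval (Fin.addCases MvPolynomial.X fun _ => 0)

theorem restrictVars_hsymm (N c d : ℕ) : restrictVars N c (MvPolynomial.hsymm (Fin (N + c)) ℚ d) =
    MvPolynomial.hsymm (Fin N) ℚ d := by
  have h1 := mk_map_hsymm_mul (σ := Fin (N + c)) (restrictVars N c).toRingHom
  have h2 : ∏ i, (1 - PowerSeries.C ((restrictVars N c).toRingHom (MvPolynomial.X i)) *
      PowerSeries.X) = ∏ i : Fin N, (1 - PowerSeries.C (MvPolynomial.X i : MvPolynomial (Fin N) ℚ) *
        PowerSeries.X) := by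
    rw [Fin.prod_univ_add]
    simp [restrictVars]
  rw [h2] at h1
  have h3 := left_inv_eq_right_inv h1 ((mul_comm _ _).trans (mk_hsymm_mul (σ := Fin N)))
  have h4 := congrArg (PowerSeries.coeff d) h3
  rwa [PowerSeries.coeff_mk, PowerSeries.coeff_mk] at h4

theorem restrictVars_schur (N c : ℕ) (lam : YoungDiagram) :
    restrictVars N c (schur (N + c) lam) = schur N lam := by
  rw [schur, AlgHom.map_det, schur]
  congr 1
  ext1 i j
  rw [AlgHom.mapMatrix_apply, Matrix.map_apply, Matrix.of_apply, Matrix.of_apply, apply_ite (restrictVars N c),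
    restrictVars_hsymm, map_zero]

theorem restrictVars_toSym (N c : ℕ) (f : Fock ℚ) :
    restrictVars N c (toSym (N + c) f) = toSym N f := by
  rw [toSym, toSym, Finsupp.linearCombination_apply, Finsupp.linearCombination_apply, map_finsuppSum]
  simp only [map_smul, restrictVars_schur]

theorem restrictVars_expand {n : ℕ} (hn : 1 ≤ n) (N c : ℕ) (p : MvPolynomial (Fin (N + c)) ℚ) :
    restrictVars N c (MvPolynomial.expand n p) = MvPolynomial.expand n (restrictVars N c p) := by
  have h : (restrictVars N c).comp (MvPolynomial.expand n) =
      (MvPolynomial.expand n).comp (restrictVars N c) := by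
    refine MvPolynomial.algHom_ext fun i => ?_
    refine Fin.addCases (fun i => ?_) (fun i => ?_) i
    · simp [restrictVars]
    · simp [restrictVars, Nat.ne_of_gt hn]
  exact DFunLike.congr_fun h p

/-- At `q = 1`, the operator `V_k` is the multiplication by `h_k(x_1^n, x_2^n, …)`. -/
theorem toSym_V {n : ℕ} (hn : 1 ≤ n) (k N : ℕ) (f : Fock ℚ) :
    toSym N (V n (1 : ℚ) k f) =
      MvPolynomial.expand n (MvPolynomial.hsymm (Fin N) ℚ k) * toSym N f := by
  induction f using Finsupp.induction_linear with
  | zero => simp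
  | add f g hf hg => rw [map_add, map_add, map_add, hf, hg, mul_add]
  | single lam a =>
    have e : Finsupp.single lam a = a • Finsupp.single lam (1 : ℚ) := by simp
    -- The identity is known for sufficiently many variables; setting the additional ones to zero
    -- yields it for `N` variables.
    have h := toSym_V_single_of_le hn k (lam := lam) (M := N + (lam.card + n * k + n)) (by omega)
    have h1 := congrArg (restrictVars N _) h
    rw [map_mul, restrictVars_toSym, restrictVars_toSym, restrictVars_expand hn,
      restrictVars_hsymm] at h1
    rw [e, map_smul, map_smul, map_smul, h1, mul_smul_comm]

end RibbonFock

theorem mainTheorem5 (n : ℕ) (hn : 2 ≤ n) :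
    -- Hayashi's formulas define an action of the quantum affine algebra
    (∃ rho : RibbonFock.Uq n (RatFunc.X : RatFunc ℚ) →ₐ[RatFunc ℚ]
        Module.End (RatFunc ℚ) (RibbonFock.Fock (RatFunc ℚ)),
      RibbonFock.IsHayashiAction n RatFunc.X rho) ∧
    (∀ rho : RibbonFock.Uq n (RatFunc.X : RatFunc ℚ) →ₐ[RatFunc ℚ]
        Module.End (RatFunc ℚ) (RibbonFock.Fock (RatFunc ℚ)),
      RibbonFock.IsHayashiAction n RatFunc.X rho →
      -- `V_k` and `U_k` commute with it; they have degree `k` and `-k` with respect to `D`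
      (∀ k : ℕ, 1 ≤ k →
        (∀ x ∈ RibbonFock.UqDerived n (RatFunc.X : RatFunc ℚ),
          Commute (RibbonFock.V n RatFunc.X k) (rho x) ∧
          Commute (RibbonFock.U n RatFunc.X k) (rho x)) ∧
        rho (RibbonFock.gen n RatFunc.X (.t (RibbonFock.scaling n))) *
            RibbonFock.V n RatFunc.X k =
          ((RatFunc.X : RatFunc ℚ) ^ (-(k : ℤ))) • (RibbonFock.V n RatFunc.X k *
            rho (RibbonFock.gen n RatFunc.X (.t (RibbonFock.scaling n)))) ∧
        rho (RibbonFock.gen n RatFunc.X (.t (RibbonFock.scaling n))) *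
            RibbonFock.U n RatFunc.X k =
          ((RatFunc.X : RatFunc ℚ) ^ (k : ℤ)) • (RibbonFock.U n RatFunc.X k *
            rho (RibbonFock.gen n RatFunc.X (.t (RibbonFock.scaling n))))) ∧
      -- the vectors `ψ^n_q(h_μ)` are highest weight vectors
      (∀ mu : List ℕ, (∀ m ∈ mu, 1 ≤ m) →
        RibbonFock.psiH n (RatFunc.X : RatFunc ℚ) mu =
          mu.foldl (fun v k => RibbonFock.V n RatFunc.X k v) (Finsupp.single ⊥ 1) ∧
        RibbonFock.IsHighestWeightVector n RatFunc.X rho (RibbonFock.psiH n RatFunc.X mu))) ∧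
    -- `U_k` is the adjoint of `V_k`
    (∀ k : ℕ, 1 ≤ k → ∀ f g : RibbonFock.Fock (RatFunc ℚ),
      RibbonFock.scalarProduct (RibbonFock.V n RatFunc.X k f) g =
        RibbonFock.scalarProduct f (RibbonFock.U n RatFunc.X k g)) ∧
    -- at `q = 1`, `V_k` is multiplication by `ψ^n(h_k)`
    (∀ k : ℕ, 1 ≤ k → ∀ (N : ℕ) (f : RibbonFock.Fock ℚ),
      RibbonFock.toSym N (RibbonFock.V n (1 : ℚ) k f) =
        MvPolynomial.expand n (MvPolynomial.hsymm (Fin N) ℚ k) * RibbonFock.toSym N f) := by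
  have hq : (RatFunc.X : RatFunc ℚ) ≠ 0 := RatFunc.X_ne_zero
  -- The indeterminate is not a root of unity; this makes the `q`-integers in the Serre relations
  -- and the denominator `q - q⁻¹` invertible.
  have hroot : ∀ k : ℕ, 0 < k → (RatFunc.X : RatFunc ℚ) ^ k ≠ 1 := by
    intro k hk h
    rw [← RatFunc.algebraMap_X, ← map_pow, ← map_one (algebraMap (Polynomial ℚ) (RatFunc ℚ))] at h
    have h1 := congrArg Polynomial.natDegree (RatFunc.algebraMap_injective ℚ h)
    rw [Polynomial.natDegree_X_pow, Polynomial.natDegree_one] at h1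
    omega
  have hn1 : 1 ≤ n := by omega
  refine ⟨RibbonFock.exists_hayashiAction hn hq hroot, fun rho hrho => ⟨fun k _ => ⟨fun x hx =>
    ⟨?_, ?_⟩, ?_, ?_⟩, fun mu _ => ⟨RibbonFock.psiH_eq_foldl hq mu, fun i => ?_⟩⟩,
    fun k _ => RibbonFock.isAdjoint_V_U hq k, fun k _ N f => RibbonFock.toSym_V hn1 k N f⟩
  · exact RibbonFock.commute_of_mem_UqDerived hrho
      (fun i => (RibbonFock.V_commute_fockF_fockE hn hq k i).2)
      (fun i => (RibbonFock.V_commute_fockF_fockE hn hq k i).1)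
      (fun i => (RibbonFock.V_commute_fockH_inv hn hq k i).1) hx
  · exact RibbonFock.commute_of_mem_UqDerived hrho
      (fun i => (RibbonFock.U_commute hn hq k i).2.1) (fun i => (RibbonFock.U_commute hn hq k i).1)
      (fun i => (RibbonFock.U_commute hn hq k i).2.2) hx
  · rw [hrho.D, RibbonFock.fockD_mul_V hn1 hq]
  · rw [hrho.D, RibbonFock.fockD_mul_U hn1 hq]
  · rw [hrho.e, RibbonFock.fockE_psiH hn hq]
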